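/- Let $p$ be a prime, $\Gamma=\mathrm{SL}_2(\mathbb{Z}[1/p])$, and $\mathcal{H}_p=\mathbb{P}_1(\mathbb{C}_p)\setminus\mathbb{P}_1(\mathbb{Q}_p)$. A rigid meromorphic (resp. analytic) cocycle of weight $w$ is a map $J$ from $\mathbb{P}_1(\mathbb{Q})\times\mathbb{P}_1(\mathbb{Q})$ to the rigid meromorphic (resp. analytic) functions on $\mathcal{H}_p$ such that $J\{r,s\}=-J\{s,r\}$, $J\{r,s\}+J\{s,t\}=J\{r,t\}$, and $(cz+d)^{-w}J\{\gamma r,\gamma s\}\bigl(\tfrac{az+b}{cz+d}\bigr)=J\{r,s\}(z)$ for all $r,s,t\in\mathbb{P}_1(\mathbb{Q})$ and $\gamma=\begin{pmatrix}a&b\\c&d\end{pmatrix}\in\Gamma$. Its value $J\{0,\infty\}$ is called a rigid meromorphic (resp. analytic) period function of weight $w$. A point $\tau\in\mathcal{H}_p$ is an RM point if $\mathbb{Q}(\tau)$ is a real quadratic field; $\tau'$ denotes its Galois conjugate. For each RM point $\tau$ fix an embedding $\mathbb{Q}(\tau)\hookrightarrow\mathbb{R}$ and let $\Sigma_\tau(0,\infty)$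 be the set of $\omega\in\Gamma\tau$ with $\omega\omega'<0$. For such $\omega$ let $Q_\omega=[A,B,C]$ be the primitive integral binary quadratic form of discriminant $D_\omega>0$ with $Q_\omega(\omega,1)=0$ whose first root $(-B+\sqrt{D_\omega})/(2A)$ (positive real square root) is $\omega$ in $\mathbb{R}$; in $\mathbb{C}_p$, let $D_\omega^{1/2}\in\mathbb{Q}(\tau)$ be the square root that corresponds to the positive real one. Let $\gamma_{Q_\omega}\cdot(0,\infty)=\pm1$ be the intersection number of the hyperbolic geodesic from $\omega$ to $\omega'$ with the one from $0$ to $\infty$ ($+1$ if $\omega<0<\omega'$, $-1$ if $\omega'<0<\omega$). For an integer $k\ge1$ put $$\varphi_\tau(z)=\sum_{\omega\in\Sigma_\tau(0,\infty)}(\gamma_{Q_\omega}\cdot(0,\infty))\,\frac{D_\omega^{k/2}}{Q_\omega(z,1)^k}.$$ Theorem. Let $k\ge1$ be odd. The series defining $\varphi_\tau$ converges for every RM point $\tau$ at every $z\in\mathcal{H}_p$ (the finitely many terms with a pole at $z$ being omitted). Let $\phi$ be a rigid meromorphic period function of weight $2k$ such that, whenever an RM point $\tau$ is a pole of $\phi$,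 the conjugate $\tau'$ is also a pole of $\phi$ and $\mathrm{res}_\tau(\phi)=-\mathrm{res}_{\tau'}(\phi)$. Then there are finitely many RM points $\tau_1,\dots,\tau_m$, constants $c_1,\dots,c_m\in\mathbb{C}_p$ and a rigid analytic period function $\psi$ of weight $2k$ with $\phi=\sum_{i=1}^m c_i\varphi_{\tau_i}+\psi$. -/

import Mathlib

open Filter Topology Polynomial

noncomputable section

namespace RigidCocycle

variable (p : ℕ) [Fact p.Prime]

/-! ### Drinfeld's upper half-plane and rigid functions on it -/

/-- The `p`-adic upper half-plane `ℙ₁(ℂ_p) - ℙ₁(ℚ_p) = ℂ_p - ℚ_p`. -/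
def Hp : Set ℂ_[p] := (Set.range (algebraMap ℚ_[p] ℂ_[p]))ᶜ

/-- The affinoid of points reducing to vertices or edges of the Bruhat-Tits tree at distance at
most `n` from the standard vertex: the complement in `ℙ₁(ℂ_p)` of the `(p + 1) p ^ n` open discs
of radius `p ^ (-n)` centred at the points `(a : b)` of `ℙ₁(ℚ_p)`, `(a, b)` a primitive pair of
`p`-adic integers. -/
def affinoid (n : ℕ) : Set ℂ_[p] :=
  {z | ∀ a b : ℚ_[p], max ‖a‖ ‖b‖ = 1 →
    (p : ℝ)⁻¹ ^ n * max 1 ‖z‖ ≤ ‖algebraMap ℚ_[p] ℂ_[p] b * z - algebraMap ℚ_[p] ℂ_[p] a‖}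

/-- Analytic functions on the `n`-th affinoid: uniform limits of rational functions without
poles there. -/
def IsAnalyticOnAffinoid (n : ℕ) (f : ℂ_[p] → ℂ_[p]) : Prop :=
  ∀ ε : ℝ, 0 < ε → ∃ P Q : ℂ_[p][X], ∀ z ∈ affinoid p n,
    Q.eval z ≠ 0 ∧ ‖f z - P.eval z / Q.eval z‖ < ε

/-- `f` restricts to a rigid analytic function on `Hp` (values off `Hp` are irrelevant). -/
def IsRigidAnalytic (f : ℂ_[p] → ℂ_[p]) : Prop :=
  ∀ n : ℕ, IsAnalyticOnAffinoid p n f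

/-- Equality of meromorphic functions: `f` and `g` agree on `Hp` off a set that meets every
affinoid in finitely many points. Representatives are total functions, whose values at the poles
carry no information. -/
def MerEq (f g : ℂ_[p] → ℂ_[p]) : Prop :=
  ∀ n : ℕ, {z ∈ affinoid p n | f z ≠ g z}.Finite

/-- `f` represents a rigid meromorphic function on `Hp`: on every affinoid it has finitely many
poles, of finite order, i.e. after multiplication by a nonzero polynomial it agrees, off a finite
set, with an analytic function on that affinoid. -/
def IsRigidMeromorphic (f : ℂ_[p] → ℂ_[p]) : Prop :=
  ∀ n : ℕ, ∃ q : ℂ_[p][X], q ≠ 0 ∧ ∃ g : ℂ_[p] → ℂ_[p], IsAnalyticOnAffinoid p n g ∧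
    {z ∈ affinoid p n | q.eval z * f z ≠ g z}.Finite

variable {p}

/-- `τ` is a pole of `f`. -/
def IsPole (f : ℂ_[p] → ℂ_[p]) (τ : ℂ_[p]) : Prop := meromorphicOrderAt f τ < 0

/-- The Laurent expansion of `f` at `τ` exists, and its coefficient of `(z - τ)⁻¹` is `r`. -/
def HasResidueAt (f : ℂ_[p] → ℂ_[p]) (τ r : ℂ_[p]) : Prop :=
  ∃ (P : ℂ_[p][X]) (g : ℂ_[p] → ℂ_[p]), AnalyticAt ℂ_[p] g τ ∧
    (∀ᶠ z in 𝓝[≠] τ, f z = P.eval (z - τ)⁻¹ + g z) ∧ P.coeff 1 = r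

variable (p)

/-! ### The Ihara group, cocycles and period functions -/

/-- The Ihara group `SL₂(ℤ[1/p])`, inside `SL₂(ℚ)`. -/
def ihara : Subgroup (Matrix.SpecialLinearGroup (Fin 2) ℚ) :=
  (Matrix.SpecialLinearGroup.map
    (algebraMap (Algebra.adjoin ℤ {(p : ℚ)⁻¹}) ℚ)).range

variable {p}

/-- The Möbius transformation `z ↦ (a z + b) / (c z + d)` on `ℂ_p`. -/
def moebius (γ : Matrix.SpecialLinearGroup (Fin 2) ℚ) (z : ℂ_[p]) : ℂ_[p] :=
  ((γ 0 0 : ℂ_[p]) * z + (γ 0 1 : ℂ_[p])) / ((γ 1 0 : ℂ_[p]) * z + (γ 1 1 : ℂ_[p]))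

/-- The weight `w` action `(h|γ)(z) = (c z + d)^(-w) h((a z + b) / (c z + d))`. -/
def slash (w : ℕ) (h : ℂ_[p] → ℂ_[p]) (γ : Matrix.SpecialLinearGroup (Fin 2) ℚ) :
    ℂ_[p] → ℂ_[p] :=
  fun z => (((γ 1 0 : ℂ_[p]) * z + (γ 1 1 : ℂ_[p])) ^ w)⁻¹ * h (moebius γ z)

/-- The action of `SL₂(ℚ)` on `ℙ₁(ℚ) = ℚ ∪ {∞}`. -/
def actP1 (γ : Matrix.SpecialLinearGroup (Fin 2) ℚ) (r : OnePoint ℚ) : OnePoint ℚ :=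
  (γ : Matrix.GeneralLinearGroup (Fin 2) ℚ) • r

variable (p)

/-- Rigid meromorphic cocycles of weight `w`: `SL₂(ℤ[1/p])`-invariant modular symbols with values
in the rigid meromorphic functions on `Hp`. -/
structure IsMeromorphicCocycle (w : ℕ) (J : OnePoint ℚ → OnePoint ℚ → ℂ_[p] → ℂ_[p]) :
    Prop where
  meromorphic : ∀ r s, IsRigidMeromorphic p (J r s)
  antisymm : ∀ r s, MerEq p (J r s) (-J s r)
  add : ∀ r s t, MerEq p (J r s + J s t) (J r t)
  invariant : ∀ γ ∈ ihara p, ∀ r s, MerEq p (slash w (J (actP1 γ r) (actP1 γ s)) γ) (J r s)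

/-- Rigid analytic cocycles of weight `w`. -/
structure IsAnalyticCocycle (w : ℕ) (J : OnePoint ℚ → OnePoint ℚ → ℂ_[p] → ℂ_[p]) :
    Prop where
  analytic : ∀ r s, IsRigidAnalytic p (J r s)
  antisymm : ∀ r s, Set.EqOn (J r s) (-J s r) (Hp p)
  add : ∀ r s t, Set.EqOn (J r s + J s t) (J r t) (Hp p)
  invariant : ∀ γ ∈ ihara p, ∀ r s,
    Set.EqOn (slash w (J (actP1 γ r) (actP1 γ s)) γ) (J r s) (Hp p)

/-- Rigid meromorphic period functions: values at `{0, ∞}` of rigid meromorphic cocycles. -/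
def IsMeromorphicPeriod (w : ℕ) (φ : ℂ_[p] → ℂ_[p]) : Prop :=
  ∃ J, IsMeromorphicCocycle p w J ∧ MerEq p φ (J ((0 : ℚ) : OnePoint ℚ) OnePoint.infty)

/-- Rigid analytic period functions: values at `{0, ∞}` of rigid analytic cocycles. -/
def IsAnalyticPeriod (w : ℕ) (ψ : ℂ_[p] → ℂ_[p]) : Prop :=
  ∃ J, IsAnalyticCocycle p w J ∧ Set.EqOn ψ (J ((0 : ℚ) : OnePoint ℚ) OnePoint.infty) (Hp p)

/-! ### Real multiplication points -/

variable {p}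

/-- The field `ℚ(τ)`, inside `ℂ_p`. -/
abbrev fieldOf (τ : ℂ_[p]) : IntermediateField ℚ ℂ_[p] := IntermediateField.adjoin ℚ {τ}

/-- The Galois conjugate of an element of degree two over `ℚ`: the other root `- b - x` of its
minimal polynomial `X ^ 2 + b X + c`. -/
def galConj {L : Type*} [Field L] [Algebra ℚ L] (x : L) : L :=
  -algebraMap ℚ L ((minpoly ℚ x).coeff 1) - x

/-- `τ` is an RM point: `τ ∈ Hp` and `ℚ(τ)` is a real quadratic field. -/
def IsRM (τ : ℂ_[p]) : Prop :=
  τ ∈ Hp p ∧ Module.finrank ℚ (fieldOf τ) = 2 ∧ Nonempty (fieldOf τ →ₐ[ℚ] ℝ)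

variable (p) in
/-- The set of RM points, as a type. -/
abbrev RMPoint : Type := {τ : ℂ_[p] // IsRM τ}

/-! ### The functions `φ_τ` -/

/-- Integral binary quadratic forms `[A, B, C] = A x ^ 2 + B x y + C y ^ 2`. -/
structure QForm where
  A : ℤ
  B : ℤ
  C : ℤ

namespace QForm

def disc (Q : QForm) : ℤ := Q.B ^ 2 - 4 * Q.A * Q.C

def Primitive (Q : QForm) : Prop := Int.gcd (Int.gcd Q.A Q.B) Q.C = 1

/-- The value `Q(x, 1)`. -/
def eval {L : Type*} [Field L] (Q : QForm) (x : L) : L := Q.A * x ^ 2 + Q.B * x + Q.C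

/-- The first root `(-B + √D) / (2 A)`, with the positive square root. -/
def firstRoot (Q : QForm) : ℝ := (-(Q.B : ℝ) + √(Q.disc : ℝ)) / (2 * (Q.A : ℝ))

instance : Nonempty QForm := ⟨⟨0, 0, 0⟩⟩

end QForm

section

variable {K : IntermediateField ℚ ℂ_[p]}

/-- `Q` is a primitive integral form of positive discriminant that vanishes at `ω` and whose first
root is `ω`, where `K = ℚ(ω)` is embedded in `ℝ` through `ι`. -/
def IsFormOf (ι : K →ₐ[ℚ] ℝ) (ω : K) (Q : QForm) : Prop :=
  Q.Primitive ∧ 0 < Q.disc ∧ Q.eval ω = 0 ∧ ι ω = Q.firstRoot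

/-- The form `Q_ω` attached to `ω`; for `ω` of degree two it exists
(`exists_isFormOf`) and is unique, being determined up to sign by `ω`. -/
def formOf (ι : K →ₐ[ℚ] ℝ) (ω : K) : QForm := Classical.epsilon (IsFormOf ι ω)

/-- The square root `2 A ω + B` of the discriminant of `Q_ω = [A, B, C]` in `K`; see
`map_sqrtDisc`. -/
def sqrtDisc (ι : K →ₐ[ℚ] ℝ) (ω : K) : K :=
  2 * ((formOf ι ω).A : K) * ω + ((formOf ι ω).B : K)

theorem isFormOf_of_sq (ι : K →ₐ[ℚ] ℝ) (ω : K) (Q : QForm) (hA : Q.A ≠ 0) (hQ : Q.Primitive)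
    (h0 : Q.eval ω = 0) (hpos : 0 < 2 * (Q.A : ℝ) * ι ω + Q.B) : IsFormOf ι ω Q := by
  have e : (Q.A : ℝ) * ι ω ^ 2 + Q.B * ι ω + Q.C = 0 := by
    have := congrArg ι h0
    simpa [QForm.eval] using this
  have e2 : (Q.disc : ℝ) = (2 * (Q.A : ℝ) * ι ω + Q.B) ^ 2 := by
    simp only [QForm.disc]; push_cast; linear_combination -4 * (Q.A : ℝ) * e
  refine ⟨hQ, ?_, h0, ?_⟩
  · have : (0 : ℝ) < Q.disc := by rw [e2]; positivity
    exact_mod_cast this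
  · have hA' : (Q.A : ℝ) ≠ 0 := by exact_mod_cast hA
    rw [QForm.firstRoot, e2, Real.sqrt_sq hpos.le]
    field_simp
    ring

theorem exists_isFormOf (ι : K →ₐ[ℚ] ℝ) (ω : K) (h : (minpoly ℚ ω).natDegree = 2) :
    ∃ Q, IsFormOf ι ω Q := by
  have hint : IsIntegral ℚ ω := by
    by_contra hn
    rw [minpoly.eq_zero hn] at h; simp at h
  have hm := minpoly.monic hint
  have hev : ω ^ 2 + ((minpoly ℚ ω).coeff 1 : K) * ω + ((minpoly ℚ ω).coeff 0 : K) = 0 := by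
    have := minpoly.aeval ℚ ω
    rw [Polynomial.aeval_eq_sum_range, h] at this
    have h2 : (minpoly ℚ ω).coeff 2 = 1 := by rw [← h]; exact hm
    simp [Finset.sum_range_succ, h2, Algebra.smul_def] at this
    linear_combination this
  have hirr : ∀ q : ℚ, ω ≠ (q : K) := by
    rintro q rfl
    have := minpoly.eq_X_sub_C K q
    simp at this
    rw [this] at h; simp at h
  set b := (minpoly ℚ ω).coeff 1
  set c := (minpoly ℚ ω).coeff 0
  have hb : (b : K) * b.den = b.num := by 
    exact_mod_cast congrArg (Rat.cast : ℚ → K) (Rat.mul_den_eq_num b)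
  have hc : (c : K) * c.den = c.num := by 
    exact_mod_cast congrArg (Rat.cast : ℚ → K) (Rat.mul_den_eq_num c)
  set A0 : ℤ := b.den * c.den
  set B0 : ℤ := b.num * c.den
  set C0 : ℤ := c.num * b.den
  have hA0 : A0 ≠ 0 := by simp [A0]
  have h1 : (A0 : K) * ω ^ 2 + B0 * ω + C0 = 0 := by
    simp only [A0, B0, C0]; push_cast
    rw [← hb, ← hc]
    linear_combination ((b.den : K) * c.den) * hev
  have key : ∀ s : ℤ, s = 1 ∨ s = -1 → ∃ Q : QForm, Q.A ≠ 0 ∧ Q.Primitive ∧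
      ∃ g : ℤ, 0 < g ∧ s * A0 = g * Q.A ∧ s * B0 = g * Q.B ∧ s * C0 = g * Q.C := by
    intro s hs
    obtain ⟨⟨A1, hA1⟩, ⟨B1, hB1⟩, ⟨C1, hC1⟩⟩ :
      ((Int.gcd (Int.gcd A0 B0) C0 : ℤ) ∣ A0) ∧ ((Int.gcd (Int.gcd A0 B0) C0 : ℤ) ∣ B0) ∧
      ((Int.gcd (Int.gcd A0 B0) C0 : ℤ) ∣ C0) :=
      ⟨(Int.gcd_dvd_left ..).trans (Int.gcd_dvd_left ..),
        (Int.gcd_dvd_left ..).trans (Int.gcd_dvd_right ..), Int.gcd_dvd_right ..⟩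
    set g := Int.gcd (Int.gcd A0 B0) C0 with hg
    have hgpos : 0 < g := by
      rcases Nat.eq_zero_or_pos g with h | h
      · rw [h] at hA1; simp at hA1; exact absurd hA1 hA0
      · exact h
    have hs0 : s.natAbs = 1 := by rcases hs with rfl | rfl <;> rfl
    refine ⟨⟨s * A1, s * B1, s * C1⟩, ?_, ?_, g, by exact_mod_cast hgpos, ?_, ?_, ?_⟩
    · intro h; apply hA0; rw [hA1]
      rcases hs with rfl | rfl <;> simp at h <;> simp [h]
    · have : g = g * Int.gcd (Int.gcd A1 B1) C1 := by
        conv_lhs => rw [hg, hA1, hB1, hC1]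
        simp [Int.gcd_mul_left]
      have h1 : Int.gcd (Int.gcd A1 B1) C1 = 1 :=
        Nat.eq_of_mul_eq_mul_left hgpos (by omega)
      simp [QForm.Primitive, Int.gcd_mul_left, hs0]
      rcases hs with rfl | rfl <;> simpa using h1
    all_goals simp only []
    · rw [hA1]; ring
    · rw [hB1]; ring
    · rw [hC1]; ring
  have hne : 2 * (A0 : ℝ) * ι ω + B0 ≠ 0 := by
    intro h0
    have hA : (A0 : ℝ) ≠ 0 := by exact_mod_cast hA0
    apply hirr (-(B0 : ℚ) / (2 * A0))
    apply ι.injective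
    push_cast
    simp
    field_simp
    rw [map_ofNat]
    linear_combination h0
  obtain ⟨s, hs, hpos⟩ : ∃ s : ℤ, (s = 1 ∨ s = -1) ∧ 0 < (s : ℝ) * (2 * (A0 : ℝ) * ι ω + B0) := by
    rcases lt_or_gt_of_ne hne with h | h
    · exact ⟨-1, Or.inr rfl, by push_cast; linarith⟩
    · exact ⟨1, Or.inl rfl, by push_cast; linarith⟩
  obtain ⟨Q, hQA, hQ, g, hg, eA, eB, eC⟩ := key s hs
  have hg' : (0 : ℝ) < g := by exact_mod_cast hg
  refine ⟨Q, isFormOf_of_sq ι ω Q hQA hQ ?_ ?_⟩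
  · have hgK : (g : K) ≠ 0 := by exact_mod_cast hg.ne'
    apply mul_left_cancel₀ hgK
    have eA' : (s : K) * A0 = g * Q.A := by exact_mod_cast congrArg (Int.cast : ℤ → K) eA
    have eB' : (s : K) * B0 = g * Q.B := by exact_mod_cast congrArg (Int.cast : ℤ → K) eB
    have eC' : (s : K) * C0 = g * Q.C := by exact_mod_cast congrArg (Int.cast : ℤ → K) eC
    simp only [QForm.eval]
    linear_combination (s : K) * h1 - ω ^ 2 * eA' - ω * eB' - eC'
  · have eA' : (s : ℝ) * A0 = g * Q.A := by exact_mod_cast congrArg (Int.cast : ℤ → ℝ) eA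
    have eB' : (s : ℝ) * B0 = g * Q.B := by exact_mod_cast congrArg (Int.cast : ℤ → ℝ) eB
    have : (s : ℝ) * (2 * (A0 : ℝ) * ι ω + B0) = g * (2 * (Q.A : ℝ) * ι ω + Q.B) := by
      linear_combination 2 * ι ω * eA' + eB'
    rw [this] at hpos
    exact pos_of_mul_pos_right hpos hg'.le

/-- `sqrtDisc` corresponds under `ι` to the positive square root of the discriminant. -/
theorem map_sqrtDisc (ι : K →ₐ[ℚ] ℝ) (ω : K) (h : (minpoly ℚ ω).natDegree = 2) :
    ι (sqrtDisc ι ω) = √((formOf ι ω).disc : ℝ) := by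
  have hf : IsFormOf ι ω (formOf ι ω) :=
    Classical.epsilon_spec (exists_isFormOf ι ω h)
  simp only [sqrtDisc, map_add, map_mul, map_intCast, map_ofNat]
  have h0 := hf.2.2.2
  have hA : ((formOf ι ω).A : ℝ) ≠ 0 := by
    intro hA
    simp [QForm.firstRoot, hA] at h0
    rw [h0] at h
    simp [minpoly.zero] at h
  rw [QForm.firstRoot] at h0
  rw [h0]
  field_simp
  ring

/-- The intersection number of the hyperbolic geodesic going from `a` to `b` with the one going
from `0` to `∞`, for real `a`, `b` (the upper half-plane has its usual orientation; a geodesic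
going from the negative to the positive half-line crosses `(0, ∞)` positively). -/
def crossing (a b : ℝ) : ℤ :=
  if a < 0 ∧ 0 < b then 1 else if b < 0 ∧ 0 < a then -1 else 0

end

/-- The set `Σ_τ(0, ∞)` of points `ω` in the orbit of `τ` under `SL₂(ℤ[1/p])` with `ω ω' < 0`;
all such points lie in `ℚ(τ)`. -/
def linked (τ : ℂ_[p]) (ι : fieldOf τ →ₐ[ℚ] ℝ) : Set (fieldOf τ) :=
  {ω | (∃ γ ∈ ihara p, (ω : ℂ_[p]) = moebius γ τ) ∧ ι ω * ι (galConj ω) < 0}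

/-- The term `(γ_{Q_ω} · (0, ∞)) D_ω^(k/2) / Q_ω(z, 1)^k`. -/
def phiTerm (k : ℕ) (τ : ℂ_[p]) (ι : fieldOf τ →ₐ[ℚ] ℝ) (z : ℂ_[p]) (ω : linked τ ι) :
    ℂ_[p] :=
  (crossing (ι ω) (ι (galConj (ω : fieldOf τ))) : ℂ_[p]) *
    (sqrtDisc ι (ω : fieldOf τ) : ℂ_[p]) ^ k / (formOf ι (ω : fieldOf τ)).eval z ^ k

/-- The function `φ_τ`, formed with the real embedding `ι` of `ℚ(τ)`. -/
def phi (k : ℕ) (τ : ℂ_[p]) (ι : fieldOf τ →ₐ[ℚ] ℝ) (z : ℂ_[p]) : ℂ_[p] :=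
  ∑' ω : linked τ ι, phiTerm k τ ι z ω

end RigidCocycle

end

/-! The proof finds where the poles of a cocycle `J` lie, determines their principal parts, and
cancels them one orbit at a time.

Location. Both summands of J{0,∞} = J{0,1} + J{1,∞} are translates of J{0,∞} under `SL₂(ℤ)`, which
preserves every affinoid. So a pole of J{0,∞} is the image of another pole in the same affinoid
under one of two unipotent matrices. As there are only finitely many poles there, iteration ends in
a cycle, and the pole `w` is fixed by a hyperbolic `g`. The same argument applied to `-1/w` shows
that 0 and ∞ separate the two real fixed points of `g` (`RegSystem.exists_fix`); in particular `w`
is an RM point. A Farey path staying on one side of the fixed geodesic then shows that J{r,s} is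
regular at `w` whenever that geodesic does not separate `r` from `s` (`RegSystem.reg_of_same_sign`).

Shape. Consequently J{0,∞} and J{g0,g∞} differ by a function regular at `w`, so f = J{0,∞} is
`g`-invariant of weight 2k up to a regular function. The kernel h = `hker w w'` has weight 2 for
`g`, hence f/h^k is invariant modulo (z-w)^k. The multiplier of `g` at `w` is not a root of unity,
which forces f/h^k to be a constant `b` modulo (z-w)^k: the principal part of `f` is that of b h^k
(`exists_reg_sub_hker`). For odd `k` the residues of h^k at `w` and `w'` are nonzero and opposite,
so the residue hypothesis says exactly that the same `b` serves at both points (`Balanced`).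

Cancellation. φ_τ is the value at {0,∞} of a cocycle summed over the whole orbit of τ, weighted by
intersection numbers (`orbCocycle`). It converges because D·|D|_p is constant on the orbit, while
only finitely many forms of bounded discriminant take opposite signs at `r` and `s`: along the
contributing terms D tends to 0 `p`-adically. At τ and τ' its principal part is a nonzero multiple
of that of h^k. Subtracting a suitable multiple makes J{0,∞} regular at τ and τ'; then all J{r,s}
are regular there, and by equivariance along both orbits, so no pole is created
(`exists_remove_pole`). Every point of `Hp` is equivalent to one of `affinoid p 1`, which contains
finitely many poles of J{0,∞}. After finitely many subtractions none is left, and the remaining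
cocycle extends analytically. -/

noncomputable section

namespace RigidCocycle

variable {p : ℕ} [Fact p.Prime]

/-! ### Möbius transformations over an arbitrary field -/

/-- The Möbius transformation attached to a rational matrix, over any field. -/
def mob {L : Type*} [Field L] (γ : Matrix.SpecialLinearGroup (Fin 2) ℚ) (x : L) : L :=
  ((γ 0 0 : L) * x + (γ 0 1 : L)) / ((γ 1 0 : L) * x + (γ 1 1 : L))

/-- The automorphy factor `c x + d`. -/
def aut {L : Type*} [Field L] (γ : Matrix.SpecialLinearGroup (Fin 2) ℚ) (x : L) : L :=
  (γ 1 0 : L) * x + (γ 1 1 : L)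

theorem moebius_eq_mob (γ : Matrix.SpecialLinearGroup (Fin 2) ℚ) (z : ℂ_[p]) :
    moebius γ z = mob γ z := rfl

theorem slash_apply (w : ℕ) (h : ℂ_[p] → ℂ_[p]) (γ : Matrix.SpecialLinearGroup (Fin 2) ℚ)
    (z : ℂ_[p]) : slash w h γ z = (aut γ z ^ w)⁻¹ * h (mob γ z) := rfl

section field

variable {L : Type*} [Field L]

theorem mob_one (x : L) : mob 1 x = x := by simp [mob]

theorem map_mob {L' : Type*} [Field L'] (f : L →+* L') (γ : Matrix.SpecialLinearGroup (Fin 2) ℚ)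
    (x : L) : f (mob γ x) = mob γ (f x) := by
  simp [mob, map_div₀]

variable [CharZero L]

theorem det_cast (γ : Matrix.SpecialLinearGroup (Fin 2) ℚ) :
    (γ 0 0 : L) * γ 1 1 - (γ 0 1 : L) * γ 1 0 = 1 := by
  have := γ.det_coe
  rw [Matrix.det_fin_two] at this
  exact_mod_cast congrArg (Rat.cast : ℚ → L) this

theorem aut_ne_zero (γ : Matrix.SpecialLinearGroup (Fin 2) ℚ) {x : L}
    (hx : ∀ q : ℚ, x ≠ q) : aut γ x ≠ 0 := by
  intro h
  unfold aut at h
  have hd := det_cast (L := L) γ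
  by_cases hc : (γ 1 0 : L) = 0
  · rw [hc] at h hd
    simp at h
    rw [h] at hd
    simp at hd
  · apply hx (-(γ 1 1) / γ 1 0)
    push_cast
    field_simp
    linear_combination h

theorem mob_mul (γ δ : Matrix.SpecialLinearGroup (Fin 2) ℚ) {x : L} (hx : aut δ x ≠ 0) :
    mob (γ * δ) x = mob γ (mob δ x) := by
  unfold mob
  unfold aut at hx
  simp only [Matrix.SpecialLinearGroup.coe_mul, Matrix.mul_apply, Fin.sum_univ_two]
  push_cast
  have e1 : ∀ u v : ℚ, (u : L) * (((δ 0 0 : L) * x + δ 0 1) / ((δ 1 0 : L) * x + δ 1 1)) + v =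
      (u * ((δ 0 0 : L) * x + δ 0 1) + v * ((δ 1 0 : L) * x + δ 1 1)) /
        ((δ 1 0 : L) * x + δ 1 1) := by
    intro u v
    rw [eq_div_iff hx, add_mul, mul_assoc, div_mul_cancel₀ _ hx]
  rw [e1, e1, div_div_div_cancel_right₀ hx]
  congr 1 <;> ring

theorem aut_mul (γ δ : Matrix.SpecialLinearGroup (Fin 2) ℚ) {x : L} (hx : aut δ x ≠ 0) :
    aut (γ * δ) x = aut γ (mob δ x) * aut δ x := by
  unfold aut mob at *
  simp only [Matrix.SpecialLinearGroup.coe_mul, Matrix.mul_apply, Fin.sum_univ_two]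
  push_cast
  field_simp
  ring

theorem mob_inv_mob (γ : Matrix.SpecialLinearGroup (Fin 2) ℚ) {x : L} (hx : aut γ x ≠ 0) :
    mob γ⁻¹ (mob γ x) = x := by
  rw [← mob_mul _ _ hx, inv_mul_cancel, mob_one]

theorem mob_irrational (γ : Matrix.SpecialLinearGroup (Fin 2) ℚ) {x : L}
    (hx : ∀ q : ℚ, x ≠ q) (q : ℚ) : mob γ x ≠ q := by
  intro h
  have h0 := aut_ne_zero γ hx
  unfold mob at h
  unfold aut at h0
  rw [div_eq_iff h0] at h
  have hd := det_cast (L := L) γ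
  by_cases hc : (γ 0 0 : L) - q * γ 1 0 = 0
  · have : (γ 0 1 : L) = q * γ 1 1 := by linear_combination h - x * hc
    have hz : (1 : L) = 0 := by
      linear_combination -hd + γ 1 1 * hc - γ 1 0 * this
    exact one_ne_zero hz
  · apply hx ((q * γ 1 1 - γ 0 1) / (γ 0 0 - q * γ 1 0))
    push_cast
    field_simp
    linear_combination h

theorem mob_sub_mob (γ : Matrix.SpecialLinearGroup (Fin 2) ℚ) {x y : L} (hx : aut γ x ≠ 0)
    (hy : aut γ y ≠ 0) : mob γ x - mob γ y = (x - y) / (aut γ x * aut γ y) := by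
  have hd := det_cast (L := L) γ
  unfold mob
  unfold aut at *
  rw [div_sub_div _ _ hx hy]
  congr 1
  linear_combination (x - y) * hd

end field

/-! ### Geometry of the affinoids -/

theorem norm_intCast_le_one (n : ℤ) : ‖(n : ℂ_[p])‖ ≤ 1 := by
  have : (n : ℂ_[p]) = algebraMap ℚ_[p] ℂ_[p] (n : ℚ_[p]) := by simp
  rw [this, norm_algebraMap']
  exact Padic.norm_int_le_one n

theorem norm_natCast_eq (n : ℕ) : ‖(n : ℂ_[p])‖ = ‖(n : ℚ_[p])‖ := by
  have : (n : ℂ_[p]) = algebraMap ℚ_[p] ℂ_[p] (n : ℚ_[p]) := by simp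
  rw [this, norm_algebraMap']

theorem norm_intCast_eq (n : ℤ) : ‖(n : ℂ_[p])‖ = ‖(n : ℚ_[p])‖ := by
  have : (n : ℂ_[p]) = algebraMap ℚ_[p] ℂ_[p] (n : ℚ_[p]) := by simp
  rw [this, norm_algebraMap']

theorem norm_p : ‖(p : ℂ_[p])‖ = (p : ℝ)⁻¹ := by
  rw [norm_natCast_eq, Padic.norm_p]

theorem ratCast_eq_algebraMap (q : ℚ) : (q : ℂ_[p]) = algebraMap ℚ_[p] ℂ_[p] (q : ℚ_[p]) := by
  simp

theorem Hp.ne_ratCast {z : ℂ_[p]} (hz : z ∈ Hp p) (q : ℚ) : z ≠ q := by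
  rintro rfl
  exact hz ⟨(q : ℚ_[p]), by simp⟩

theorem p_pos : (0 : ℝ) < p := by exact_mod_cast (Fact.out : p.Prime).pos

theorem one_lt_p : (1 : ℝ) < p := by exact_mod_cast (Fact.out : p.Prime).one_lt

theorem inv_p_pow_pos (n : ℕ) : (0 : ℝ) < (p : ℝ)⁻¹ ^ n := pow_pos (inv_pos.2 p_pos) n

theorem inv_p_pow_le_one (n : ℕ) : (p : ℝ)⁻¹ ^ n ≤ 1 :=
  pow_le_one₀ (inv_pos.2 p_pos).le (inv_le_one_of_one_le₀ one_lt_p.le)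

theorem le_norm_of_mem_affinoid {n : ℕ} {z : ℂ_[p]} (hz : z ∈ affinoid p n) (a b : ℚ_[p]) :
    (p : ℝ)⁻¹ ^ n * max 1 ‖z‖ * max ‖a‖ ‖b‖ ≤
      ‖algebraMap ℚ_[p] ℂ_[p] b * z - algebraMap ℚ_[p] ℂ_[p] a‖ := by
  obtain ⟨c, hc⟩ : ∃ c : ℚ_[p], ‖c‖ = max ‖a‖ ‖b‖ := by
    rcases max_choice ‖a‖ ‖b‖ with h | h
    · exact ⟨a, h.symm⟩
    · exact ⟨b, h.symm⟩
  by_cases h0 : c = 0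
  · rw [← hc, h0]; simp
  have hcn : ‖c‖ ≠ 0 := by simpa using h0
  have hcp : 0 < ‖c‖ := by positivity
  have := hz (a / c) (b / c) (by
    rw [norm_div, norm_div, max_div_div_right hcp.le, ← hc, div_self hcn])
  have e : algebraMap ℚ_[p] ℂ_[p] b * z - algebraMap ℚ_[p] ℂ_[p] a =
      algebraMap ℚ_[p] ℂ_[p] c * (algebraMap ℚ_[p] ℂ_[p] (b / c) * z -
        algebraMap ℚ_[p] ℂ_[p] (a / c)) := by
    have : algebraMap ℚ_[p] ℂ_[p] c ≠ 0 := by simpa using h0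
    simp only [map_div₀]
    field_simp
  rw [e, norm_mul, norm_algebraMap', ← hc, mul_comm]
  gcongr

theorem affinoid_subset_Hp (n : ℕ) : affinoid p n ⊆ Hp p := by
  rintro z hz ⟨a, rfl⟩
  have := le_norm_of_mem_affinoid hz a 1
  simp only [map_one, one_mul, sub_self, norm_zero] at this
  have h2 : 0 < (p : ℝ)⁻¹ ^ n * max 1 ‖algebraMap ℚ_[p] ℂ_[p] a‖ * max ‖a‖ ‖(1 : ℚ_[p])‖ := by
    have := inv_p_pow_pos (p := p) n
    have h1 : (0 : ℝ) < max ‖a‖ ‖(1 : ℚ_[p])‖ := lt_max_of_lt_right (by simp)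
    have h3 : (0 : ℝ) < max 1 ‖algebraMap ℚ_[p] ℂ_[p] a‖ := lt_max_of_lt_left (by simp)
    positivity
  linarith

theorem norm_le_of_mem_affinoid {n : ℕ} {z : ℂ_[p]} (hz : z ∈ affinoid p n) :
    ‖z‖ ≤ (p : ℝ) ^ n := by
  have h := hz 1 0 (by simp)
  simp only [map_zero, zero_mul, map_one, zero_sub, norm_neg, norm_one] at h
  have h2 : (p : ℝ)⁻¹ ^ n * ‖z‖ ≤ 1 :=
    le_trans (by have := inv_p_pow_pos (p := p) n; gcongr; exact le_max_right _ _) h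
  rw [inv_pow] at h2
  have := pow_pos (p_pos (p := p)) n
  rwa [inv_mul_le_iff₀ this, mul_one] at h2

/-- With |b| ≤ 1, moving `z` by less than p^(-n) changes bz - a by less than |bz - a| itself, so the
norm does not change. Thus the affinoid is a union of open discs of radius p^(-n), and any point
outside is at distance at least p^(-n) from it. -/
theorem mem_affinoid_of_norm_sub_lt {n : ℕ} {z w : ℂ_[p]} (hz : z ∈ affinoid p n)
    (h : ‖w - z‖ < (p : ℝ)⁻¹ ^ n) : w ∈ affinoid p n := by
  intro a b hab
  have hz' := hz a b hab
  have hle := inv_p_pow_le_one (p := p) n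
  have hpos := inv_p_pow_pos (p := p) n
  have hw1 : max 1 ‖w‖ ≤ max 1 ‖z‖ := by
    refine max_le (le_max_left _ _) ?_
    have : ‖w‖ ≤ max ‖w - z‖ ‖z‖ := by
      simpa using IsUltrametricDist.norm_add_le_max (w - z) z
    exact this.trans (max_le_max (h.le.trans hle) le_rfl)
  have hb : ‖b‖ ≤ 1 := hab ▸ le_max_right _ _
  set x := algebraMap ℚ_[p] ℂ_[p] b * z - algebraMap ℚ_[p] ℂ_[p] a
  have e : algebraMap ℚ_[p] ℂ_[p] b * w - algebraMap ℚ_[p] ℂ_[p] a =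
      x + algebraMap ℚ_[p] ℂ_[p] b * (w - z) := by simp only [x]; ring
  have hx : (p : ℝ)⁻¹ ^ n ≤ ‖x‖ := by
    refine le_trans ?_ hz'
    exact le_mul_of_one_le_right hpos.le (le_max_left _ _)
  have hlt : ‖algebraMap ℚ_[p] ℂ_[p] b * (w - z)‖ < ‖x‖ := by
    rw [norm_mul, norm_algebraMap']
    refine lt_of_le_of_lt ?_ (h.trans_le hx)
    exact mul_le_of_le_one_left (norm_nonneg _) hb
  rw [e, IsUltrametricDist.norm_add_eq_max_of_norm_ne_norm hlt.ne', max_eq_left hlt.le]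
  refine le_trans ?_ hz'
  gcongr

theorem affinoid_mem_nhds {n : ℕ} {z : ℂ_[p]} (hz : z ∈ affinoid p n) : affinoid p n ∈ 𝓝 z := by
  refine Metric.mem_nhds_iff.2 ⟨_, inv_p_pow_pos (p := p) n, fun w hw ↦ ?_⟩
  rw [Metric.mem_ball, dist_eq_norm] at hw
  exact mem_affinoid_of_norm_sub_lt hz hw

theorem exists_pos_le_norm_sub {z : ℂ_[p]} (hz : z ∈ Hp p) :
    ∃ δ > 0, ∀ a : ℚ_[p], δ ≤ ‖z - algebraMap ℚ_[p] ℂ_[p] a‖ := by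
  have hcl : IsClosed (Set.range (algebraMap ℚ_[p] ℂ_[p])) :=
    (algebraMap_isometry ℚ_[p] ℂ_[p]).isClosedEmbedding.isClosed_range
  obtain ⟨δ, hδ, h⟩ := Metric.isOpen_iff.1 hcl.isOpen_compl z hz
  refine ⟨δ, hδ, fun a ↦ ?_⟩
  by_contra hlt
  have hm : algebraMap ℚ_[p] ℂ_[p] a ∉ Metric.ball z δ := fun hm ↦ h hm ⟨a, rfl⟩
  apply hm
  rw [Metric.mem_ball, dist_comm, dist_eq_norm]
  exact not_le.1 hlt

/-- ℚ_p is closed in ℂ_p, so `z` keeps a distance δ from it. If |b| is so small that |bz| < 1 then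
|bz - a| = |a| = 1; otherwise bz - a = b(z - a/b) is bounded below through δ. -/
theorem exists_mem_affinoid {z : ℂ_[p]} (hz : z ∈ Hp p) : ∃ n, z ∈ affinoid p n := by
  obtain ⟨δ, hδ, h⟩ := exists_pos_le_norm_sub hz
  set R := max 1 ‖z‖
  have hR : 0 < R := lt_max_of_lt_left one_pos
  obtain ⟨n, hn⟩ := exists_pow_lt_of_lt_one (show 0 < min 1 (δ / R) / R by positivity)
    (inv_lt_one_of_one_lt₀ (one_lt_p (p := p)))
  refine ⟨n, fun a b hab ↦ ?_⟩
  rw [lt_div_iff₀ hR] at hn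
  refine hn.le.trans ?_
  by_cases hbz : ‖b‖ * R < 1
  · have hb1 : ‖b‖ < 1 := lt_of_le_of_lt (le_mul_of_one_le_right (norm_nonneg _)
      (le_max_left _ _)) hbz
    have ha : ‖a‖ = 1 := by
      rcases max_choice ‖a‖ ‖b‖ with h | h <;> rw [h] at hab
      · exact hab
      · linarith
    have hlt : ‖algebraMap ℚ_[p] ℂ_[p] b * z‖ < ‖algebraMap ℚ_[p] ℂ_[p] a‖ := by
      rw [norm_mul, norm_algebraMap', norm_algebraMap', ha]
      exact lt_of_le_of_lt (by gcongr; exact le_max_right _ _) hbz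
    rw [sub_eq_add_neg, IsUltrametricDist.norm_add_eq_max_of_norm_ne_norm (by
      rw [norm_neg]; exact hlt.ne), norm_neg, max_eq_right hlt.le, norm_algebraMap', ha]
    exact min_le_left _ _
  · refine (min_le_right _ _).trans ?_
    have hb : b ≠ 0 := by rintro rfl; simp at hbz
    have hb' : algebraMap ℚ_[p] ℂ_[p] b ≠ 0 := by simpa using hb
    have e : algebraMap ℚ_[p] ℂ_[p] b * z - algebraMap ℚ_[p] ℂ_[p] a =
      algebraMap ℚ_[p] ℂ_[p] b * (z - algebraMap ℚ_[p] ℂ_[p] (a / b)) := by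
      simp only [map_div₀]; field_simp
    rw [e, norm_mul, norm_algebraMap', div_le_iff₀ hR]
    have := h (a / b)
    calc δ ≤ ‖z - algebraMap ℚ_[p] ℂ_[p] (a / b)‖ * 1 := by rw [mul_one]; exact this
      _ ≤ ‖z - algebraMap ℚ_[p] ℂ_[p] (a / b)‖ * (‖b‖ * R) := by gcongr; exact not_lt.1 hbz
      _ = _ := by ring

theorem isOpen_Hp : IsOpen (Hp p) := by
  rw [isOpen_iff_mem_nhds]
  intro z hz
  obtain ⟨n, hn⟩ := exists_mem_affinoid hz
  exact Filter.mem_of_superset (affinoid_mem_nhds hn) (affinoid_subset_Hp n)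

theorem mob_mem_Hp (γ : Matrix.SpecialLinearGroup (Fin 2) ℚ) {z : ℂ_[p]} (hz : z ∈ Hp p) :
    mob γ z ∈ Hp p := by
  rintro ⟨a, ha⟩
  apply hz
  refine ⟨mob γ⁻¹ a, ?_⟩
  have h0 := aut_ne_zero γ (Hp.ne_ratCast hz)
  rw [map_mob, ha, mob_inv_mob γ h0]

theorem aut_ne_zero_of_mem_Hp (γ : Matrix.SpecialLinearGroup (Fin 2) ℚ) {z : ℂ_[p]}
    (hz : z ∈ Hp p) : aut γ z ≠ 0 := aut_ne_zero γ (Hp.ne_ratCast hz)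

/-! ### Functions on the closed unit disc -/

theorem norm_sub_le_max' (x y : ℂ_[p]) : ‖x - y‖ ≤ max ‖x‖ ‖y‖ := by
  simpa [sub_eq_add_neg] using IsUltrametricDist.norm_add_le_max x (-y)

/-- Uniform limits of polynomials on the closed unit disc. -/
def IsTate (F : ℂ_[p] → ℂ_[p]) : Prop :=
  ∀ ε : ℝ, 0 < ε → ∃ P : ℂ_[p][X], ∀ x, ‖x‖ ≤ 1 → ‖F x - P.eval x‖ < ε

/-- The Cauchy estimate: averaging P(ζ)ζ^(-i) over the `N`-th roots of unity isolates the `i`-th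
coefficient, and the division by `N` costs nothing when `p` does not divide `N`. -/
theorem norm_coeff_le_of_norm_eval_le {P : ℂ_[p][X]} {ε : ℝ}
    (h : ∀ x, ‖x‖ ≤ 1 → ‖P.eval x‖ ≤ ε) (i : ℕ) : ‖P.coeff i‖ ≤ ε := by
  have hε : 0 ≤ ε := (norm_nonneg _).trans (h 0 (by simp))
  by_cases hi : P.natDegree < i
  · rw [coeff_eq_zero_of_natDegree_lt hi]; simpa
  -- Larger than the degree, so that no two exponents of `P` agree modulo `N`, and congruent to 1
  -- modulo `p`, so that |N| = 1.
  set N := p * (P.natDegree + 1) + 1 with hN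
  have hp := (Fact.out : p.Prime).pos
  have hdN : P.natDegree < N := by
    have : P.natDegree + 1 ≤ p * (P.natDegree + 1) := Nat.le_mul_of_pos_left _ hp
    omega
  have hN0 : N ≠ 0 := by omega
  have hNK : (N : ℂ_[p]) ≠ 0 := by exact_mod_cast hN0
  have hNn : ‖(N : ℂ_[p])‖ = 1 := by
    rw [norm_natCast_eq, Padic.norm_natCast_eq_one_iff, hN]
    simp
  have : NeZero (N : ℂ_[p]) := ⟨hNK⟩
  obtain ⟨ζ, hζ⟩ := HasEnoughRootsOfUnity.exists_primitiveRoot ℂ_[p] N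
  have hζn : ‖ζ‖ = 1 := (hζ.isOfFinOrder hN0).norm_eq_one
  have hsum : ∑ j ∈ Finset.range N, P.eval (ζ ^ j) * (ζ ^ j) ^ (N - i) = N * P.coeff i := by
    have e1 : ∀ j, P.eval (ζ ^ j) * (ζ ^ j) ^ (N - i) =
        ∑ m ∈ Finset.range N, P.coeff m * (ζ ^ (m + (N - i))) ^ j := by
      intro j
      rw [eval_eq_sum_range' hdN, Finset.sum_mul]
      refine Finset.sum_congr rfl fun m _ ↦ ?_
      rw [mul_assoc, ← pow_add, ← pow_mul, ← pow_mul, mul_comm j]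
    simp_rw [e1]
    rw [Finset.sum_comm, Finset.sum_eq_single i]
    · have : i + (N - i) = N := by omega
      rw [this, hζ.pow_eq_one]
      simp [mul_comm]
    · intro m hm hmi
      rw [← Finset.mul_sum]
      have hne : ζ ^ (m + (N - i)) ≠ 1 := by
        intro h1
        have hd := hζ.dvd_of_pow_eq_one _ h1
        have hm' := Finset.mem_range.1 hm
        obtain ⟨q, hq⟩ := hd
        have : q = 1 := by
          rcases Nat.lt_or_ge q 2 with h | h
          · interval_cases q
            · omega
            · rfl
          · have := Nat.mul_le_mul_left N h
            omega
        subst this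
        omega
      have hg := geom_sum_mul (ζ ^ (m + (N - i))) N
      rw [← pow_mul, mul_comm _ N, pow_mul, hζ.pow_eq_one, one_pow, sub_self] at hg
      rcases mul_eq_zero.1 hg with h | h
      · rw [h, mul_zero]
      · exact absurd (sub_eq_zero.1 h) hne
    · intro h
      exact absurd (Finset.mem_range.2 (by omega)) h
  have : ‖∑ j ∈ Finset.range N, P.eval (ζ ^ j) * (ζ ^ j) ^ (N - i)‖ ≤ ε := by
    refine IsUltrametricDist.norm_sum_le_of_forall_le_of_nonneg hε fun j _ ↦ ?_
    rw [norm_mul, norm_pow, norm_pow, hζn, one_pow, one_pow, mul_one]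
    exact h _ (by rw [norm_pow, hζn, one_pow])
  rwa [hsum, norm_mul, hNn, one_mul] at this

theorem IsTate.of_poly (P : ℂ_[p][X]) : IsTate fun x ↦ P.eval x :=
  fun ε hε ↦ ⟨P, fun x _ ↦ by simpa⟩

theorem IsTate.of_limit {F : ℂ_[p] → ℂ_[p]}
    (h : ∀ ε : ℝ, 0 < ε → ∃ G, IsTate G ∧ ∀ x, ‖x‖ ≤ 1 → ‖F x - G x‖ < ε) : IsTate F := by
  intro ε hε
  obtain ⟨G, hG, h1⟩ := h ε hε
  obtain ⟨P, hP⟩ := hG ε hε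
  refine ⟨P, fun x hx ↦ ?_⟩
  rw [← sub_add_sub_cancel _ (G x)]
  exact (IsUltrametricDist.norm_add_le_max _ _).trans_lt (max_lt (h1 x hx) (hP x hx))

theorem norm_eval_le (P : ℂ_[p][X]) (R : ℝ) :
    ∃ M : ℝ, 0 < M ∧ ∀ x, ‖x‖ ≤ R → ‖P.eval x‖ ≤ M := by
  induction P using Polynomial.induction_on' with
  | add P Q hP hQ =>
    obtain ⟨M, hM, h1⟩ := hP
    obtain ⟨M', hM', h2⟩ := hQ
    refine ⟨M + M', by positivity, fun x hx ↦ ?_⟩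
    rw [eval_add]
    exact (norm_add_le _ _).trans (add_le_add (h1 x hx) (h2 x hx))
  | monomial n a =>
    refine ⟨‖a‖ * |R| ^ n + 1, by positivity, fun x hx ↦ ?_⟩
    rw [eval_monomial, norm_mul, norm_pow]
    have : ‖x‖ ≤ |R| := hx.trans (le_abs_self R)
    have : ‖a‖ * ‖x‖ ^ n ≤ ‖a‖ * |R| ^ n := by gcongr
    linarith

theorem IsTate.exists_bound {F : ℂ_[p] → ℂ_[p]} (hF : IsTate F) :
    ∃ M : ℝ, 0 < M ∧ ∀ x, ‖x‖ ≤ 1 → ‖F x‖ ≤ M := by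
  obtain ⟨P, hP⟩ := hF 1 one_pos
  obtain ⟨M, hM, h⟩ := norm_eval_le P 1
  refine ⟨1 + M, by positivity, fun x hx ↦ ?_⟩
  have := norm_add_le (F x - P.eval x) (P.eval x)
  rw [sub_add_cancel] at this
  linarith [hP x hx, h x hx]

theorem IsTate.mul {F G : ℂ_[p] → ℂ_[p]} (hF : IsTate F) (hG : IsTate G) :
    IsTate fun x ↦ F x * G x := by
  intro ε hε
  obtain ⟨M, hM, hFM⟩ := hF.exists_bound
  obtain ⟨Q, hQ⟩ := hG (ε / (2 * M)) (by positivity)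
  obtain ⟨M', hM', hQM⟩ := norm_eval_le Q 1
  obtain ⟨P, hP⟩ := hF (ε / (2 * M')) (by positivity)
  refine ⟨P * Q, fun x hx ↦ ?_⟩
  have e : F x * G x - (P * Q).eval x =
      F x * (G x - Q.eval x) + (F x - P.eval x) * Q.eval x := by rw [eval_mul]; ring
  rw [e]
  refine (norm_add_le _ _).trans_lt ?_
  rw [norm_mul, norm_mul]
  have h1 : ‖F x‖ * ‖G x - Q.eval x‖ < ε / 2 :=
    calc _ ≤ M * ‖G x - Q.eval x‖ := by gcongr; exact hFM x hx
      _ < M * (ε / (2 * M)) := by gcongr; exact hQ x hx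
      _ = ε / 2 := by field_simp
  have h2 : ‖F x - P.eval x‖ * ‖Q.eval x‖ < ε / 2 :=
    calc _ ≤ ‖F x - P.eval x‖ * M' := by gcongr; exact hQM x hx
      _ < (ε / (2 * M')) * M' := by gcongr; exact hP x hx
      _ = ε / 2 := by field_simp
  linarith

/-- The geometric series in x/w, truncated once its remainder is below ε. -/
theorem IsTate.inv_sub {w : ℂ_[p]} (hw : 1 < ‖w‖) : IsTate fun x ↦ (x - w)⁻¹ := by
  intro ε hε
  have hw0 : w ≠ 0 := by rintro rfl; simp at hw; linarith
  obtain ⟨n, hn⟩ := exists_pow_lt_of_lt_one hε (inv_lt_one_of_one_lt₀ hw)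
  refine ⟨-∑ i ∈ Finset.range n, C (w⁻¹ ^ (i + 1)) * X ^ i, fun x hx ↦ ?_⟩
  have hxw : ‖x - w‖ = ‖w‖ := by
    have hlt : ‖x‖ < ‖w‖ := hx.trans_lt hw
    rw [sub_eq_add_neg, IsUltrametricDist.norm_add_eq_max_of_norm_ne_norm (by
      rw [norm_neg]; exact hlt.ne), norm_neg, max_eq_right hlt.le]
  have hxw0 : x - w ≠ 0 := by
    intro h; rw [h, norm_zero] at hxw; linarith
  have e : (x - w)⁻¹ - (-∑ i ∈ Finset.range n, C (w⁻¹ ^ (i + 1)) * X ^ i : ℂ_[p][X]).eval x =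
      (x / w) ^ n * (x - w)⁻¹ := by
    have hg := geom_sum_mul (x / w) n
    have : (∑ i ∈ Finset.range n, C (w⁻¹ ^ (i + 1)) * X ^ i : ℂ_[p][X]).eval x =
        w⁻¹ * ∑ i ∈ Finset.range n, (x / w) ^ i := by
      rw [eval_finsetSum, Finset.mul_sum]
      refine Finset.sum_congr rfl fun i _ ↦ ?_
      simp [div_eq_mul_inv, mul_pow, pow_succ]
      ring
    rw [eval_neg, this, sub_neg_eq_add]
    have h1 : x / w - 1 = (x - w) * w⁻¹ := by field_simp
    rw [h1] at hg
    rw [eq_mul_inv_iff_mul_eq₀ hxw0, add_mul, inv_mul_cancel₀ hxw0]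
    linear_combination hg
  rw [e, norm_mul, norm_inv, hxw, norm_pow, norm_div]
  have h3 : (‖x‖ / ‖w‖) ^ n ≤ ‖w‖⁻¹ ^ n := by
    gcongr
    rw [div_eq_mul_inv]
    exact mul_le_of_le_one_left (by positivity) hx
  calc _ ≤ ‖w‖⁻¹ ^ n * 1 := by
        gcongr
        exact inv_le_one_of_one_le₀ hw.le
    _ < ε := by rw [mul_one]; exact hn

/-- Induction on polynomials over an algebraically closed field through their roots. -/
theorem poly_induction {K : Type*} [Field K] [IsAlgClosed K] {motive : K[X] → Prop}
    (const : ∀ c, motive (C c)) (mul : ∀ w P, motive P → motive ((X - C w) * P)) (P : K[X]) :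
    motive P := by
  induction hn : P.natDegree generalizing P with
  | zero => rw [eq_C_of_natDegree_eq_zero hn]; exact const _
  | succ n ih =>
    obtain ⟨w, hw⟩ := IsAlgClosed.exists_root P (by
      intro h; rw [natDegree_eq_zero_iff_degree_le_zero.2 h.le] at hn; omega)
    obtain ⟨P', rfl⟩ := dvd_iff_isRoot.2 hw
    refine mul w P' (ih P' ?_)
    have h0 : P' ≠ 0 := by rintro rfl; simp at hn
    rw [natDegree_mul (X_sub_C_ne_zero w) h0, natDegree_X_sub_C] at hn
    omega

theorem IsTate.inv_poly (Q : ℂ_[p][X]) (hQ : ∀ x, ‖x‖ ≤ 1 → Q.eval x ≠ 0) :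
    IsTate fun x ↦ (Q.eval x)⁻¹ := by
  induction Q using poly_induction with
  | const c => simpa using IsTate.of_poly (C c⁻¹)
  | mul w P ih =>
    have hw : 1 < ‖w‖ := by
      by_contra h
      exact hQ w (not_lt.1 h) (by simp)
    have := (IsTate.inv_sub hw).mul (ih fun x hx h ↦ hQ x hx (by simp [h]))
    simpa [mul_inv, mul_comm] using this

theorem IsTate.rational (P Q : ℂ_[p][X]) (hQ : ∀ x, ‖x‖ ≤ 1 → Q.eval x ≠ 0) :
    IsTate fun x ↦ P.eval x / Q.eval x := by
  simp_rw [div_eq_mul_inv]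
  exact (IsTate.of_poly P).mul (IsTate.inv_poly Q hQ)

theorem norm_eval_sub_eval_zero_le {P : ℂ_[p][X]} {ε : ℝ}
    (h : ∀ x, ‖x‖ ≤ 1 → ‖P.eval x‖ ≤ ε) {x : ℂ_[p]} (hx : ‖x‖ ≤ 1) :
    ‖P.eval x - P.eval 0‖ ≤ ε * ‖x‖ := by
  have hε : 0 ≤ ε := (norm_nonneg _).trans (h 0 (by simp))
  have e : P.eval x - P.eval 0 = ∑ i ∈ Finset.range P.natDegree, P.coeff (i + 1) * x ^ (i + 1) := by
    rw [eval_eq_sum_range, Finset.sum_range_succ', ← coeff_zero_eq_eval_zero]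
    simp
  rw [e]
  refine IsUltrametricDist.norm_sum_le_of_forall_le_of_nonneg (by positivity) fun i _ ↦ ?_
  rw [norm_mul, norm_pow, pow_succ]
  gcongr
  · exact norm_coeff_le_of_norm_eval_le h _
  · exact mul_le_of_le_one_left (norm_nonneg _) (pow_le_one₀ (norm_nonneg _) hx)

/-- Schwarz' lemma on the closed unit disc. -/
theorem IsTate.norm_sub_le {F : ℂ_[p] → ℂ_[p]} (hF : IsTate F) {ε : ℝ}
    (h : ∀ x, ‖x‖ ≤ 1 → ‖F x‖ ≤ ε) {x : ℂ_[p]} (hx : ‖x‖ ≤ 1) : ‖F x - F 0‖ ≤ ε * ‖x‖ := by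
  have hε : 0 ≤ ε := (norm_nonneg _).trans (h 0 (by simp))
  by_cases hx0 : x = 0
  · simp [hx0]
  refine le_of_forall_pos_le_add fun η hη ↦ ?_
  have hxn : 0 < ‖x‖ := norm_pos_iff.2 hx0
  obtain ⟨P, hP⟩ := hF (η / 3) (by positivity)
  have h1 : ∀ x, ‖x‖ ≤ 1 → ‖P.eval x‖ ≤ ε + η / 3 := by
    intro y hy
    have := norm_add_le (P.eval y - F y) (F y)
    rw [sub_add_cancel, norm_sub_rev] at this
    linarith [hP y hy, h y hy]
  have h2 := norm_eval_sub_eval_zero_le h1 hx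
  have h3 := hP x hx
  have h4 := hP 0 (by simp)
  rw [norm_sub_rev] at h4
  have e : F x - F 0 = (F x - P.eval x) + (P.eval x - P.eval 0) + (P.eval 0 - F 0) := by ring
  have h5 : ‖F x - F 0‖ ≤ η / 3 + (ε + η / 3) * ‖x‖ + η / 3 := by
    rw [e]
    refine (norm_add_le _ _).trans (add_le_add ((norm_add_le _ _).trans (add_le_add h3.le h2)) h4.le)
  nlinarith

/-- By the coefficient estimate, the coefficients of the approximating polynomials are Cauchy,
uniformly in the index; their limits are the coefficients of a power series with sum `F`. -/
theorem IsTate.analyticAt {F : ℂ_[p] → ℂ_[p]} (hF : IsTate F) : AnalyticAt ℂ_[p] F 0 := by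
  choose P hP using fun n : ℕ ↦ hF ((1 / 2 : ℝ) ^ n) (by positivity)
  have hPP : ∀ m n : ℕ, m ≤ n → ∀ i, ‖(P m).coeff i - (P n).coeff i‖ ≤ (1 / 2 : ℝ) ^ m := by
    intro m n hmn i
    rw [← coeff_sub]
    refine norm_coeff_le_of_norm_eval_le (fun x hx ↦ ?_) i
    have e : (P m - P n).eval x = (F x - (P n).eval x) - (F x - (P m).eval x) := by
      rw [eval_sub]; ring
    rw [e]
    refine (norm_sub_le_max' _ _).trans (max_le ?_ (hP m x hx).le)
    exact (hP n x hx).le.trans (pow_le_pow_of_le_one (by norm_num) (by norm_num) hmn)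
  have hlim : ∀ i, ∃ a, Tendsto (fun n ↦ (P n).coeff i) atTop (𝓝 a) := by
    intro i
    apply cauchySeq_tendsto_of_complete
    refine cauchySeq_of_le_tendsto_0 (fun n ↦ 2 * (1 / 2 : ℝ) ^ n) ?_ ?_
    · intro n m N hn hm
      rw [dist_eq_norm]
      have h1 := hPP N n hn i
      have h2 := hPP N m hm i
      rw [norm_sub_rev] at h1
      have := norm_add_le ((P n).coeff i - (P N).coeff i) ((P N).coeff i - (P m).coeff i)
      rw [sub_add_sub_cancel] at this
      linarith
    · simpa using (tendsto_pow_atTop_nhds_zero_of_lt_one (by norm_num : (0 : ℝ) ≤ 1 / 2)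
        (by norm_num)).const_mul 2
  choose a ha using hlim
  have hPa : ∀ m i, ‖(P m).coeff i - a i‖ ≤ (1 / 2 : ℝ) ^ m := by
    intro m i
    refine le_of_tendsto (((ha i).const_sub _).norm) ?_
    filter_upwards [eventually_ge_atTop m] with n hn using hPP m n hn i
  have hpart : ∀ x : ℂ_[p], ‖x‖ ≤ 1 → ∀ m N, (P m).natDegree < N →
      ‖∑ i ∈ Finset.range N, x ^ i * a i - F x‖ ≤ (1 / 2 : ℝ) ^ m := by
    intro x hx m N hN
    have e : ∑ i ∈ Finset.range N, x ^ i * a i - F x =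
        ((P m).eval x - F x) - ∑ i ∈ Finset.range N, x ^ i * ((P m).coeff i - a i) := by
      rw [eval_eq_sum_range' hN]
      simp only [mul_sub, Finset.sum_sub_distrib]
      simp_rw [mul_comm (x ^ _)]
      ring
    rw [e]
    refine (norm_sub_le_max' _ _).trans (max_le ?_ ?_)
    · rw [norm_sub_rev]; exact (hP m x hx).le
    · refine IsUltrametricDist.norm_sum_le_of_forall_le_of_nonneg (by positivity) fun i _ ↦ ?_
      rw [norm_mul, norm_pow]
      calc _ ≤ 1 * (1 / 2 : ℝ) ^ m := by
            gcongr
            · exact pow_le_one₀ (norm_nonneg _) hx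
            · exact hPa m i
        _ = _ := one_mul _
  have htend : ∀ x : ℂ_[p], ‖x‖ ≤ 1 →
      Tendsto (fun N ↦ ∑ i ∈ Finset.range N, x ^ i * a i) atTop (𝓝 (F x)) := by
    intro x hx
    rw [Metric.tendsto_atTop]
    intro ε hε
    obtain ⟨m, hm⟩ := exists_pow_lt_of_lt_one hε (by norm_num : (1 / 2 : ℝ) < 1)
    refine ⟨(P m).natDegree + 1, fun N hN ↦ ?_⟩
    rw [dist_eq_norm]
    exact (hpart x hx m N (by omega)).trans_lt hm
  refine ⟨FormalMultilinearSeries.ofScalars ℂ_[p] a, hasFPowerSeriesAt_iff.2 ?_⟩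
  filter_upwards [Metric.closedBall_mem_nhds (0 : ℂ_[p]) one_pos] with x hx
  have hx' : ‖x‖ ≤ 1 := by simpa using hx
  have ht := htend x hx'
  have hterm : Tendsto (fun i ↦ x ^ i * a i) atTop (𝓝 0) := by
    have h2 := (ht.comp (tendsto_add_atTop_nat 1)).sub ht
    simpa [Finset.sum_range_succ] using h2
  have hs : Summable fun i ↦ x ^ i * a i := by
    apply NonarchimedeanAddGroup.summable_of_tendsto_cofinite_zero
    rwa [Nat.cofinite_eq_atTop]
  have := hs.hasSum
  rw [tendsto_nhds_unique this.tendsto_sum_nat ht] at this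
  simpa [FormalMultilinearSeries.coeff_ofScalars] using this

/-! ### Analytic functions on the affinoids -/

namespace IsAnalyticOnAffinoid

variable {n : ℕ} {f g : ℂ_[p] → ℂ_[p]}

theorem of_limit (h : ∀ ε : ℝ, 0 < ε → ∃ g, IsAnalyticOnAffinoid p n g ∧
    ∀ z ∈ affinoid p n, ‖f z - g z‖ < ε) : IsAnalyticOnAffinoid p n f := by
  intro ε hε
  obtain ⟨G, hG, h1⟩ := h ε hε
  obtain ⟨P, Q, hP⟩ := hG ε hε
  refine ⟨P, Q, fun z hz ↦ ⟨(hP z hz).1, ?_⟩⟩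
  rw [← sub_add_sub_cancel _ (G z)]
  exact (IsUltrametricDist.norm_add_le_max _ _).trans_lt (max_lt (h1 z hz) (hP z hz).2)

theorem congr (hf : IsAnalyticOnAffinoid p n f) (h : Set.EqOn f g (affinoid p n)) :
    IsAnalyticOnAffinoid p n g :=
  of_limit fun ε hε ↦ ⟨f, hf, fun z hz ↦ by rw [h hz]; simpa⟩

theorem rational (P Q : ℂ_[p][X]) (hQ : ∀ z ∈ affinoid p n, Q.eval z ≠ 0) :
    IsAnalyticOnAffinoid p n fun z ↦ P.eval z / Q.eval z :=
  fun ε hε ↦ ⟨P, Q, fun z hz ↦ ⟨hQ z hz, by simpa⟩⟩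

theorem poly (P : ℂ_[p][X]) : IsAnalyticOnAffinoid p n fun z ↦ P.eval z := by
  simpa using rational (n := n) P 1 (by simp)

theorem const (c : ℂ_[p]) : IsAnalyticOnAffinoid p n fun _ ↦ c := by simpa using poly (n := n) (C c)

theorem add (hf : IsAnalyticOnAffinoid p n f) (hg : IsAnalyticOnAffinoid p n g) :
    IsAnalyticOnAffinoid p n fun z ↦ f z + g z := by
  intro ε hε
  obtain ⟨P, Q, h1⟩ := hf ε hε
  obtain ⟨P', Q', h2⟩ := hg ε hε
  refine ⟨P * Q' + Q * P', Q * Q', fun z hz ↦ ?_⟩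
  obtain ⟨h1, h1'⟩ := h1 z hz
  obtain ⟨h2, h2'⟩ := h2 z hz
  refine ⟨by simp [h1, h2], ?_⟩
  simp only [eval_add, eval_mul]
  rw [← div_add_div _ _ h1 h2, add_sub_add_comm]
  exact (IsUltrametricDist.norm_add_le_max _ _).trans_lt (max_lt h1' h2')

theorem exists_inv_bound (Q : ℂ_[p][X]) (hQ : ∀ z ∈ affinoid p n, Q.eval z ≠ 0) :
    ∃ M : ℝ, 0 < M ∧ ∀ z ∈ affinoid p n, ‖(Q.eval z)⁻¹‖ ≤ M := by
  induction Q using poly_induction with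
  | const c => exact ⟨‖c⁻¹‖ + 1, by positivity, fun z _ ↦ by simp⟩
  | mul w P ih =>
    obtain ⟨M, hM, h⟩ := ih fun z hz h ↦ hQ z hz (by simp [h])
    have hpos := inv_p_pow_pos (p := p) n
    refine ⟨((p : ℝ)⁻¹ ^ n)⁻¹ * M, by positivity, fun z hz ↦ ?_⟩
    have hw : w ∉ affinoid p n := fun hw ↦ hQ w hw (by simp)
    have hd : (p : ℝ)⁻¹ ^ n ≤ ‖z - w‖ := by
      by_contra hlt
      exact hw (mem_affinoid_of_norm_sub_lt hz (by rw [norm_sub_rev]; exact not_le.1 hlt))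
    simp only [eval_mul, eval_sub, eval_X, eval_C, mul_inv, norm_mul]
    gcongr
    · rw [norm_inv]; gcongr
    · exact h z hz

theorem exists_bound (hf : IsAnalyticOnAffinoid p n f) :
    ∃ M : ℝ, 0 < M ∧ ∀ z ∈ affinoid p n, ‖f z‖ ≤ M := by
  obtain ⟨P, Q, h⟩ := hf 1 one_pos
  obtain ⟨M, hM, h1⟩ := exists_inv_bound Q fun z hz ↦ (h z hz).1
  obtain ⟨M', hM', h2⟩ := norm_eval_le P ((p : ℝ) ^ n)
  refine ⟨1 + M' * M, by positivity, fun z hz ↦ ?_⟩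
  have h3 := norm_add_le (f z - P.eval z / Q.eval z) (P.eval z / Q.eval z)
  rw [sub_add_cancel] at h3
  have h4 : ‖P.eval z / Q.eval z‖ ≤ M' * M := by
    rw [div_eq_mul_inv, norm_mul]
    gcongr
    · exact h2 z (norm_le_of_mem_affinoid hz)
    · exact h1 z hz
  linarith [(h z hz).2]

theorem mul (hf : IsAnalyticOnAffinoid p n f) (hg : IsAnalyticOnAffinoid p n g) :
    IsAnalyticOnAffinoid p n fun z ↦ f z * g z := by
  intro ε hε
  obtain ⟨M, hM, hfM⟩ := hf.exists_bound
  obtain ⟨P', Q', h2⟩ := hg (ε / (2 * M)) (by positivity)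
  obtain ⟨M', hM', hQM⟩ := exists_bound (rational (n := n) P' Q' fun z hz ↦ (h2 z hz).1)
  obtain ⟨P, Q, h1⟩ := hf (ε / (2 * M')) (by positivity)
  refine ⟨P * P', Q * Q', fun z hz ↦ ?_⟩
  have hfM := hfM z hz
  have hQM := hQM z hz
  obtain ⟨h1, h1'⟩ := h1 z hz
  obtain ⟨h2, h2'⟩ := h2 z hz
  refine ⟨by simp [h1, h2], ?_⟩
  simp only [eval_mul]
  rw [mul_div_mul_comm]
  set a := P.eval z / Q.eval z
  set b := P'.eval z / Q'.eval z
  have e : f z * g z - a * b = f z * (g z - b) + (f z - a) * b := by ring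
  rw [e]
  refine (norm_add_le _ _).trans_lt ?_
  rw [norm_mul, norm_mul]
  have h3 : ‖f z‖ * ‖g z - b‖ < ε / 2 :=
    calc _ ≤ M * ‖g z - b‖ := by gcongr
      _ < M * (ε / (2 * M)) := by gcongr
      _ = ε / 2 := by field_simp
  have h4 : ‖f z - a‖ * ‖b‖ < ε / 2 :=
    calc _ ≤ ‖f z - a‖ * M' := by gcongr
      _ < (ε / (2 * M')) * M' := by gcongr
      _ = ε / 2 := by field_simp
  linarith

theorem inv_poly (Q : ℂ_[p][X]) (hQ : ∀ z ∈ affinoid p n, Q.eval z ≠ 0) :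
    IsAnalyticOnAffinoid p n fun z ↦ (Q.eval z)⁻¹ := by
  simpa using rational (n := n) 1 Q hQ

theorem sub (hf : IsAnalyticOnAffinoid p n f) (hg : IsAnalyticOnAffinoid p n g) :
    IsAnalyticOnAffinoid p n fun z ↦ f z - g z := by
  simpa [sub_eq_add_neg] using hf.add ((const (-1)).mul hg)

theorem sum {ι : Type*} (s : Finset ι) {u : ι → ℂ_[p] → ℂ_[p]}
    (hu : ∀ i ∈ s, IsAnalyticOnAffinoid p n (u i)) :
    IsAnalyticOnAffinoid p n fun z ↦ ∑ i ∈ s, u i z := by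
  classical
  induction s using Finset.induction_on with
  | empty => simpa using const 0
  | insert a s ha ih =>
    simp only [Finset.sum_insert ha]
    exact (hu a (by simp)).add (ih fun i hi ↦ hu i (by simp [hi]))

theorem summable_of_small {ι : Type*} {u : ι → ℂ_[p] → ℂ_[p]} {z : ℂ_[p]}
    (h : ∀ ε : ℝ, 0 < ε → {i | ¬ ‖u i z‖ ≤ ε}.Finite) : Summable fun i ↦ u i z := by
  apply NonarchimedeanAddGroup.summable_of_tendsto_cofinite_zero
  rw [Metric.tendsto_nhds]
  intro ε hε
  refine (h (ε / 2) (by positivity)).subset fun i hi h1 ↦ hi ?_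
  show dist (u i z) 0 < ε
  rw [dist_zero_right]
  linarith

theorem norm_tsum_le {ι : Type*} {u : ι → ℂ_[p]} {ε : ℝ} (hε : 0 ≤ ε) (h : ∀ i, ‖u i‖ ≤ ε) :
    ‖∑' i, u i‖ ≤ ε := by
  by_cases hs : Summable u
  · refine le_of_tendsto hs.hasSum.norm (Eventually.of_forall fun s ↦ ?_)
    exact IsUltrametricDist.norm_sum_le_of_forall_le_of_nonneg hε fun i _ ↦ h i
  · rw [tsum_eq_zero_of_not_summable hs]; simpa

theorem tsum {ι : Type*} {u : ι → ℂ_[p] → ℂ_[p]} (hu : ∀ i, IsAnalyticOnAffinoid p n (u i))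
    (h : ∀ ε : ℝ, 0 < ε → {i | ¬ ∀ z ∈ affinoid p n, ‖u i z‖ ≤ ε}.Finite) :
    IsAnalyticOnAffinoid p n fun z ↦ ∑' i, u i z := by
  refine of_limit fun ε hε ↦ ?_
  have hfin := h (ε / 2) (by positivity)
  refine ⟨fun z ↦ ∑ i ∈ hfin.toFinset, u i z, sum _ fun i _ ↦ hu i, fun z hz ↦ ?_⟩
  have hs : Summable fun i ↦ u i z := summable_of_small fun η hη ↦
    (h η hη).subset fun i hi h1 ↦ hi (h1 z hz)
  rw [← hs.sum_add_tsum_compl (s := hfin.toFinset), add_sub_cancel_left]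
  refine lt_of_le_of_lt (norm_tsum_le (by positivity) fun i ↦ ?_) (half_lt_self hε)
  have := i.2
  simp only [Set.mem_compl_iff, Finset.mem_coe, Set.Finite.mem_toFinset, Set.mem_ofPred_eq,
    not_not] at this
  exact this z hz

/-- The closed disc of radius p^(-(n+1)) about `a` lies in the open disc of radius p^(-n), hence in
the affinoid; there rational functions without poles are limits of polynomials. -/
theorem isTate (hf : IsAnalyticOnAffinoid p n f) {a : ℂ_[p]} (ha : a ∈ affinoid p n) :
    IsTate fun x ↦ f (a + (p : ℂ_[p]) ^ (n + 1) * x) := by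
  refine IsTate.of_limit fun ε hε ↦ ?_
  obtain ⟨P, Q, h⟩ := hf ε hε
  set s : ℂ_[p][X] := C a + C ((p : ℂ_[p]) ^ (n + 1)) * X
  have hmem : ∀ x : ℂ_[p], ‖x‖ ≤ 1 → a + (p : ℂ_[p]) ^ (n + 1) * x ∈ affinoid p n := by
    intro x hx
    refine mem_affinoid_of_norm_sub_lt ha ?_
    rw [add_sub_cancel_left, norm_mul, norm_pow, norm_p, pow_succ]
    have h1 := inv_p_pow_pos (p := p) n
    have h2 := inv_lt_one_of_one_lt₀ (one_lt_p (p := p))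
    have h3 := inv_pos.2 (p_pos (p := p))
    calc _ ≤ (p : ℝ)⁻¹ ^ n * (p : ℝ)⁻¹ * 1 := by gcongr
      _ < (p : ℝ)⁻¹ ^ n * 1 := by rw [mul_one]; gcongr
      _ = _ := mul_one _
  have hs : ∀ x, s.eval x = a + (p : ℂ_[p]) ^ (n + 1) * x := fun x ↦ by simp [s]
  refine ⟨fun x ↦ (P.comp s).eval x / (Q.comp s).eval x, IsTate.rational _ _ fun x hx ↦ ?_,
    fun x hx ↦ ?_⟩
  · rw [eval_comp, hs]; exact (h _ (hmem x hx)).1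
  · simp only [eval_comp, hs]; exact (h _ (hmem x hx)).2

theorem p_pow_ne_zero (m : ℕ) : (p : ℂ_[p]) ^ m ≠ 0 :=
  pow_ne_zero _ (by exact_mod_cast (Fact.out : p.Prime).ne_zero)

theorem analyticAt (hf : IsAnalyticOnAffinoid p n f) {a : ℂ_[p]} (ha : a ∈ affinoid p n) :
    AnalyticAt ℂ_[p] f a := by
  have h := (hf.isTate ha).analyticAt
  have h2 : AnalyticAt ℂ_[p] (fun z : ℂ_[p] ↦ (z - a) / (p : ℂ_[p]) ^ (n + 1)) a := by fun_prop
  have h3 : (fun z : ℂ_[p] ↦ (z - a) / (p : ℂ_[p]) ^ (n + 1)) a = 0 := by simp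
  refine (h.comp_of_eq h2 h3).congr (Eventually.of_forall fun z ↦ ?_)
  have := p_pow_ne_zero (p := p) (n + 1)
  simp only [Function.comp]
  congr 1
  field_simp
  ring

/-- The difference quotient of a rational approximation of `f` is rational and approximates that of
`f`: away from `w` because dividing by z - w costs a bounded factor, near `w` by Schwarz' lemma
applied to the error. This is what allows poles to be divided out in `exists_analytic_of_reg`. -/
theorem exists_div_sub (hf : IsAnalyticOnAffinoid p n f) {w : ℂ_[p]} (hw : w ∈ affinoid p n)
    (h0 : f w = 0) :
    ∃ g, IsAnalyticOnAffinoid p n g ∧ ∀ z ∈ affinoid p n, z ≠ w → (z - w) * g z = f z := by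
  classical
  set v := deriv f w
  have hlim : Tendsto (fun z ↦ f z / (z - w)) (𝓝[≠] w) (𝓝 v) := by
    have := hasDerivAt_iff_tendsto_slope.1 (hf.analyticAt hw).differentiableAt.hasDerivAt
    refine this.congr fun z ↦ ?_
    rw [slope_def_field, h0, sub_zero]
  refine ⟨Function.update (fun z ↦ f z / (z - w)) w v, ?_, fun z _ hz ↦ ?_⟩
  swap
  · rw [Function.update_of_ne hz]
    exact mul_div_cancel₀ _ (sub_ne_zero.2 hz)
  set r := ‖(p : ℂ_[p]) ^ (n + 1)‖
  have hr : 0 < r := norm_pos_iff.2 (p_pow_ne_zero _)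
  refine of_limit fun ε hε ↦ ?_
  obtain ⟨P, Q, h⟩ := hf (ε * r / 2) (by positivity)
  have hRana := rational (n := n) P Q fun z hz ↦ (h z hz).1
  -- The numerator of P/Q - P(w)/Q(w) vanishes at `w`; its quotient by X - w gives the rational
  -- approximation of f/(z - w), without a pole at `w`.
  obtain ⟨S, hS⟩ : (X - C w) ∣ (P * C (Q.eval w) - C (P.eval w) * Q) := by
    rw [dvd_iff_isRoot]; simp [IsRoot, mul_comm]
  have hQw := (h w hw).1
  have hSe : ∀ z ∈ affinoid p n, P.eval z / Q.eval z - P.eval w / Q.eval w =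
      (z - w) * (S.eval z / (Q * C (Q.eval w)).eval z) := by
    intro z hz
    have hQz := (h z hz).1
    have := congrArg (eval z) hS
    simp only [eval_sub, eval_mul, eval_C, eval_X] at this ⊢
    field_simp
    linear_combination this
  have hG : ∀ z ∈ affinoid p n, Q.eval z * Q.eval w ≠ 0 := fun z hz ↦
    mul_ne_zero (h z hz).1 hQw
  have hSana := rational (n := n) S (Q * C (Q.eval w)) fun z hz ↦ by simpa using hG z hz
  refine ⟨_, hSana, ?_⟩
  have key : ∀ z ∈ affinoid p n, z ≠ w →
      ‖f z / (z - w) - S.eval z / (Q * C (Q.eval w)).eval z‖ ≤ ε / 2 := by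
    intro z hz hzw
    have hzw' : z - w ≠ 0 := sub_ne_zero.2 hzw
    have hn : 0 < ‖z - w‖ := norm_pos_iff.2 hzw'
    set F : ℂ_[p] → ℂ_[p] := fun z ↦ f z - P.eval z / Q.eval z with hF
    have e : f z / (z - w) - S.eval z / (Q * C (Q.eval w)).eval z = (F z - F w) / (z - w) := by
      have e2 : F z - F w = f z - (P.eval z / Q.eval z - P.eval w / Q.eval w) := by
        simp only [hF, h0]; ring
      rw [e2, hSe z hz, sub_div, mul_div_cancel_left₀ _ hzw']
    rw [e, norm_div, div_le_iff₀ hn]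
    by_cases hd : ‖z - w‖ ≤ r
    · have hT := (hf.sub hRana).isTate hw
      set x := (z - w) / (p : ℂ_[p]) ^ (n + 1)
      have hx : ‖x‖ ≤ 1 := by rw [norm_div]; exact div_le_one_of_le₀ hd hr.le
      have hmem : ∀ y : ℂ_[p], ‖y‖ ≤ 1 → w + (p : ℂ_[p]) ^ (n + 1) * y ∈ affinoid p n := by
        intro y hy
        refine mem_affinoid_of_norm_sub_lt hw ?_
        rw [add_sub_cancel_left, norm_mul, norm_pow, norm_p]
        have h2 := inv_lt_one_of_one_lt₀ (one_lt_p (p := p))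
        have h3 := inv_pos.2 (p_pos (p := p))
        calc _ ≤ (p : ℝ)⁻¹ ^ (n + 1) * 1 := by gcongr
          _ < (p : ℝ)⁻¹ ^ n := by rw [mul_one]; exact pow_lt_pow_right_of_lt_one₀ h3 h2 (by omega)
      have := hT.norm_sub_le (ε := ε * r / 2) (fun y hy ↦ (h _ (hmem y hy)).2.le) hx
      have hzx : w + (p : ℂ_[p]) ^ (n + 1) * x = z := by
        simp only [x]; rw [mul_div_cancel₀ _ (p_pow_ne_zero _)]; ring
      simp only [hzx, mul_zero, add_zero] at this
      refine this.trans (le_of_eq ?_)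
      rw [norm_div]
      have hr' := hr.ne'
      change ε * r / 2 * (‖z - w‖ / r) = _
      field_simp
    · have h1 : ‖F z - F w‖ ≤ ε * r / 2 :=
        (norm_sub_le_max' _ _).trans (max_le (h z hz).2.le (h w hw).2.le)
      have := not_le.1 hd
      nlinarith
  intro z hz
  refine lt_of_le_of_lt ?_ (half_lt_self hε)
  by_cases hzw : z = w
  · subst hzw
    rw [Function.update_self]
    have hc := (hSana.analyticAt hw).continuousAt.tendsto.mono_left (nhdsWithin_le_nhds (s := {z}ᶜ))
    refine le_of_tendsto (hlim.sub hc).norm ?_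
    filter_upwards [self_mem_nhdsWithin, mem_nhdsWithin_of_mem_nhds (affinoid_mem_nhds hw)]
      with y hy hy2 using key y hy2 hy
  · rw [Function.update_of_ne hzw]
    exact key z hz hzw

end IsAnalyticOnAffinoid

/-! ### Regular points -/

/-- `f` agrees near `w`, off `w`, with a function that is analytic at `w`. -/
def Reg (f : ℂ_[p] → ℂ_[p]) (w : ℂ_[p]) : Prop :=
  ∃ g, AnalyticAt ℂ_[p] g w ∧ f =ᶠ[𝓝[≠] w] g

namespace Reg

variable {f g : ℂ_[p] → ℂ_[p]} {w : ℂ_[p]}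

theorem of_analyticAt (h : AnalyticAt ℂ_[p] f w) : Reg f w := ⟨f, h, EventuallyEq.rfl⟩

theorem congr (hf : Reg f w) (h : f =ᶠ[𝓝[≠] w] g) : Reg g w := by
  obtain ⟨f', h1, h2⟩ := hf
  exact ⟨f', h1, h.symm.trans h2⟩

theorem add (hf : Reg f w) (hg : Reg g w) : Reg (f + g) w := by
  obtain ⟨f', h1, h2⟩ := hf
  obtain ⟨g', h3, h4⟩ := hg
  exact ⟨f' + g', h1.add h3, h2.add h4⟩

theorem mul (hf : Reg f w) (hg : Reg g w) : Reg (f * g) w := by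
  obtain ⟨f', h1, h2⟩ := hf
  obtain ⟨g', h3, h4⟩ := hg
  exact ⟨f' * g', h1.mul h3, h2.mul h4⟩

theorem neg (hf : Reg f w) : Reg (-f) w := by
  obtain ⟨f', h1, h2⟩ := hf
  exact ⟨-f', h1.neg, h2.neg⟩

theorem sub (hf : Reg f w) (hg : Reg g w) : Reg (f - g) w := by
  rw [sub_eq_add_neg]; exact hf.add hg.neg

theorem const (c : ℂ_[p]) : Reg (fun _ ↦ c) w := of_analyticAt analyticAt_const

theorem const_mul (c : ℂ_[p]) (hf : Reg f w) : Reg (fun z ↦ c * f z) w := (const c).mul hf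

theorem sum {ι : Type*} (s : Finset ι) {u : ι → ℂ_[p] → ℂ_[p]} (hu : ∀ i ∈ s, Reg (u i) w) :
    Reg (fun z ↦ ∑ i ∈ s, u i z) w := by
  classical
  induction s using Finset.induction_on with
  | empty => simpa using const (w := w) 0
  | insert a s ha ih =>
    simp only [Finset.sum_insert ha]
    exact (hu a (by simp)).add (ih fun i hi ↦ hu i (by simp [hi]))

theorem not_isPole (hf : Reg f w) : ¬ IsPole f w := by
  obtain ⟨g, h1, h2⟩ := hf
  rw [IsPole, meromorphicOrderAt_congr h2, not_lt]
  exact h1.meromorphicOrderAt_nonneg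

end Reg

theorem reg_of_meromorphicOrderAt_nonneg {f : ℂ_[p] → ℂ_[p]} {w : ℂ_[p]} (hf : MeromorphicAt f w)
    (h : 0 ≤ meromorphicOrderAt f w) : Reg f w := by
  by_cases ht : meromorphicOrderAt f w = ⊤
  · rw [meromorphicOrderAt_eq_top_iff] at ht
    exact ⟨0, analyticAt_const, ht⟩
  · lift meromorphicOrderAt f w to ℤ using ht with m hm
    obtain ⟨g, h1, -, h2⟩ := (meromorphicOrderAt_eq_int_iff hf).1 hm.symm
    have hm0 : 0 ≤ m := by exact_mod_cast h
    lift m to ℕ using hm0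
    refine ⟨fun z ↦ (z - w) ^ m * g z, by fun_prop, ?_⟩
    filter_upwards [h2] with z hz
    simpa using hz

theorem eventually_of_finite {n : ℕ} {w : ℂ_[p]} (hw : w ∈ affinoid p n) {P : ℂ_[p] → Prop}
    (h : {z ∈ affinoid p n | ¬ P z}.Finite) : ∀ᶠ z in 𝓝[≠] w, P z := by
  have h1 : ∀ᶠ z in 𝓝[≠] w, z ∉ {z ∈ affinoid p n | ¬ P z} := by
    have hc : IsClosed ({z ∈ affinoid p n | ¬ P z} \ {w}) := (h.subset Set.sdiff_subset).isClosed
    have := hc.isOpen_compl.mem_nhds (x := w) (by simp)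
    filter_upwards [mem_nhdsWithin_of_mem_nhds this, self_mem_nhdsWithin] with z hz hzw h
    exact hz ⟨h, hzw⟩
  filter_upwards [h1, mem_nhdsWithin_of_mem_nhds (affinoid_mem_nhds hw)] with z hz hz2
  by_contra h2
  exact hz ⟨hz2, h2⟩

theorem MerEq.eventuallyEq {f g : ℂ_[p] → ℂ_[p]} (h : MerEq p f g) {w : ℂ_[p]} (hw : w ∈ Hp p) :
    f =ᶠ[𝓝[≠] w] g := by
  obtain ⟨n, hn⟩ := exists_mem_affinoid hw
  exact eventually_of_finite hn (h n)

theorem eval_finite {q : ℂ_[p][X]} (hq : q ≠ 0) : {z | q.eval z = 0}.Finite := by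
  classical
  refine q.roots.toFinset.finite_toSet.subset fun z hz ↦ ?_
  simpa [hq] using hz

/-- A meromorphic function on an affinoid without poles agrees with an analytic one. -/
theorem exists_analytic_of_reg {n : ℕ} {f : ℂ_[p] → ℂ_[p]} (hf : ∀ w ∈ affinoid p n, Reg f w)
    (q : ℂ_[p][X]) (hq : q ≠ 0) : ∀ g, IsAnalyticOnAffinoid p n g →
      {z ∈ affinoid p n | q.eval z * f z ≠ g z}.Finite →
    ∃ g, IsAnalyticOnAffinoid p n g ∧ {z ∈ affinoid p n | f z ≠ g z}.Finite := by
  induction q using poly_induction with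
  | const c =>
    intro g hg hfin
    have hc : c ≠ 0 := by simpa using hq
    refine ⟨_, (IsAnalyticOnAffinoid.const c⁻¹).mul hg, hfin.subset fun z hz ↦ ⟨hz.1, fun h ↦ ?_⟩⟩
    apply hz.2
    rw [← h]
    simp [hc]
  | mul w P ih =>
    have hP : P ≠ 0 := by rintro rfl; simp at hq
    intro g hg hfin
    have hfin' : ∀ g₁ : ℂ_[p] → ℂ_[p],
        (∀ z ∈ affinoid p n, z ≠ w → (z - w) * g₁ z = g z) →
        {z ∈ affinoid p n | P.eval z * f z ≠ g₁ z}.Finite := by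
      intro g₁ h1
      refine (hfin.union (Set.finite_singleton w)).subset fun z hz ↦ ?_
      by_cases hzw : z = w
      · right; exact hzw
      · left
        refine ⟨hz.1, fun h ↦ hz.2 ?_⟩
        rw [← h1 z hz.1 hzw] at h
        simp only [eval_mul, eval_sub, eval_X, eval_C] at h
        exact mul_left_cancel₀ (sub_ne_zero.2 hzw) (by rw [← h]; ring)
    by_cases hw : w ∈ affinoid p n
    -- Near `w` the function `g` is (z - w)P(z) times a function that is regular because `w` is not
    -- a pole of `f`.
    · have hg0 : g w = 0 := by
        obtain ⟨f', h1, h2⟩ := hf w hw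
        have h3 : g =ᶠ[𝓝[≠] w] fun z ↦ ((X - C w) * P).eval z * f' z := by
          filter_upwards [h2, eventually_of_finite hw hfin] with z hz hz2
          rw [← hz2, hz]
        have h4 : Tendsto g (𝓝[≠] w) (𝓝 (g w)) :=
          (hg.analyticAt hw).continuousAt.tendsto.mono_left nhdsWithin_le_nhds
        have h5 : Tendsto (fun z ↦ ((X - C w) * P).eval z * f' z) (𝓝[≠] w)
            (𝓝 (((X - C w) * P).eval w * f' w)) :=
          ((Polynomial.continuous _).continuousAt.mul h1.continuousAt).tendsto.mono_left
            nhdsWithin_le_nhds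
        rw [tendsto_nhds_unique (h4.congr' h3) h5]
        simp
      obtain ⟨g₁, h1, h2⟩ := hg.exists_div_sub hw hg0
      exact ih hP g₁ h1 (hfin' g₁ h2)
    · have hne : ∀ z ∈ affinoid p n, (X - C w).eval z ≠ 0 := by
        intro z hz h
        have : z = w := by simpa [sub_eq_zero] using h
        exact hw (this ▸ hz)
      refine ih hP _ (hg.mul (IsAnalyticOnAffinoid.inv_poly _ hne)) (hfin' _ fun z hz hzw ↦ ?_)
      simp only [eval_sub, eval_X, eval_C]
      have := sub_ne_zero.2 hzw
      field_simp

/-- The poles are among the roots of the polynomial that clears the denominators. -/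
theorem IsRigidMeromorphic.finite_not_reg {f : ℂ_[p] → ℂ_[p]} (hf : IsRigidMeromorphic p f)
    (n : ℕ) : {w ∈ affinoid p n | ¬ Reg f w}.Finite := by
  obtain ⟨q, hq, g, hg, hfin⟩ := hf n
  refine (eval_finite hq).subset fun w hw ↦ ?_
  by_contra h0
  refine hw.2 ⟨fun z ↦ (q.eval z)⁻¹ * g z, ?_, ?_⟩
  · exact ((AnalyticAt.aeval_polynomial analyticAt_id q).inv h0).mul (hg.analyticAt hw.1)
  · have hc : ∀ᶠ z in 𝓝[≠] w, q.eval z ≠ 0 := by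
      refine Filter.Eventually.filter_mono nhdsWithin_le_nhds ?_
      exact (Polynomial.continuous q).continuousAt.eventually_ne h0
    filter_upwards [hc, eventually_of_finite hw.1 hfin] with z hz hz2
    rw [← hz2]
    field_simp

theorem IsRigidMeromorphic.meromorphicAt {f : ℂ_[p] → ℂ_[p]} (hf : IsRigidMeromorphic p f)
    {w : ℂ_[p]} (hw : w ∈ Hp p) : MeromorphicAt f w := by
  obtain ⟨n, hn⟩ := exists_mem_affinoid hw
  obtain ⟨q, hq, g, hg, hfin⟩ := hf n
  have h1 : MeromorphicAt (fun z ↦ (q.eval z)⁻¹ * g z) w :=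
    (AnalyticAt.aeval_polynomial analyticAt_id q).meromorphicAt.inv.mul
      (hg.analyticAt hn).meromorphicAt
  refine h1.congr ?_
  have hc : ∀ᶠ z in 𝓝[≠] w, q.eval z ≠ 0 :=
    eventually_of_finite hn ((eval_finite hq).subset fun z hz ↦ not_not.1 hz.2)
  filter_upwards [hc, eventually_of_finite hn hfin] with z hz hz2
  rw [← hz2]
  field_simp

/-! ### Regular points and the slash action -/

theorem analyticAt_mob (γ : Matrix.SpecialLinearGroup (Fin 2) ℚ) {w : ℂ_[p]} (hw : w ∈ Hp p) :
    AnalyticAt ℂ_[p] (mob γ) w := by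
  have h0 := aut_ne_zero_of_mem_Hp γ hw
  unfold aut at h0
  unfold mob
  fun_prop (disch := exact h0)

theorem analyticAt_aut (γ : Matrix.SpecialLinearGroup (Fin 2) ℚ) (w : ℂ_[p]) :
    AnalyticAt ℂ_[p] (aut γ) w := by
  unfold aut
  fun_prop

theorem tendsto_mob (γ : Matrix.SpecialLinearGroup (Fin 2) ℚ) {w : ℂ_[p]} (hw : w ∈ Hp p) :
    Tendsto (mob γ) (𝓝[≠] w) (𝓝[≠] (mob γ w)) := by
  refine tendsto_nhdsWithin_iff.2 ⟨(analyticAt_mob γ hw).continuousAt.tendsto.mono_left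
    nhdsWithin_le_nhds, ?_⟩
  filter_upwards [self_mem_nhdsWithin, mem_nhdsWithin_of_mem_nhds (isOpen_Hp.mem_nhds hw)]
    with z hz hz2 h
  apply hz
  have : mob γ z = mob γ w := h
  rw [Set.mem_singleton_iff, ← mob_inv_mob γ (aut_ne_zero_of_mem_Hp γ hz2), this,
    mob_inv_mob γ (aut_ne_zero_of_mem_Hp γ hw)]

theorem Reg.slash {f : ℂ_[p] → ℂ_[p]} (k : ℕ) (γ : Matrix.SpecialLinearGroup (Fin 2) ℚ)
    {w : ℂ_[p]} (hw : w ∈ Hp p) (hf : Reg f (mob γ w)) : Reg (slash k f γ) w := by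
  obtain ⟨g, h1, h2⟩ := hf
  have h0 := aut_ne_zero_of_mem_Hp γ hw
  refine ⟨fun z ↦ (aut γ z ^ k)⁻¹ * g (mob γ z), ?_, ?_⟩
  · exact (((analyticAt_aut γ w).pow k).inv (pow_ne_zero _ h0)).mul
      (h1.comp (analyticAt_mob γ hw))
  · filter_upwards [(tendsto_mob γ hw).eventually h2] with z hz
    rw [slash_apply, hz]

theorem slash_slash_inv (f : ℂ_[p] → ℂ_[p]) (k : ℕ) (γ : Matrix.SpecialLinearGroup (Fin 2) ℚ)
    {z : ℂ_[p]} (hz : z ∈ Hp p) : slash k (slash k f γ) γ⁻¹ z = f z := by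
  have h0 := aut_ne_zero_of_mem_Hp γ⁻¹ hz
  rw [slash_apply, slash_apply, ← mul_assoc, ← mul_inv, ← mul_pow,
    mul_comm (aut γ⁻¹ z), ← aut_mul _ _ h0, ← mob_mul _ _ h0, mul_inv_cancel, mob_one]
  simp [aut]

theorem Reg.of_slash {f : ℂ_[p] → ℂ_[p]} {k : ℕ} {γ : Matrix.SpecialLinearGroup (Fin 2) ℚ}
    {w : ℂ_[p]} (hw : w ∈ Hp p) (hf : Reg (RigidCocycle.slash k f γ) w) : Reg f (mob γ w) := by
  have h1 := mob_mem_Hp γ hw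
  have h0 := aut_ne_zero_of_mem_Hp γ hw
  have h2 : Reg (RigidCocycle.slash k (RigidCocycle.slash k f γ) γ⁻¹) (mob γ w) := by
    refine Reg.slash k _ h1 ?_
    rwa [mob_inv_mob γ h0]
  refine h2.congr ?_
  filter_upwards [mem_nhdsWithin_of_mem_nhds (isOpen_Hp.mem_nhds h1)] with z hz
  exact slash_slash_inv f k γ hz

/-! ### Integral matrices and the Ihara group -/

/-- The inclusion of `SL₂(ℤ)` in `SL₂(ℚ)`. -/
def toQ : Matrix.SpecialLinearGroup (Fin 2) ℤ →* Matrix.SpecialLinearGroup (Fin 2) ℚ :=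
  Matrix.SpecialLinearGroup.map (Int.castRingHom ℚ)

@[simp]
theorem toQ_apply (M : Matrix.SpecialLinearGroup (Fin 2) ℤ) (i j : Fin 2) :
    toQ M i j = (M i j : ℚ) := rfl

theorem int_det (M : Matrix.SpecialLinearGroup (Fin 2) ℤ) :
    M 0 0 * M 1 1 - M 0 1 * M 1 0 = 1 := by
  have := M.det_coe
  rwa [Matrix.det_fin_two] at this

/-- The matrix with the given rows. -/
def mk2 {R : Type*} [CommRing R] (a b c d : R) (h : a * d - b * c = 1) :
    Matrix.SpecialLinearGroup (Fin 2) R :=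
  ⟨!![a, b; c, d], by rw [Matrix.det_fin_two_of, h]⟩

section
variable {R : Type*} [CommRing R] {a b c d : R} (h : a * d - b * c = 1)
@[simp] theorem mk2_00 : mk2 a b c d h 0 0 = a := rfl
@[simp] theorem mk2_01 : mk2 a b c d h 0 1 = b := rfl
@[simp] theorem mk2_10 : mk2 a b c d h 1 0 = c := rfl
@[simp] theorem mk2_11 : mk2 a b c d h 1 1 = d := rfl
end

variable (p) in
omit [Fact p.Prime] in
theorem mem_ihara {γ : Matrix.SpecialLinearGroup (Fin 2) ℚ} :
    γ ∈ ihara p ↔ ∀ i j, γ i j ∈ Algebra.adjoin ℤ {(p : ℚ)⁻¹} := by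
  constructor
  · rintro ⟨δ, rfl⟩ i j
    exact (δ i j).2
  · intro h
    refine ⟨mk2 ⟨γ 0 0, h 0 0⟩ ⟨γ 0 1, h 0 1⟩ ⟨γ 1 0, h 1 0⟩ ⟨γ 1 1, h 1 1⟩ ?_, ?_⟩
    · apply Subtype.ext
      have := γ.det_coe
      rwa [Matrix.det_fin_two] at this
    · ext i j
      fin_cases i <;> fin_cases j <;> rfl

theorem toQ_mem_ihara (M : Matrix.SpecialLinearGroup (Fin 2) ℤ) : toQ M ∈ ihara p := by
  rw [mem_ihara]
  intro i j
  rw [toQ_apply]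
  exact algebraMap_mem (Algebra.adjoin ℤ {(p : ℚ)⁻¹}) (M i j)

theorem exists_pow_mul_eq_of_mem_adjoin {x : ℚ} (hx : x ∈ Algebra.adjoin ℤ {(p : ℚ)⁻¹}) :
    ∃ (m : ℕ) (a : ℤ), (p : ℚ) ^ m * x = a := by
  have hp : (p : ℚ) ≠ 0 := by exact_mod_cast (Fact.out : p.Prime).ne_zero
  induction hx using Algebra.adjoin_induction with
  | mem x hx =>
    rw [Set.mem_singleton_iff.1 hx]
    exact ⟨1, 1, by simp [hp]⟩
  | algebraMap r => exact ⟨0, r, by simp⟩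
  | add x y _ _ hx hy =>
    obtain ⟨m, a, h⟩ := hx
    obtain ⟨n, b, h'⟩ := hy
    refine ⟨m + n, p ^ n * a + p ^ m * b, ?_⟩
    push_cast
    rw [← h, ← h']
    ring
  | mul x y _ _ hx hy =>
    obtain ⟨m, a, h⟩ := hx
    obtain ⟨n, b, h'⟩ := hy
    refine ⟨m + n, a * b, ?_⟩
    push_cast
    rw [← h, ← h']
    ring

omit [Fact p.Prime] in
theorem div_pow_mem_adjoin (a : ℤ) (m : ℕ) :
    (a : ℚ) / (p : ℚ) ^ m ∈ Algebra.adjoin ℤ {(p : ℚ)⁻¹} := by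
  rw [div_eq_mul_inv, ← inv_pow]
  exact mul_mem (algebraMap_mem (Algebra.adjoin ℤ {(p : ℚ)⁻¹}) a)
    (pow_mem (Algebra.subset_adjoin (Set.mem_singleton _)) m)

/-- The matrix `p ^ m γ` is integral for `m` large. -/
theorem exists_int_matrix {γ : Matrix.SpecialLinearGroup (Fin 2) ℚ} (hγ : γ ∈ ihara p) :
    ∃ (m : ℕ) (M : Fin 2 → Fin 2 → ℤ), ∀ i j, (p : ℚ) ^ m * γ i j = M i j := by
  choose m a h using fun i j ↦ exists_pow_mul_eq_of_mem_adjoin ((mem_ihara p).1 hγ i j)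
  set N := m 0 0 + m 0 1 + m 1 0 + m 1 1
  have hN : ∀ i j, m i j ≤ N := by
    intro i j
    fin_cases i <;> fin_cases j <;> simp [N] <;> omega
  refine ⟨N, fun i j ↦ p ^ (N - m i j) * a i j, fun i j ↦ ?_⟩
  push_cast
  rw [← h i j, ← mul_assoc, ← pow_add, Nat.sub_add_cancel (hN i j)]

/-- The quantity |bz - a| / max(1, |z|) is a homogeneous distance in ℙ₁. An integral matrix of
determinant 1 permutes the primitive pairs (a, b), and neither norm grows under it. -/
theorem mob_mem_affinoid {n : ℕ} (M : Matrix.SpecialLinearGroup (Fin 2) ℤ) {z : ℂ_[p]}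
    (hz : z ∈ affinoid p n) : mob (toQ M) z ∈ affinoid p n := by
  have h0 := aut_ne_zero_of_mem_Hp (toQ M) (affinoid_subset_Hp n hz)
  intro a b hab
  have hdet : (M 0 0 : ℚ_[p]) * M 1 1 - M 0 1 * M 1 0 = 1 := by exact_mod_cast int_det M
  -- The pair (a', b') is M⁻¹(a, b); it has norm at least 1 because the integral matrix `M` takes it
  -- back to (a, b).
  set a' : ℚ_[p] := M 1 1 * a - M 0 1 * b
  set b' : ℚ_[p] := M 0 0 * b - M 1 0 * a
  have hle : ∀ (m : ℤ) (x : ℚ_[p]), ‖(m : ℚ_[p]) * x‖ ≤ ‖x‖ := fun m x ↦ by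
    rw [norm_mul]
    exact mul_le_of_le_one_left (norm_nonneg _) (Padic.norm_int_le_one m)
  have hle' : ∀ (m : ℤ) (x : ℂ_[p]), ‖(m : ℂ_[p]) * x‖ ≤ ‖x‖ := fun m x ↦ by
    rw [norm_mul]
    exact mul_le_of_le_one_left (norm_nonneg _) (norm_intCast_le_one m)
  have hmax : 1 ≤ max ‖a'‖ ‖b'‖ := by
    rw [← hab]
    refine max_le ?_ ?_
    · have : a = M 0 0 * a' + M 0 1 * b' := by
        simp only [a', b']; linear_combination -a * hdet
      calc ‖a‖ = ‖M 0 0 * a' + M 0 1 * b'‖ := by rw [← this]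
        _ ≤ _ := (IsUltrametricDist.norm_add_le_max _ _).trans (max_le_max (hle _ _) (hle _ _))
    · have : b = M 1 0 * a' + M 1 1 * b' := by
        simp only [a', b']; linear_combination -b * hdet
      calc ‖b‖ = ‖M 1 0 * a' + M 1 1 * b'‖ := by rw [← this]
        _ ≤ _ := (IsUltrametricDist.norm_add_le_max _ _).trans (max_le_max (hle _ _) (hle _ _))
  have h1 := le_norm_of_mem_affinoid hz a' b'
  have h2 : (p : ℝ)⁻¹ ^ n * max 1 ‖z‖ ≤
      ‖algebraMap ℚ_[p] ℂ_[p] b' * z - algebraMap ℚ_[p] ℂ_[p] a'‖ := by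
    refine le_trans ?_ h1
    have := inv_p_pow_pos (p := p) n
    exact le_mul_of_one_le_right (by positivity) hmax
  have e : algebraMap ℚ_[p] ℂ_[p] b' * z - algebraMap ℚ_[p] ℂ_[p] a' =
      aut (toQ M) z * (algebraMap ℚ_[p] ℂ_[p] b * mob (toQ M) z - algebraMap ℚ_[p] ℂ_[p] a) := by
    have hm : aut (toQ M) z * mob (toQ M) z = M 0 0 * z + M 0 1 := by
      unfold mob
      rw [← aut, mul_div_cancel₀ _ h0]
      simp
    rw [mul_sub, mul_left_comm, hm]
    simp only [a', b', aut, toQ_apply]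
    simp
    ring
  have hnum : ∀ x y : ℤ, ‖(x : ℂ_[p]) * z + y‖ ≤ max 1 ‖z‖ := fun x y ↦
    (IsUltrametricDist.norm_add_le_max _ _).trans (max_le ((hle' _ _).trans (le_max_right _ _))
      ((norm_intCast_le_one y).trans (le_max_left _ _)))
  have h3 : ‖aut (toQ M) z‖ * max 1 ‖mob (toQ M) z‖ ≤ max 1 ‖z‖ := by
    rw [mul_max_of_nonneg _ _ (norm_nonneg _), mul_one, ← norm_mul]
    refine max_le ?_ ?_
    · simpa [aut] using hnum (M 1 0) (M 1 1)
    · have hm : aut (toQ M) z * mob (toQ M) z = M 0 0 * z + M 0 1 := by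
        unfold mob
        rw [← aut, mul_div_cancel₀ _ h0]
        simp
      rw [hm]
      exact hnum _ _
  rw [e, norm_mul] at h2
  have hpos : 0 < ‖aut (toQ M) z‖ := norm_pos_iff.2 h0
  have hpn := inv_p_pow_pos (p := p) n
  refine le_of_mul_le_mul_left ?_ hpos
  calc _ = (p : ℝ)⁻¹ ^ n * (‖aut (toQ M) z‖ * max 1 ‖mob (toQ M) z‖) := by ring
    _ ≤ (p : ℝ)⁻¹ ^ n * max 1 ‖z‖ := by gcongr
    _ ≤ _ := h2

/-- Every point of `Hp` can be moved into `affinoid p 1` by the Ihara group. -/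
theorem exists_mob_mem_affinoid_one {z : ℂ_[p]} (hz : z ∈ Hp p) :
    ∃ γ ∈ ihara p, mob γ z ∈ affinoid p 1 := by
  have hp0 : (p : ℚ) ≠ 0 := by exact_mod_cast (Fact.out : p.Prime).ne_zero
  obtain ⟨δ, hδ, hmin⟩ := exists_pos_le_norm_sub hz
  -- a best approximation in `ℚ_p`
  obtain ⟨a₀, ha₀⟩ : ∃ a₀ : ℚ_[p], ∀ a : ℚ_[p],
      ‖z - algebraMap ℚ_[p] ℂ_[p] a₀‖ ≤ ‖z - algebraMap ℚ_[p] ℂ_[p] a‖ := by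
    have hcont : Continuous fun a : ℚ_[p] ↦ ‖z - algebraMap ℚ_[p] ℂ_[p] a‖ := by
      have := (algebraMap_isometry ℚ_[p] ℂ_[p]).continuous
      fun_prop
    refine hcont.exists_forall_le ?_
    refine tendsto_atTop_mono (f := fun a : ℚ_[p] ↦ ‖a‖ - ‖z‖) (fun a ↦ ?_) ?_
    · have := norm_sub_norm_le (algebraMap ℚ_[p] ℂ_[p] a) z
      rwa [norm_algebraMap', norm_sub_rev] at this
    · exact tendsto_atTop_add_const_right _ _ (tendsto_norm_cocompact_atTop)
  set r := ‖z - algebraMap ℚ_[p] ℂ_[p] a₀‖ with hr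
  have hrpos : 0 < r := hδ.trans_le (hmin a₀)
  obtain ⟨m, n, hmn⟩ : ∃ (m : ℕ) (n : ℤ), ‖a₀ - (n : ℚ_[p]) / (p : ℚ_[p]) ^ m‖ < r := by
    have hpp : (p : ℚ_[p]) ≠ 0 := by exact_mod_cast (Fact.out : p.Prime).ne_zero
    obtain ⟨m, hm⟩ : ∃ m : ℕ, ‖(p : ℚ_[p]) ^ m * a₀‖ ≤ 1 := by
      have h1 : Tendsto (fun m : ℕ ↦ ‖(p : ℚ_[p]) ^ m * a₀‖) atTop (𝓝 0) := by
        simp_rw [norm_mul, norm_pow, Padic.norm_p]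
        have := tendsto_pow_atTop_nhds_zero_of_lt_one (inv_pos.2 (p_pos (p := p))).le
          (inv_lt_one_of_one_lt₀ (one_lt_p (p := p)))
        simpa using this.mul_const ‖a₀‖
      exact (h1.eventually (eventually_le_nhds one_pos)).exists
    obtain ⟨x, hx⟩ : ∃ x : ℤ_[p], (x : ℚ_[p]) = (p : ℚ_[p]) ^ m * a₀ := ⟨⟨_, hm⟩, rfl⟩
    obtain ⟨n, hn⟩ := PadicInt.denseRange_natCast.exists_dist_lt x (show 0 < r * (p : ℝ)⁻¹ ^ m from
        mul_pos hrpos (inv_p_pow_pos m))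
    refine ⟨m, n, ?_⟩
    rw [dist_eq_norm, PadicInt.norm_def] at hn
    have hn' : ‖(p : ℚ_[p]) ^ m * a₀ - n‖ < r * (p : ℝ)⁻¹ ^ m := by
      rw [← hx]; simpa using hn
    have e : (p : ℚ_[p]) ^ m * a₀ - n = (p : ℚ_[p]) ^ m * (a₀ - (n : ℚ_[p]) / (p : ℚ_[p]) ^ m) := by
      field_simp
    rw [e, norm_mul, norm_pow, Padic.norm_p, mul_comm] at hn'
    have := lt_of_mul_lt_mul_right hn' (inv_p_pow_pos m).le
    simpa using this
  set a : ℚ := (n : ℚ) / (p : ℚ) ^ m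
  have hzar : ‖z - a‖ = r := by
    have e : z - a = (z - algebraMap ℚ_[p] ℂ_[p] a₀) +
        algebraMap ℚ_[p] ℂ_[p] (a₀ - (n : ℚ_[p]) / (p : ℚ_[p]) ^ m) := by
      simp [a]
    refine le_antisymm ?_ ?_
    · rw [e]
      refine (IsUltrametricDist.norm_add_le_max _ _).trans (max_le le_rfl ?_)
      rw [norm_algebraMap']; exact hmn.le
    · rw [ratCast_eq_algebraMap]; exact ha₀ _
  -- scaling
  obtain ⟨j, hj1, hj2⟩ := exists_mem_Ico_zpow (x := r * p) (y := (p : ℝ) ^ 2) (by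
    have := p_pos (p := p); positivity) (by have := one_lt_p (p := p); nlinarith)
  have hpr : (p : ℝ) ≠ 0 := p_pos.ne'
  have hmemj : ∀ i : ℤ, (p : ℚ) ^ i ∈ Algebra.adjoin ℤ {(p : ℚ)⁻¹} := by
    intro i
    obtain ⟨i, rfl | rfl⟩ := i.eq_nat_or_neg
    · simpa using div_pow_mem_adjoin (p := p) ((p : ℤ) ^ i) 0
    · simpa using div_pow_mem_adjoin (p := p) 1 i
  have hdet : (p : ℚ) ^ j * (p : ℚ) ^ (-j) - (-(a * (p : ℚ) ^ j)) * 0 = 1 := by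
    rw [← zpow_add₀ hp0]; simp
  -- The map z ↦ p^(2j)(z - a). Only even powers of `p` are available as scaling factors, so |s| can
  -- be brought into [1/p, p) but not to 1; hence `affinoid p 1` and not `affinoid p 0`.
  refine ⟨mk2 ((p : ℚ) ^ j) (-(a * (p : ℚ) ^ j)) 0 ((p : ℚ) ^ (-j)) hdet, ?_, ?_⟩
  · rw [mem_ihara]
    have h1 := hmemj j
    have h2 := hmemj (-j)
    have h3 := neg_mem (mul_mem (div_pow_mem_adjoin (p := p) n m) h1)
    intro i k
    fin_cases i <;> fin_cases k
    · exact h1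
    · exact h3
    · exact zero_mem _
    · exact h2
  have hmob : mob (mk2 ((p : ℚ) ^ j) (-(a * (p : ℚ) ^ j)) 0 ((p : ℚ) ^ (-j)) hdet) z =
      ((p : ℂ_[p]) ^ j) ^ 2 * (z - a) := by
    have hpC : (p : ℂ_[p]) ≠ 0 := by exact_mod_cast (Fact.out : p.Prime).ne_zero
    unfold mob
    simp
    ring
  rw [hmob]
  set s := ((p : ℂ_[p]) ^ j) ^ 2 * (z - a) with hs
  have hsn : ‖s‖ = r / ((p : ℝ) ^ 2) ^ j := by
    rw [hs, norm_mul, hzar, norm_pow, norm_zpow, norm_p, div_eq_mul_inv, mul_comm, ← zpow_natCast,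
      ← zpow_natCast (p : ℝ), ← zpow_mul, ← zpow_mul, inv_zpow, mul_comm j]
  have hpj : (0 : ℝ) < ((p : ℝ) ^ 2) ^ j := by have := p_pos (p := p); positivity
  have hs1 : (p : ℝ)⁻¹ ≤ ‖s‖ := by
    rw [hsn, le_div_iff₀ hpj, inv_mul_le_iff₀ p_pos, mul_comm]; exact hj1
  have hs2 : ‖s‖ ≤ p := by
    rw [hsn, div_le_iff₀ hpj]
    rw [zpow_add_one₀ (by positivity)] at hj2
    have := p_pos (p := p)
    nlinarith
  have hsmin : ∀ c : ℚ_[p], ‖s‖ ≤ ‖s - algebraMap ℚ_[p] ℂ_[p] c‖ := by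
    intro c
    have hpC : (p : ℂ_[p]) ≠ 0 := by exact_mod_cast (Fact.out : p.Prime).ne_zero
    have e : s - algebraMap ℚ_[p] ℂ_[p] c = ((p : ℂ_[p]) ^ j) ^ 2 *
        (z - algebraMap ℚ_[p] ℂ_[p] (a + c / ((p : ℚ_[p]) ^ j) ^ 2)) := by
      simp only [map_add, map_div₀, map_pow, map_zpow₀, map_natCast, hs]
      rw [← ratCast_eq_algebraMap]
      field_simp
      ring
    rw [e, hs, norm_mul, norm_mul, hzar]
    gcongr
    exact ha₀ _
  -- As 0 is now a best approximation of `s` in ℚ_p, the vectors `s` and 1 are orthogonal over ℚ_p,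
  -- and |bs - c| is bounded below by both of its terms.
  have hmax : ∀ c : ℚ_[p], max ‖s‖ ‖c‖ ≤ ‖s - algebraMap ℚ_[p] ℂ_[p] c‖ := by
    intro c
    refine max_le (hsmin c) ?_
    have := norm_sub_le_max' s (s - algebraMap ℚ_[p] ℂ_[p] c)
    rw [sub_sub_cancel, norm_algebraMap'] at this
    exact this.trans (max_le (hsmin c) le_rfl)
  intro c b hcb
  have hp1 := inv_pos.2 (p_pos (p := p))
  have key : max (‖b‖ * ‖s‖) ‖c‖ ≤ ‖algebraMap ℚ_[p] ℂ_[p] b * s - algebraMap ℚ_[p] ℂ_[p] c‖ := by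
    by_cases hb : b = 0
    · simp [hb]
    have hb' : algebraMap ℚ_[p] ℂ_[p] b ≠ 0 := by simpa using hb
    have e : algebraMap ℚ_[p] ℂ_[p] b * s - algebraMap ℚ_[p] ℂ_[p] c =
      algebraMap ℚ_[p] ℂ_[p] b * (s - algebraMap ℚ_[p] ℂ_[p] (c / b)) := by
      simp only [map_div₀]; field_simp
    have hbn : ‖b‖ ≠ 0 := by simpa using hb
    rw [e, norm_mul (algebraMap ℚ_[p] ℂ_[p] b), norm_algebraMap']
    calc _ = ‖b‖ * max ‖s‖ ‖c / b‖ := by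
          rw [mul_max_of_nonneg _ _ (norm_nonneg _), norm_div, mul_div_cancel₀ _ hbn]
      _ ≤ _ := by gcongr; exact hmax _
  refine le_trans ?_ key
  rw [pow_one]
  have hu : max 1 ‖s‖ ≤ p := max_le one_lt_p.le hs2
  rcases max_choice ‖c‖ ‖b‖ with h | h <;> rw [h] at hcb
  · refine le_max_of_le_right ?_
    rw [hcb, inv_mul_le_iff₀ p_pos, mul_one]
    exact hu
  · refine le_max_of_le_left ?_
    rw [hcb, one_mul]
    rw [mul_max_of_nonneg _ _ hp1.le, mul_one]
    refine max_le hs1 ?_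
    exact mul_le_of_le_one_left (norm_nonneg _) (inv_le_one_of_one_le₀ one_lt_p.le)

/-! ### Points of the rational projective line -/

/-- The point `(x : y)` of `ℙ₁(ℚ)`. -/
def pt (x y : ℤ) : OnePoint ℚ := if y = 0 then OnePoint.infty else (((x : ℚ) / y : ℚ) : OnePoint ℚ)

theorem pt_neg (x y : ℤ) : pt (-x) (-y) = pt x y := by
  simp [pt, neg_div_neg_eq]

theorem pt_zero_one : pt 0 1 = ((0 : ℚ) : OnePoint ℚ) := by simp [pt]

theorem pt_one_zero : pt 1 0 = OnePoint.infty := by simp [pt]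

theorem exists_pt (r : OnePoint ℚ) : ∃ x y, IsCoprime x y ∧ pt x y = r := by
  induction r using OnePoint.rec with
  | infty => exact ⟨1, 0, isCoprime_one_left, pt_one_zero⟩
  | coe q =>
    refine ⟨q.num, q.den, q.isCoprime_num_den, ?_⟩
    have : (q.den : ℤ) ≠ 0 := by exact_mod_cast q.den_nz
    rw [pt, if_neg this]
    norm_cast
    rw [Rat.num_divInt_den]

theorem pt_eq_pt {x y x' y' : ℤ} (h : IsCoprime x y) (h' : IsCoprime x' y')
    (hd : x * y' - y * x' = 0) : pt x y = pt x' y' := by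
  by_cases hy : y = 0
  · subst hy
    have hx : x ≠ 0 := by
      rintro rfl
      exact not_isCoprime_zero_zero h
    have : y' = 0 := by
      have : x * y' = 0 := by linarith
      exact (mul_eq_zero.1 this).resolve_left hx
    simp [pt, this]
  · have hy' : y' ≠ 0 := by
      rintro rfl
      have hx' : x' ≠ 0 := by
        rintro rfl
        exact not_isCoprime_zero_zero h'
      have : y * x' = 0 := by linarith
      exact hy ((mul_eq_zero.1 this).resolve_right hx')
    rw [pt, pt, if_neg hy, if_neg hy']
    congr 1
    have h1 : (y : ℚ) ≠ 0 := by exact_mod_cast hy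
    have h2 : (y' : ℚ) ≠ 0 := by exact_mod_cast hy'
    rw [div_eq_div_iff h1 h2]
    have : (x : ℚ) * y' - y * x' = 0 := by exact_mod_cast hd
    linear_combination this

theorem actP1_infty (γ : Matrix.SpecialLinearGroup (Fin 2) ℚ) :
    actP1 γ OnePoint.infty =
      if γ 1 0 = 0 then OnePoint.infty else ((γ 0 0 / γ 1 0 : ℚ) : OnePoint ℚ) := by
  unfold actP1
  rw [OnePoint.smul_infty_eq_ite]
  rfl

theorem actP1_coe (γ : Matrix.SpecialLinearGroup (Fin 2) ℚ) (q : ℚ) :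
    actP1 γ (q : OnePoint ℚ) = if γ 1 0 * q + γ 1 1 = 0 then OnePoint.infty else
      (((γ 0 0 * q + γ 0 1) / (γ 1 0 * q + γ 1 1) : ℚ) : OnePoint ℚ) := by
  unfold actP1
  rw [OnePoint.smul_some_eq_ite]
  rfl

theorem actP1_pt (M : Matrix.SpecialLinearGroup (Fin 2) ℤ) (x y : ℤ) (h : IsCoprime x y) :
    actP1 (toQ M) (pt x y) = pt (M 0 0 * x + M 0 1 * y) (M 1 0 * x + M 1 1 * y) := by
  unfold pt
  by_cases hy : y = 0
  · subst hy
    have hx' : x ≠ 0 := by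
      rintro rfl
      exact not_isCoprime_zero_zero h
    have hx : (x : ℚ) ≠ 0 := by exact_mod_cast hx'
    rw [if_pos rfl, actP1_infty]
    simp only [toQ_apply, mul_zero, add_zero, mul_eq_zero, hx', or_false, Int.cast_eq_zero]
    split_ifs
    · rfl
    · push_cast
      rw [mul_div_mul_right _ _ hx]
  · have hy' : (y : ℚ) ≠ 0 := by exact_mod_cast hy
    rw [if_neg hy, actP1_coe]
    have e : ∀ u v : ℤ, (u : ℚ) * (x / y) + v = ((u * x + v * y : ℤ) : ℚ) / y := by
      intro u v; push_cast; field_simp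
    simp only [toQ_apply, e, div_eq_zero_iff, hy', or_false, Int.cast_eq_zero]
    split_ifs
    · rfl
    · rw [div_div_div_cancel_right₀ hy']

theorem actP1_mul (γ δ : Matrix.SpecialLinearGroup (Fin 2) ℚ) (r : OnePoint ℚ) :
    actP1 (γ * δ) r = actP1 γ (actP1 δ r) := by
  simp [actP1, mul_smul]

theorem actP1_one (r : OnePoint ℚ) : actP1 1 r = r := by simp [actP1]

/-! ### Farey paths -/

/-- Two points of `ℙ₁(ℚ)` in a region closed under one of the two segments between any two of its
points are joined by a path of unimodular steps inside the region. -/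
theorem farey_induction {E : OnePoint ℚ → OnePoint ℚ → Prop} (hrefl : ∀ r, E r r)
    (hsymm : ∀ r s, E r s → E s r) (htrans : ∀ r s t, E r s → E s t → E r t)
    {G : ℤ → ℤ → Prop} (hneg : ∀ x y, G x y → G (-x) (-y))
    (hcone : ∀ x y x' y', G x y → G x' y' →
      (∀ i j N a b : ℤ, 0 < i → 0 < j → 0 < N → N * a = i * x + j * x' →
        N * b = i * y + j * y' → G a b) ∨
      (∀ i j N a b : ℤ, 0 < i → 0 < j → 0 < N → N * a = i * x - j * x' →
        N * b = i * y - j * y' → G a b))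
    (hunim : ∀ x y x' y', x * y' - y * x' = 1 → G x y → G x' y' → E (pt x y) (pt x' y')) :
    ∀ (N : ℕ) (x y x' y' : ℤ), IsCoprime x y → IsCoprime x' y' → G x y → G x' y' →
      (x * y' - y * x').natAbs = N → E (pt x y) (pt x' y') := by
  intro N
  induction N using Nat.strong_induction_on with
  | _ N ih =>
    intro x y x' y' hc hc' hG hG' hN
    -- Replacing (x', y') by its negative changes neither the point nor the absolute value of the
    -- determinant, and exchanges the two cones.
    wlog hcone' : (∀ i j N a b : ℤ, 0 < i → 0 < j → 0 < N → N * a = i * x + j * x' →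
        N * b = i * y + j * y' → G a b) generalizing x' y'
    · have h2 := (hcone x y x' y' hG hG').resolve_left hcone'
      rw [← pt_neg x' y']
      refine this (-x') (-y') hc'.neg_neg (hneg _ _ hG') ?_ ?_
      · rw [← hN, ← Int.natAbs_neg]; congr 1; ring
      · intro i j N a b hi hj hN h3 h4
        exact h2 i j N a b hi hj hN (by rw [h3]; ring) (by rw [h4]; ring)
    rcases Nat.lt_or_ge N 2 with hN2 | hN2
    · interval_cases N
      · rw [pt_eq_pt hc hc' (by simpa using hN)]
        exact hrefl _
      · rcases Int.natAbs_eq_iff.1 hN with h | h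
        · exact hunim _ _ _ _ (by simpa using h) hG hG'
        · exact hsymm _ _ (hunim _ _ _ _ (by push_cast at h; linarith) hG' hG)
    · -- an intermediate vector `t = (i v + v') / N` with `det (v, t) = ± 1`
      set D := x * y' - y * x' with hD
      obtain ⟨s, hs, hsD⟩ : ∃ s : ℤ, (s = 1 ∨ s = -1) ∧ D = s * N := by
        rcases Int.natAbs_eq_iff.1 hN with h | h
        · exact ⟨1, Or.inl rfl, by rw [h]; ring⟩
        · exact ⟨-1, Or.inr rfl, by rw [h]; ring⟩
      have hss : s * s = 1 := by rcases hs with rfl | rfl <;> rfl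
      obtain ⟨u, v, huv⟩ := hc
      -- `v₀ = s (-v, u)` has determinant `s` with `(x, y)`
      have hNpos : (0 : ℤ) < N := by omega
      set i₀ : ℤ := -(u * x' + v * y')
      set i := i₀ % N with hi
      set q := i₀ / N with hq
      have hiq : i₀ = i + N * q := by
        rw [hi, hq, Int.emod_add_mul_ediv]
      have hi0 : 0 ≤ i := Int.emod_nonneg _ hNpos.ne'
      have hiN : i < N := Int.emod_lt_of_pos _ hNpos
      set a := s * -v - q * x
      set b := s * u - q * y
      have ha : N * a = i * x + 1 * x' := by
        have h1 : i = i₀ - N * q := by linarith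
        have h2 : (N : ℤ) * (s * -v) = i₀ * x + x' := by
          simp only [i₀]
          linear_combination x' * huv + v * hsD - v * hD
        simp only [a, h1]
        linear_combination h2
      have hb : N * b = i * y + 1 * y' := by
        have h1 : i = i₀ - N * q := by linarith
        have h2 : (N : ℤ) * (s * u) = i₀ * y + y' := by
          simp only [i₀]
          linear_combination y' * huv - u * hsD + u * hD
        simp only [b, h1]
        linear_combination h2
      have hdet : x * b - y * a = s := by
        simp only [a, b]
        linear_combination s * huv
      -- If `i` were 0, then (x', y') would be `N` times an integral vector, which is impossible for
      -- a coprime pair when N ≥ 2.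
      have hipos : 0 < i := by
        refine lt_of_le_of_ne hi0 fun h ↦ ?_
        rw [← h] at ha hb
        obtain ⟨u', v', huv'⟩ := hc'
        have : (N : ℤ) ∣ 1 := ⟨u' * a + v' * b, by
          linear_combination -huv' - u' * ha - v' * hb⟩
        have := Int.le_of_dvd one_pos this
        omega
      have hGt : G a b := hcone' i 1 N a b hipos one_pos hNpos ha hb
      have hct : IsCoprime a b := ⟨-(s * y), s * x, by
        linear_combination s * hdet + hss⟩
      have hdet2 : a * y' - b * x' = s * i := by
        have h1 : (N : ℤ) * (a * y' - b * x') = N * (s * i) := by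
          linear_combination y' * ha - x' * hb + i * hsD - i * hD
        exact mul_left_cancel₀ hNpos.ne' h1
      -- The two new determinants have absolute values 1 and `i`, both smaller than `N`.
      refine htrans _ (pt a b) _ (ih 1 (by omega) x y a b ⟨u, v, huv⟩ hct hG hGt ?_)
        (ih i.natAbs (by omega) a b x' y' hct hc' hGt hG' ?_)
      · rw [hdet]; rcases hs with rfl | rfl <;> rfl
      · rw [hdet2]; rcases hs with rfl | rfl <;> simp

/-! ### Fixed forms of integral matrices -/

/-- The binary quadratic form `det (v, g v)`, whose roots are the fixed points of `g`. -/
def fixForm (g : Matrix.SpecialLinearGroup (Fin 2) ℤ) (x y : ℤ) : ℤ :=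
  g 1 0 * x ^ 2 + (g 1 1 - g 0 0) * x * y - g 0 1 * y ^ 2

theorem sl_inv_apply (M : Matrix.SpecialLinearGroup (Fin 2) ℤ) :
    M⁻¹ 0 0 = M 1 1 ∧ M⁻¹ 0 1 = -M 0 1 ∧ M⁻¹ 1 0 = -M 1 0 ∧ M⁻¹ 1 1 = M 0 0 := by
  refine ⟨?_, ?_, ?_, ?_⟩ <;>
    simp [Matrix.SpecialLinearGroup.coe_inv, Matrix.adjugate_fin_two]

theorem sl_mul_apply (M N : Matrix.SpecialLinearGroup (Fin 2) ℤ) (i j : Fin 2) :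
    (M * N) i j = M i 0 * N 0 j + M i 1 * N 1 j := by
  simp [Matrix.SpecialLinearGroup.coe_mul, Matrix.mul_apply, Fin.sum_univ_two]

/-- det(Mv, MWM⁻¹·Mv) = det M · det(v, Wv). With W = M = g this also says that the fixed form is
invariant under `g` itself. -/
theorem fixForm_conj (M W : Matrix.SpecialLinearGroup (Fin 2) ℤ) (x y : ℤ) :
    fixForm (M * W * M⁻¹) (M 0 0 * x + M 0 1 * y) (M 1 0 * x + M 1 1 * y) = fixForm W x y := by
  obtain ⟨h1, h2, h3, h4⟩ := sl_inv_apply M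
  have hd := int_det M
  simp only [fixForm, sl_mul_apply, h1, h2, h3, h4]
  set a := M 0 0
  set b := M 0 1
  set c := M 1 0
  set d := M 1 1
  -- The left side is homogeneous in the entries of `M`, so the right side needs a factor (det M)²
  -- before the two agree as polynomials.
  have e : ∀ D : ℤ, D = a * d - b * c → D = 1 →
      D ^ 2 * (W 1 0 * x ^ 2 + (W 1 1 - W 0 0) * x * y - W 0 1 * y ^ 2) =
      W 1 0 * x ^ 2 + (W 1 1 - W 0 0) * x * y - W 0 1 * y ^ 2 := by
    intro D _ h
    rw [h, one_pow, one_mul]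
  rw [← e _ rfl hd]
  ring

theorem trace_conj (M W : Matrix.SpecialLinearGroup (Fin 2) ℤ) :
    (M * W * M⁻¹) 0 0 + (M * W * M⁻¹) 1 1 = W 0 0 + W 1 1 := by
  obtain ⟨h1, h2, h3, h4⟩ := sl_inv_apply M
  have hd := int_det M
  simp only [sl_mul_apply, h1, h2, h3, h4]
  linear_combination (W 0 0 + W 1 1) * hd

theorem fixForm_root {g : Matrix.SpecialLinearGroup (Fin 2) ℤ} {w : ℂ_[p]} (hw : w ∈ Hp p)
    (hg : mob (toQ g) w = w) :
    (g 1 0 : ℂ_[p]) * w ^ 2 + (g 1 1 - g 0 0) * w - g 0 1 = 0 := by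
  have h0 := aut_ne_zero_of_mem_Hp (toQ g) hw
  unfold mob at hg
  rw [← aut, div_eq_iff h0] at hg
  simp [aut] at hg
  linear_combination -hg

theorem mob_conj_fix {M W : Matrix.SpecialLinearGroup (Fin 2) ℤ} {x w : ℂ_[p]} (hx : x ∈ Hp p)
    (hw : w = mob (toQ M) x) (hW : mob (toQ W) x = x) : mob (toQ (M * W * M⁻¹)) w = w := by
  have hw' : w ∈ Hp p := hw ▸ mob_mem_Hp _ hx
  have h1 : mob (toQ M⁻¹) w = x := by
    rw [map_inv, hw, mob_inv_mob _ (aut_ne_zero_of_mem_Hp _ hx)]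
  rw [map_mul, map_mul, mob_mul _ _ (aut_ne_zero_of_mem_Hp _ hw'), h1,
    mob_mul _ _ (aut_ne_zero_of_mem_Hp _ hx), hW, hw]

theorem linear_eq_zero {w : ℂ_[p]} (hw : w ∈ Hp p) {a b : ℤ} (h : (a : ℂ_[p]) * w = b) :
    a = 0 ∧ b = 0 := by
  have ha : a = 0 := by
    by_contra ha
    have ha' : (a : ℂ_[p]) ≠ 0 := by exact_mod_cast ha
    apply Hp.ne_ratCast hw ((b : ℚ) / a)
    push_cast
    rw [eq_div_iff ha', mul_comm, h]
  refine ⟨ha, ?_⟩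
  rw [ha] at h
  simp at h
  exact_mod_cast h.symm

/-- Two integral quadratic equations of the same irrational point are proportional. -/
theorem quad_proportional {w : ℂ_[p]} (hw : w ∈ Hp p) {A B C A' B' C' : ℤ}
    (h : (A : ℂ_[p]) * w ^ 2 + B * w + C = 0) (h' : (A' : ℂ_[p]) * w ^ 2 + B' * w + C' = 0) :
    A' * B = A * B' ∧ A' * C = A * C' := by
  have := linear_eq_zero (a := A' * B - A * B') (b := A * C' - A' * C) hw (by
    push_cast; linear_combination (A' : ℂ_[p]) * h - A * h')
  constructor <;> linarith [this.1, this.2]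

theorem fixForm_proportional {g g' : Matrix.SpecialLinearGroup (Fin 2) ℤ} {w : ℂ_[p]}
    (hw : w ∈ Hp p) (hg : mob (toQ g) w = w) (hg' : mob (toQ g') w = w) (x y : ℤ) :
    g' 1 0 * fixForm g x y = g 1 0 * fixForm g' x y := by
  have := quad_proportional hw (A := g 1 0) (B := g 1 1 - g 0 0) (C := -g 0 1) (A' := g' 1 0)
    (B' := g' 1 1 - g' 0 0) (C' := -g' 0 1)
    (by push_cast; linear_combination fixForm_root hw hg)
    (by push_cast; linear_combination fixForm_root hw hg')
  unfold fixForm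
  linear_combination x * y * this.1 + y ^ 2 * this.2

/-! ### The set of singular points of a cocycle -/

/-- The formal properties of the relation "`J r s` is regular at `w`" for a rigid meromorphic
cocycle `J`. -/
structure RegSystem (R : OnePoint ℚ → OnePoint ℚ → ℂ_[p] → Prop) : Prop where
  refl : ∀ w ∈ Hp p, ∀ r, R r r w
  symm : ∀ w ∈ Hp p, ∀ r s, R r s w → R s r w
  trans : ∀ w ∈ Hp p, ∀ r s t, R r s w → R s t w → R r t w
  equiv : ∀ γ ∈ ihara p, ∀ w ∈ Hp p, ∀ r s, R r s w ↔ R (actP1 γ r) (actP1 γ s) (mob γ w)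
  finite : ∀ n, {w ∈ affinoid p n | ¬ R (pt 0 1) (pt 1 0) w}.Finite

namespace RegSystem

variable {R : OnePoint ℚ → OnePoint ℚ → ℂ_[p] → Prop}

theorem transport (hR : RegSystem R) (M : Matrix.SpecialLinearGroup (Fin 2) ℤ) {w : ℂ_[p]}
    (hw : w ∈ Hp p) : R (pt 0 1) (pt 1 0) w ↔
      R (pt (M 0 1) (M 1 1)) (pt (M 0 0) (M 1 0)) (mob (toQ M) w) := by
  rw [hR.equiv _ (toQ_mem_ihara M) w hw, actP1_pt _ _ _ isCoprime_one_right,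
    actP1_pt _ _ _ isCoprime_one_left]
  simp

/-- The path from 0 to ∞ is cut at 1, and one of the halves must be singular at `w`; each half is
the image of {0, ∞} under a nonnegative unipotent matrix. The entries of the identity sum to 2, so
the bound 3 records that no nonempty product of such matrices is trivial. -/
theorem step (hR : RegSystem R) {n : ℕ} {w : ℂ_[p]} (hw : w ∈ affinoid p n)
    (h : ¬ R (pt 0 1) (pt 1 0) w) :
    ∃ M : Matrix.SpecialLinearGroup (Fin 2) ℤ, (∀ i j, 0 ≤ M i j) ∧
      (∀ N : Matrix.SpecialLinearGroup (Fin 2) ℤ, (∀ i j, 0 ≤ N i j) →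
        3 ≤ (M * N) 0 0 + (M * N) 0 1 + (M * N) 1 0 + (M * N) 1 1) ∧
      ∃ x ∈ affinoid p n, ¬ R (pt 0 1) (pt 1 0) x ∧ w = mob (toQ M) x := by
  have hwH := affinoid_subset_Hp n hw
  have key : ∀ M : Matrix.SpecialLinearGroup (Fin 2) ℤ,
      ¬ R (pt (M 0 1) (M 1 1)) (pt (M 0 0) (M 1 0)) w →
      ∃ x ∈ affinoid p n, ¬ R (pt 0 1) (pt 1 0) x ∧ w = mob (toQ M) x := by
    intro M hM
    have h1 : mob (toQ M) (mob (toQ M⁻¹) w) = w := by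
      rw [← mob_mul _ _ (aut_ne_zero_of_mem_Hp _ hwH), ← map_mul, mul_inv_cancel, map_one, mob_one]
    refine ⟨mob (toQ M⁻¹) w, mob_mem_affinoid _ hw, ?_, h1.symm⟩
    rw [hR.transport M (mob_mem_Hp _ hwH), h1]
    exact hM
  have hpos : ∀ N : Matrix.SpecialLinearGroup (Fin 2) ℤ, (∀ i j, 0 ≤ N i j) →
      1 ≤ N 0 0 ∧ 1 ≤ N 1 1 := by
    intro N hN
    have hd := int_det N
    have h1 : 0 < N 0 0 * N 1 1 := by nlinarith [mul_nonneg (hN 0 1) (hN 1 0)]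
    exact ⟨pos_of_mul_pos_left h1 (hN 1 1), pos_of_mul_pos_right h1 (hN 0 0)⟩
  by_cases h1 : R (pt 0 1) (pt 1 1) w
  · have h2 : ¬ R (pt 1 1) (pt 1 0) w := fun h2 ↦ h (hR.trans w hwH _ _ _ h1 h2)
    refine ⟨mk2 1 1 0 1 (by norm_num), ?_, fun N hN ↦ ?_, key _ (by simpa using h2)⟩
    · intro i j; fin_cases i <;> fin_cases j <;> simp
    · simp only [sl_mul_apply, mk2_00, mk2_01, mk2_10, mk2_11]
      linarith [hN 0 0, hN 0 1, hN 1 0, hN 1 1, (hpos N hN).1, (hpos N hN).2]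
  · refine ⟨mk2 1 0 1 1 (by norm_num), ?_, fun N hN ↦ ?_, key _ (by simpa using h1)⟩
    · intro i j; fin_cases i <;> fin_cases j <;> simp
    · simp only [sl_mul_apply, mk2_00, mk2_01, mk2_10, mk2_11]
      linarith [hN 0 0, hN 0 1, hN 1 0, hN 1 1, (hpos N hN).1, (hpos N hN).2]

/-- A singular point of `J 0 ∞` is the image under a nonnegative matrix of a fixed point of a
nontrivial nonnegative matrix. -/
theorem exists_nonneg (hR : RegSystem R) {w : ℂ_[p]} (hw : w ∈ Hp p)
    (h : ¬ R (pt 0 1) (pt 1 0) w) :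
    ∃ M W : Matrix.SpecialLinearGroup (Fin 2) ℤ, (∀ i j, 0 ≤ M i j) ∧ (∀ i j, 0 ≤ W i j) ∧
      3 ≤ W 0 0 + W 0 1 + W 1 0 + W 1 1 ∧ ∃ x ∈ Hp p, w = mob (toQ M) x ∧ mob (toQ W) x = x := by
  obtain ⟨n, hn⟩ := exists_mem_affinoid hw
  let P := {w ∈ affinoid p n | ¬ R (pt 0 1) (pt 1 0) w}
  have hfin : Finite P := (hR.finite n).to_subtype
  have hstep : ∀ w : P, ∃ M : Matrix.SpecialLinearGroup (Fin 2) ℤ, (∀ i j, 0 ≤ M i j) ∧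
      (∀ N : Matrix.SpecialLinearGroup (Fin 2) ℤ, (∀ i j, 0 ≤ N i j) →
        3 ≤ (M * N) 0 0 + (M * N) 0 1 + (M * N) 1 0 + (M * N) 1 1) ∧
      ∃ x : P, (w : ℂ_[p]) = mob (toQ M) (x : ℂ_[p]) := by
    rintro ⟨w, hw, hw'⟩
    obtain ⟨M, h1, h2, x, hx, hx', h3⟩ := hR.step hw hw'
    exact ⟨M, h1, h2, ⟨x, hx, hx'⟩, h3⟩
  choose m hm1 hm2 f hf using hstep
  have hPH : ∀ x : P, (x : ℂ_[p]) ∈ Hp p := fun x ↦ affinoid_subset_Hp n x.2.1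
  have hword : ∀ (i : ℕ) (w : P), ∃ N : Matrix.SpecialLinearGroup (Fin 2) ℤ, (∀ i j, 0 ≤ N i j) ∧
      (0 < i → 3 ≤ N 0 0 + N 0 1 + N 1 0 + N 1 1) ∧
      (w : ℂ_[p]) = mob (toQ N) ((f^[i] w : P) : ℂ_[p]) := by
    intro i
    induction i with
    | zero =>
      intro w
      refine ⟨1, ?_, by simp, by simp [mob_one]⟩
      intro i j; fin_cases i <;> fin_cases j <;> simp
    | succ i ih =>
      intro w
      obtain ⟨N, h1, -, h3⟩ := ih (f w)
      refine ⟨m w * N, fun i j ↦ ?_, fun _ ↦ hm2 w N h1, ?_⟩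
      · rw [sl_mul_apply]
        exact add_nonneg (mul_nonneg (hm1 _ _ _) (h1 _ _)) (mul_nonneg (hm1 _ _ _) (h1 _ _))
      · rw [map_mul, mob_mul _ _ (aut_ne_zero_of_mem_Hp _ (hPH _)), Function.iterate_succ_apply,
          ← h3, ← hf]
  -- Iterating the step inside the finite set of singular points of one affinoid must repeat a
  -- point. The word before the repetition is `M`, and the word along the cycle is `W`.
  obtain ⟨i, j, hij, hfij⟩ := Finite.exists_ne_map_eq_of_infinite
    fun i : ℕ ↦ f^[i] (⟨w, hn, h⟩ : P)
  wlog hlt : i < j generalizing i j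
  · exact this j i hij.symm hfij.symm (lt_of_le_of_ne (not_lt.1 hlt) hij.symm)
  obtain ⟨M, hM, -, hM2⟩ := hword i ⟨w, hn, h⟩
  obtain ⟨W, hW, hW2, hW3⟩ := hword (j - i) (f^[i] ⟨w, hn, h⟩)
  rw [← Function.iterate_add_apply, Nat.sub_add_cancel hlt.le] at hW3
  refine ⟨M, W, hM, hW, hW2 (by omega), _, hPH _, hM2, ?_⟩
  change f^[i] _ = f^[j] _ at hfij
  rw [← hfij] at hW3
  exact hW3.symm

/-- A singular point `w` of `J 0 ∞` is fixed by a hyperbolic matrix `g`, and `0` and `∞` separate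
its two real fixed points; here only that the fixed form changes sign on the positive quadrant. -/
theorem exists_fix_quadrant (hR : RegSystem R) {w : ℂ_[p]} (hw : w ∈ Hp p)
    (h : ¬ R (pt 0 1) (pt 1 0) w) :
    ∃ g : Matrix.SpecialLinearGroup (Fin 2) ℤ, mob (toQ g) w = w ∧ 3 ≤ g 0 0 + g 1 1 ∧
      ∃ x y x' y' : ℤ, 0 ≤ x ∧ 0 ≤ y ∧ 0 ≤ x' ∧ 0 ≤ y' ∧ 0 < fixForm g x y ∧
        fixForm g x' y' < 0 := by
  obtain ⟨M, W, hM, hW, hW3, x, hx, hwx, hWx⟩ := hR.exists_nonneg hw h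
  have hroot := fixForm_root hx hWx
  have hd := int_det W
  -- A nonnegative `W` with a zero off the diagonal is unipotent and triangular; being nontrivial it
  -- has only a rational fixed point, so it cannot fix a point of `Hp`.
  have hone : W 0 1 * W 1 0 = 0 → W 0 0 = 1 ∧ W 1 1 = 1 := by
    intro h0
    have h1 : W 0 0 * W 1 1 = 1 := by linarith
    exact (Int.mul_eq_one_iff_eq_one_or_neg_one.1 h1).resolve_right fun h ↦ by
      have := hW 0 0; omega
  have hc : W 1 0 ≠ 0 := by
    intro h0
    obtain ⟨h1, h2⟩ := hone (by rw [h0, mul_zero])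
    rw [h0, h1, h2] at hroot
    have : W 0 1 = 0 := by
      have : (W 0 1 : ℂ_[p]) = 0 := by simpa using hroot
      exact_mod_cast this
    omega
  have hb : W 0 1 ≠ 0 := by
    intro h0
    obtain ⟨h1, h2⟩ := hone (by rw [h0, zero_mul])
    rw [h0, h1, h2] at hroot
    have hx0 : x ≠ 0 := by simpa using Hp.ne_ratCast hx 0
    have : (W 1 0 : ℂ_[p]) = 0 := by simpa [hx0] using hroot
    exact hc (by exact_mod_cast this)
  have hc' : 0 < W 1 0 := lt_of_le_of_ne (hW 1 0) hc.symm
  have hb' : 0 < W 0 1 := lt_of_le_of_ne (hW 0 1) hb.symm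
  refine ⟨M * W * M⁻¹, mob_conj_fix hx hwx hWx, ?_, M 0 0, M 1 0, M 0 1, M 1 1, hM _ _, hM _ _,
    hM _ _, hM _ _, ?_, ?_⟩
  · rw [trace_conj]
    by_contra hlt
    have h1 := hW 0 0
    have h2 := hW 1 1
    -- The product of the diagonal entries is 1 plus the product of the positive off-diagonal ones,
    -- whereas nonnegative integers of sum at most 2 have product at most 1.
    have h3 : 2 ≤ W 0 0 * W 1 1 := by nlinarith
    have h4 : W 0 0 + W 1 1 ≤ 2 := by omega
    nlinarith [sq_nonneg (W 0 0 - W 1 1)]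
  · have := fixForm_conj M W 1 0
    simp only [mul_one, mul_zero, add_zero] at this
    rw [this]
    simpa [fixForm] using hc'
  · have := fixForm_conj M W 0 1
    simp only [mul_one, mul_zero, zero_add] at this
    rw [this]
    simpa [fixForm] using hb'

/-- A singular point `w` of `J 0 ∞` is fixed by a hyperbolic matrix `g` in `SL₂(ℤ)`, whose real
fixed points are separated by `0` and `∞`. -/
theorem exists_fix (hR : RegSystem R) {w : ℂ_[p]} (hw : w ∈ Hp p)
    (h : ¬ R (pt 0 1) (pt 1 0) w) :
    ∃ g : Matrix.SpecialLinearGroup (Fin 2) ℤ, mob (toQ g) w = w ∧ 3 ≤ g 0 0 + g 1 1 ∧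
      0 < g 1 0 * g 0 1 := by
  obtain ⟨g, hg, htr, x, y, x', y', hx, hy, hx', hy', hpos, hneg⟩ := hR.exists_fix_quadrant hw h
  -- The map z ↦ -1/z exchanges 0 and ∞ and carries the positive quadrant to the adjacent one. The
  -- fixed form therefore changes sign on both.
  set S : Matrix.SpecialLinearGroup (Fin 2) ℤ := mk2 0 (-1) 1 0 (by norm_num) with hS
  have hSw := mob_mem_Hp (toQ S) hw
  have hS' : ¬ R (pt 0 1) (pt 1 0) (mob (toQ S) w) := by
    intro h1
    apply h
    rw [hR.transport S hw]
    have h2 := hR.symm _ hSw _ _ h1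
    have e1 : pt (S 0 1) (S 1 1) = pt 1 0 := by
      rw [← pt_neg 1 0]; simp [hS]
    have e2 : pt (S 0 0) (S 1 0) = pt 0 1 := by simp [hS]
    rwa [e1, e2]
  obtain ⟨g', hg', -, u, v, u', v', hu, hv, hu', hv', hpos', hneg'⟩ := hR.exists_fix_quadrant hSw hS'
  have hfix : mob (toQ (S⁻¹ * g' * S⁻¹⁻¹)) w = w := by
    refine mob_conj_fix hSw ?_ hg'
    rw [map_inv, mob_inv_mob _ (aut_ne_zero_of_mem_Hp _ hw)]
  have hSinv := sl_inv_apply S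
  have e : ∀ x y, fixForm (S⁻¹ * g' * S⁻¹⁻¹) y (-x) = fixForm g' x y := by
    intro x y
    rw [← fixForm_conj S⁻¹ g' x y, hSinv.1, hSinv.2.1, hSinv.2.2.1, hSinv.2.2.2]
    simp [hS]
  have hprop := fixForm_proportional hw hg hfix
  set g'' := S⁻¹ * g' * S⁻¹⁻¹
  refine ⟨g, hg, htr, ?_⟩
  have hroot := fixForm_root hw hg
  have hroot'' := fixForm_root hw hfix
  have hw0 : w ≠ 0 := by simpa using Hp.ne_ratCast hw 0
  have hc : g 1 0 ≠ 0 := by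
    intro h0
    have := linear_eq_zero hw (a := g 1 1 - g 0 0) (b := g 0 1) (by
      rw [h0] at hroot; push_cast; linear_combination hroot)
    simp [fixForm, h0, this.1, this.2] at hpos
  have hc'' : g'' 1 0 ≠ 0 := by
    intro h0
    have := linear_eq_zero hw (a := g'' 1 1 - g'' 0 0) (b := g'' 0 1) (by
      rw [h0] at hroot''; push_cast; linear_combination hroot'')
    rw [← e] at hpos'
    simp [fixForm, h0, this.1, this.2] at hpos'
  have hb : g 0 1 ≠ 0 := by
    intro h0
    have := linear_eq_zero hw (a := g 1 0) (b := -(g 1 1 - g 0 0)) (by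
      rw [h0] at hroot
      have h2 : w * ((g 1 0 : ℂ_[p]) * w + (g 1 1 - g 0 0)) = 0 := by
        push_cast at hroot; linear_combination hroot
      have := (mul_eq_zero.1 h2).resolve_left hw0
      push_cast; linear_combination this)
    exact hc this.1
  by_contra hle
  have hAC : g 1 0 * g 0 1 < 0 := lt_of_le_of_ne (not_lt.1 hle) (mul_ne_zero hc hb)
  set c := g 1 0
  set b := g 0 1
  -- If cb < 0, both square terms of c·F are nonnegative, so its middle term makes it nonnegative on
  -- one of the two quadrants, contradicting the change of sign there.
  have hcF : ∀ x y, c * fixForm g x y = (c * x) ^ 2 + c * (g 1 1 - g 0 0) * (x * y) -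
      c * b * y ^ 2 := fun x y ↦ by simp only [fixForm]; ring
  rcases le_total 0 (c * (g 1 1 - g 0 0)) with hs | hs
  · have hnn : ∀ x y, 0 ≤ x → 0 ≤ y → 0 ≤ c * fixForm g x y := by
      intro x y hx hy
      rw [hcF]
      nlinarith [mul_nonneg hs (mul_nonneg hx hy), sq_nonneg (c * x), sq_nonneg y]
    have h1 := hnn x y hx hy
    have h2 := hnn x' y' hx' hy'
    have h3 : 0 ≤ c := nonneg_of_mul_nonneg_left h1 hpos
    have h4 : c ≤ 0 := by
      by_contra h5
      have := mul_neg_of_pos_of_neg (not_le.1 h5) hneg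
      linarith
    exact hc (le_antisymm h4 h3)
  · have hnn : ∀ x y, 0 ≤ x → 0 ≤ y → 0 ≤ c * fixForm g y (-x) := by
      intro x y hx hy
      rw [hcF]
      nlinarith [mul_nonneg (neg_nonneg.2 hs) (mul_nonneg hx hy), sq_nonneg (c * y), sq_nonneg x]
    have h1 := hnn u v hu hv
    have h2 := hnn u' v' hu' hv'
    have h3 : g'' 1 0 * (c * fixForm g v (-u)) = c ^ 2 * fixForm g' u v := by
      rw [← e]; linear_combination c * hprop v (-u)
    have h4 : g'' 1 0 * (c * fixForm g v' (-u')) = c ^ 2 * fixForm g' u' v' := by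
      rw [← e]; linear_combination c * hprop v' (-u')
    have hc2 : 0 < c ^ 2 := by positivity
    have h5 : 0 < g'' 1 0 * (c * fixForm g v (-u)) := by rw [h3]; positivity
    have h6 : g'' 1 0 * (c * fixForm g v' (-u')) < 0 := by
      rw [h4]; exact mul_neg_of_pos_of_neg hc2 hneg'
    have h7 : 0 < g'' 1 0 := pos_of_mul_pos_left h5 h1
    have := mul_nonneg h7.le h2
    linarith

/-- If the fixed form of a matrix fixing `w` has the same sign at `r` and `s`, then `J r s` is
regular at `w`. -/
theorem reg_of_same_sign (hR : RegSystem R) {w : ℂ_[p]} (hw : w ∈ Hp p)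
    {g : Matrix.SpecialLinearGroup (Fin 2) ℤ} (hg : mob (toQ g) w = w) {x y x' y' : ℤ}
    (hc : IsCoprime x y) (hc' : IsCoprime x' y') (hs : 0 < fixForm g x y * fixForm g x' y') :
    R (pt x y) (pt x' y') w := by
  obtain ⟨σ, hσ, hσx, hσx'⟩ : ∃ σ : ℤ, (σ = 1 ∨ σ = -1) ∧ 0 < σ * fixForm g x y ∧
      0 < σ * fixForm g x' y' := by
    rcases pos_and_pos_or_neg_and_neg_of_mul_pos hs with h | h
    · exact ⟨1, Or.inl rfl, by linarith, by linarith⟩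
    · exact ⟨-1, Or.inr rfl, by linarith, by linarith⟩
  refine farey_induction (E := fun r s ↦ R r s w) (G := fun x y ↦ 0 < σ * fixForm g x y)
    (hR.refl w hw) (hR.symm w hw) (hR.trans w hw) ?_ ?_ ?_ _ x y x' y' hc hc' hσx hσx' rfl
  · intro x y h
    have : fixForm g (-x) (-y) = fixForm g x y := by simp only [fixForm]; ring
    rwa [this]
  · intro x y x' y' h h'
    -- The polar form of the two vectors: if it is nonnegative the form keeps its sign on the cone
    -- spanned by v and v', otherwise on the one spanned by v and -v'.
    set β := σ * (2 * g 1 0 * x * x' + (g 1 1 - g 0 0) * (x * y' + x' * y) - 2 * g 0 1 * y * y')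
    rcases le_total 0 β with hβ | hβ
    · left
      intro i j N a b hi hj hN ha hb
      have e : N ^ 2 * (σ * fixForm g a b) =
          i ^ 2 * (σ * fixForm g x y) + i * j * β + j ^ 2 * (σ * fixForm g x' y') := by
        have : N ^ 2 * (σ * fixForm g a b) = σ * fixForm g (N * a) (N * b) := by
          simp only [fixForm]; ring
        rw [this, ha, hb]
        simp only [fixForm, β]; ring
      have h1 : 0 < N ^ 2 * (σ * fixForm g a b) := by rw [e]; positivity
      exact pos_of_mul_pos_right h1 (by positivity)
    · right
      intro i j N a b hi hj hN ha hb
      have e : N ^ 2 * (σ * fixForm g a b) =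
          i ^ 2 * (σ * fixForm g x y) + i * j * (-β) + j ^ 2 * (σ * fixForm g x' y') := by
        have : N ^ 2 * (σ * fixForm g a b) = σ * fixForm g (N * a) (N * b) := by
          simp only [fixForm]; ring
        rw [this, ha, hb]
        simp only [fixForm, β]; ring
      have hβ' : 0 ≤ -β := by linarith
      have h1 : 0 < N ^ 2 * (σ * fixForm g a b) := by rw [e]; positivity
      exact pos_of_mul_pos_right h1 (by positivity)
  · intro x y x' y' hd h h'
    by_contra hn
    -- the matrix with columns `(x', y')` and `(x, y)` up to sign
    set M : Matrix.SpecialLinearGroup (Fin 2) ℤ := mk2 (-x') x (-y') y (by linarith) with hM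
    have hMM : mob (toQ M) (mob (toQ M⁻¹) w) = w := by
      rw [← mob_mul _ _ (aut_ne_zero_of_mem_Hp _ hw), ← map_mul, mul_inv_cancel, map_one, mob_one]
    have hw1 := mob_mem_Hp (toQ M⁻¹) hw
    have hn' : ¬ R (pt 0 1) (pt 1 0) (mob (toQ M⁻¹) w) := by
      rw [hR.transport M hw1, hMM]
      simpa [hM, pt_neg] using hn
    obtain ⟨g₁, hg₁, -, hg₁c⟩ := hR.exists_fix hw1 hn'
    have hfix := mob_conj_fix hw1 hMM.symm hg₁
    have hprop := fixForm_proportional hw hg hfix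
    have e1 := fixForm_conj M g₁ 1 0
    have e2 := fixForm_conj M g₁ 0 1
    simp [hM] at e1 e2
    rw [← hM] at e1 e2
    set g₂ := M * g₁ * M⁻¹
    have e1' : fixForm g₂ x' y' = g₁ 1 0 := by
      have : fixForm g₂ (-x') (-y') = fixForm g₂ x' y' := by simp only [fixForm]; ring
      rw [← this, e1]; simp [fixForm]
    have e2' : fixForm g₂ x y = -g₁ 0 1 := by rw [e2]; simp [fixForm]
    have h1 := hprop x y
    have h2 := hprop x' y'
    rw [e2'] at h1
    rw [e1'] at h2
    have hpos : 0 < (σ * fixForm g x y) * (σ * fixForm g x' y') := mul_pos h h'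
    -- If this unimodular step were singular, `exists_fix` after transport by `M` would give a fixed
    -- form of `w` with opposite signs at its ends. All fixed forms of `w` are proportional, so this
    -- contradicts the equal signs of that of `g`.
    have h3 : (g₂ 1 0) ^ 2 * ((σ * fixForm g x y) * (σ * fixForm g x' y')) =
        -(σ * g 1 0) ^ 2 * (g₁ 1 0 * g₁ 0 1) := by
      linear_combination σ ^ 2 * (g₂ 1 0 * fixForm g x' y') * h1 -
        σ ^ 2 * (g 1 0 * g₁ 0 1) * h2
    have h4 : 0 ≤ (g₂ 1 0) ^ 2 * ((σ * fixForm g x y) * (σ * fixForm g x' y')) := by positivity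
    have h5 : 0 ≤ (σ * g 1 0) ^ 2 * (g₁ 1 0 * g₁ 0 1) := by positivity
    have h6 : (σ * g 1 0) ^ 2 * (g₁ 1 0 * g₁ 0 1) = 0 := by linarith
    have hg0 : g 1 0 = 0 := by
      rcases mul_eq_zero.1 h6 with h | h
      · have := pow_eq_zero_iff (two_ne_zero) |>.1 h
        rcases mul_eq_zero.1 this with h | h
        · rcases hσ with h' | h' <;> omega
        · exact h
      · omega
    have := linear_eq_zero hw (a := g 1 1 - g 0 0) (b := g 0 1) (by
      have hroot := fixForm_root hw hg
      rw [hg0] at hroot; push_cast; linear_combination hroot)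
    simp [fixForm, hg0, this.1, this.2] at h

/-- If `J 0 ∞` is regular on `affinoid p 1`, then all `J r s` are regular everywhere. -/
theorem reg_of_reg_affinoid_one (hR : RegSystem R)
    (h : ∀ w ∈ affinoid p 1, R (pt 0 1) (pt 1 0) w) {w : ℂ_[p]} (hw : w ∈ Hp p)
    (r s : OnePoint ℚ) : R r s w := by
  obtain ⟨γ, hγ, hmem⟩ := exists_mob_mem_affinoid_one hw
  rw [hR.equiv γ hγ w hw]
  have hw' := mob_mem_Hp γ hw
  obtain ⟨x, y, hc, h1⟩ := exists_pt (actP1 γ r)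
  obtain ⟨x', y', hc', h2⟩ := exists_pt (actP1 γ s)
  rw [← h1, ← h2]
  set w₁ := mob γ w
  -- Here no region is imposed: every unimodular step is a translate of {0, ∞} under `SL₂(ℤ)`, which
  -- preserves the affinoid.
  refine farey_induction (E := fun r s ↦ R r s w₁) (G := fun _ _ ↦ True)
    (hR.refl w₁ hw') (hR.symm w₁ hw') (hR.trans w₁ hw') (by simp) (by simp) ?_ _ x y x' y' hc hc'
    trivial trivial rfl
  intro x y x' y' hd _ _
  set M : Matrix.SpecialLinearGroup (Fin 2) ℤ := mk2 (-x') x (-y') y (by linarith) with hM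
  have hMM : mob (toQ M) (mob (toQ M⁻¹) w₁) = w₁ := by
    rw [← mob_mul _ _ (aut_ne_zero_of_mem_Hp _ hw'), ← map_mul, mul_inv_cancel, map_one, mob_one]
  have h3 := (hR.transport M (mob_mem_Hp (toQ M⁻¹) hw')).1 (h _ (mob_mem_affinoid _ hmem))
  rw [hMM] at h3
  simpa [hM, pt_neg] using h3

end RegSystem

/-! ### Galois conjugates -/

section galConj

variable {L : Type*} [Field L] [Algebra ℚ L]

/-- As `x` is irrational, X² - sX + n is its minimal polynomial. The conjugate is thus recognised by
a rational sum and a rational product, which is how all its functorialities are obtained. -/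
theorem natDegree_galConj_of_sum_of_prod {x y : L} (hx : ∀ q : ℚ, x ≠ algebraMap ℚ L q) {s n : ℚ}
    (hs : x + y = algebraMap ℚ L s) (hn : x * y = algebraMap ℚ L n) :
    (minpoly ℚ x).natDegree = 2 ∧ galConj x = y := by
  set q : ℚ[X] := X ^ 2 - C s * X + C n with hq
  have hqm : q.Monic := by rw [hq]; monicity!
  have hqd : q.natDegree = 2 := by rw [hq]; compute_degree!
  have hq0 : aeval x q = 0 := by
    simp [hq, ← hs, ← hn]; ring
  have hint : IsIntegral ℚ x := ⟨q, hqm, by rwa [← aeval_def]⟩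
  have hdvd := minpoly.dvd ℚ x hq0
  have h2 : 2 ≤ (minpoly ℚ x).natDegree := by
    rw [minpoly.two_le_natDegree_iff hint]
    rintro ⟨r, hr⟩
    exact hx r hr.symm
  have hle : (minpoly ℚ x).natDegree ≤ 2 := hqd ▸ natDegree_le_of_dvd hdvd hqm.ne_zero
  have heq : q = minpoly ℚ x :=
    (eq_of_monic_of_dvd_of_natDegree_le (minpoly.monic hint) hqm hdvd (by omega))
  refine ⟨le_antisymm hle h2, ?_⟩
  have hc : (minpoly ℚ x).coeff 1 = -s := by
    rw [← heq, hq]; simp [coeff_C]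
  rw [galConj, hc, map_neg, neg_neg, ← hs]
  ring

theorem exists_sum_prod_galConj {x : L} (h : (minpoly ℚ x).natDegree = 2) :
    ∃ s n : ℚ, x + galConj x = algebraMap ℚ L s ∧ x * galConj x = algebraMap ℚ L n := by
  have hint : IsIntegral ℚ x := by
    by_contra hn
    rw [minpoly.eq_zero hn] at h; simp at h
  have hm := minpoly.monic hint
  have hev : x ^ 2 + ((minpoly ℚ x).coeff 1 : L) * x + ((minpoly ℚ x).coeff 0 : L) = 0 := by
    have : CharZero L := charZero_of_injective_algebraMap (algebraMap ℚ L).injective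
    have := minpoly.aeval ℚ x
    rw [Polynomial.aeval_eq_sum_range, h] at this
    have h2 : (minpoly ℚ x).coeff 2 = 1 := by rw [← h]; exact hm
    simp [Finset.sum_range_succ, h2, Algebra.smul_def] at this
    linear_combination this
  refine ⟨-(minpoly ℚ x).coeff 1, (minpoly ℚ x).coeff 0, ?_, ?_⟩
  · rw [galConj, map_neg]; ring
  · rw [galConj, eq_ratCast, eq_ratCast]; linear_combination -hev

theorem ne_algebraMap_of_natDegree {x : L} (h : (minpoly ℚ x).natDegree = 2) (q : ℚ) :
    x ≠ algebraMap ℚ L q := by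
  rintro rfl
  rw [minpoly.eq_X_sub_C] at h
  simp at h

theorem galConj_ne {x : L} (h : (minpoly ℚ x).natDegree = 2) : galConj x ≠ x := by
  have : CharZero L := charZero_of_injective_algebraMap (algebraMap ℚ L).injective
  intro he
  obtain ⟨s, n, hs, -⟩ := exists_sum_prod_galConj h
  rw [he] at hs
  refine ne_algebraMap_of_natDegree h (s / 2) ?_
  rw [map_div₀, ← hs]
  simp

theorem galConj_props {x : L} (h : (minpoly ℚ x).natDegree = 2) :
    (minpoly ℚ (galConj x)).natDegree = 2 ∧ galConj (galConj x) = x := by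
  obtain ⟨s, n, hs, hn⟩ := exists_sum_prod_galConj h
  refine natDegree_galConj_of_sum_of_prod (s := s) (n := n) (fun q hq ↦ ?_) (by rw [add_comm, hs])
    (by rw [mul_comm, hn])
  refine ne_algebraMap_of_natDegree h (s - q) ?_
  rw [map_sub, ← hs, ← hq]; ring

theorem map_galConj {L' : Type*} [Field L'] [Algebra ℚ L'] (f : L →ₐ[ℚ] L') {x : L}
    (h : (minpoly ℚ x).natDegree = 2) :
    (minpoly ℚ (f x)).natDegree = 2 ∧ galConj (f x) = f (galConj x) := by
  obtain ⟨s, n, hs, hn⟩ := exists_sum_prod_galConj h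
  refine natDegree_galConj_of_sum_of_prod (s := s) (n := n) (fun q hq ↦ ?_)
    (by rw [← map_add, hs, AlgHom.commutes]) (by rw [← map_mul, hn, AlgHom.commutes])
  refine ne_algebraMap_of_natDegree h q (f.injective ?_)
  exact hq.trans (f.commutes q).symm

theorem galConj_mob (γ : Matrix.SpecialLinearGroup (Fin 2) ℚ) {x : L}
    (h : (minpoly ℚ x).natDegree = 2) :
    (minpoly ℚ (mob γ x)).natDegree = 2 ∧ galConj (mob γ x) = mob γ (galConj x) := by
  have : CharZero L := charZero_of_injective_algebraMap (algebraMap ℚ L).injective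
  obtain ⟨s, n, hs, hn⟩ := exists_sum_prod_galConj h
  have hirr : ∀ q : ℚ, x ≠ q := fun q ↦ by simpa using ne_algebraMap_of_natDegree h q
  have hirr' : ∀ q : ℚ, galConj x ≠ q := fun q ↦ by
    simpa using ne_algebraMap_of_natDegree (galConj_props h).1 q
  have h1 := aut_ne_zero γ hirr
  have h2 := aut_ne_zero γ hirr'
  set y := galConj x
  rw [eq_ratCast] at hs hn
  have hN : aut γ x * aut γ y =
      (((γ 1 0) ^ 2 * n + γ 1 0 * γ 1 1 * s + (γ 1 1) ^ 2 : ℚ) : L) := by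
    push_cast
    rw [← hs, ← hn]
    simp only [aut]
    ring
  have hN0 : aut γ x * aut γ y ≠ 0 := mul_ne_zero h1 h2
  -- The common denominator is the norm (cx + d)(cy + d); the numerators are (ax + b)(cy + d) + (ay
  -- + b)(cx + d) and (ax + b)(ay + b) written through s = x + y and n = xy.
  refine natDegree_galConj_of_sum_of_prod
    (s := (2 * γ 0 0 * γ 1 0 * n + (γ 0 0 * γ 1 1 + γ 0 1 * γ 1 0) * s + 2 * γ 0 1 * γ 1 1) /
      ((γ 1 0) ^ 2 * n + γ 1 0 * γ 1 1 * s + (γ 1 1) ^ 2))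
    (n := ((γ 0 0) ^ 2 * n + γ 0 0 * γ 0 1 * s + (γ 0 1) ^ 2) /
      ((γ 1 0) ^ 2 * n + γ 1 0 * γ 1 1 * s + (γ 1 1) ^ 2))
    (fun q ↦ by simpa using mob_irrational γ hirr q) ?_ ?_
  · rw [eq_ratCast, Rat.cast_div, ← hN]
    unfold mob
    rw [← aut, ← aut, div_add_div _ _ h1 h2]
    congr 1
    push_cast
    rw [← hs, ← hn]
    simp only [aut]
    ring
  · rw [eq_ratCast, Rat.cast_div, ← hN]
    unfold mob
    rw [← aut, ← aut, div_mul_div_comm]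
    congr 1
    push_cast
    rw [← hs, ← hn]
    ring

end galConj

/-! ### Real multiplication points -/

theorem natDegree_of_finrank {τ : ℂ_[p]} (h : Module.finrank ℚ (fieldOf τ) = 2) :
    (minpoly ℚ τ).natDegree = 2 := by
  have : FiniteDimensional ℚ (fieldOf τ) := Module.finite_of_finrank_pos (by omega)
  have hint : IsIntegral ℚ τ := by
    have h1 := Algebra.IsIntegral.isIntegral (R := ℚ) (IntermediateField.AdjoinSimple.gen ℚ τ)
    simpa using h1.map (fieldOf τ).val
  rw [← h, IntermediateField.adjoin.finrank hint]

theorem IsRM.natDegree {τ : ℂ_[p]} (h : IsRM τ) : (minpoly ℚ τ).natDegree = 2 :=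
  natDegree_of_finrank h.2.1

/-- A rational quadratic equation with nonnegative discriminant is solvable in ℝ, which gives the
real embedding. The inequality may be weak because a point of `Hp` is irrational. -/
theorem isRM_iff {τ : ℂ_[p]} : IsRM τ ↔ τ ∈ Hp p ∧ ∃ s n : ℚ, τ ^ 2 - s * τ + n = 0 ∧
    0 ≤ s ^ 2 - 4 * n := by
  constructor
  · intro h
    refine ⟨h.1, ?_⟩
    obtain ⟨ι⟩ := h.2.2
    have hg : (minpoly ℚ (IntermediateField.AdjoinSimple.gen ℚ τ)).natDegree = 2 := by
      have h1 : minpoly ℚ (IntermediateField.AdjoinSimple.gen ℚ τ) = minpoly ℚ τ :=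
        IntermediateField.minpoly_gen ℚ τ
      rw [h1, h.natDegree]
    obtain ⟨s, n, hs, hn⟩ := exists_sum_prod_galConj hg
    refine ⟨s, n, ?_, ?_⟩
    · have hs' := congrArg (algebraMap (fieldOf τ) ℂ_[p]) hs
      have hn' := congrArg (algebraMap (fieldOf τ) ℂ_[p]) hn
      simp at hs' hn'
      rw [← hs', ← hn']
      ring
    · have hs' := congrArg ι hs
      have hn' := congrArg ι hn
      simp at hs' hn'
      have : (0 : ℝ) ≤ s ^ 2 - 4 * n := by
        rw [← hs', ← hn']
        nlinarith [sq_nonneg (ι (IntermediateField.AdjoinSimple.gen ℚ τ) -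
          ι (galConj (IntermediateField.AdjoinSimple.gen ℚ τ)))]
      exact_mod_cast this
  · rintro ⟨hτ, s, n, h, hd⟩
    have hirr : ∀ q : ℚ, τ ≠ algebraMap ℚ ℂ_[p] q := fun q ↦ by simpa using Hp.ne_ratCast hτ q
    obtain ⟨h2, h3⟩ := natDegree_galConj_of_sum_of_prod (y := s - τ) hirr (s := s) (n := n)
      (by simp) (by simp; linear_combination -h)
    have hint : IsIntegral ℚ τ := by
      by_contra hn
      rw [minpoly.eq_zero hn] at h2; simp at h2
    refine ⟨hτ, by rw [IntermediateField.adjoin.finrank hint, h2], ?_⟩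
    have hm : minpoly ℚ τ = X ^ 2 - C s * X + C n := by
      symm
      refine eq_of_monic_of_dvd_of_natDegree_le (minpoly.monic hint) (by monicity!)
        (minpoly.dvd _ _ (by simpa using h)) ?_
      rw [h2]; compute_degree!
    set D : ℝ := s ^ 2 - 4 * n
    have hD : 0 ≤ D := by simp only [D]; exact_mod_cast hd
    refine ⟨(IntermediateField.algHomAdjoinIntegralEquiv ℚ (K := ℝ) hint).symm
      ⟨(s + √D) / 2, ?_⟩⟩
    rw [mem_aroots]
    refine ⟨minpoly.ne_zero hint, ?_⟩
    rw [hm]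
    have := Real.sq_sqrt hD
    simp
    have h4 : √D ^ 2 = s ^ 2 - 4 * n := this
    linear_combination h4 / 4

theorem galConj_mem_Hp {τ : ℂ_[p]} (hτ : τ ∈ Hp p) : galConj τ ∈ Hp p := by
  rintro ⟨a, ha⟩
  refine hτ ⟨-((minpoly ℚ τ).coeff 1 : ℚ_[p]) - a, ?_⟩
  rw [map_sub, ha, galConj]
  simp

theorem IsRM.galConj {τ : ℂ_[p]} (h : IsRM τ) : IsRM (galConj τ) := by
  obtain ⟨h1, s, n, h2, h3⟩ := isRM_iff.1 h
  have hirr : ∀ q : ℚ, τ ≠ algebraMap ℚ ℂ_[p] q := fun q ↦ by simpa using Hp.ne_ratCast h1 q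
  obtain ⟨-, h4⟩ := natDegree_galConj_of_sum_of_prod (y := s - τ) hirr (s := s) (n := n)
      (by simp) (by simp; linear_combination -h2)
  refine isRM_iff.2 ⟨galConj_mem_Hp h1, s, n, ?_, h3⟩
  rw [h4]
  linear_combination h2

theorem isRM_of_fix {w : ℂ_[p]} (hw : w ∈ Hp p) {g : Matrix.SpecialLinearGroup (Fin 2) ℤ}
    (hg : mob (toQ g) w = w) (hpos : 0 < g 1 0 * g 0 1) : IsRM w := by
  have hroot := fixForm_root hw hg
  have hc : g 1 0 ≠ 0 := by rintro h; simp [h] at hpos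
  have hcC : (g 1 0 : ℂ_[p]) ≠ 0 := by exact_mod_cast hc
  have hcQ : (g 1 0 : ℚ) ≠ 0 := by exact_mod_cast hc
  refine isRM_iff.2 ⟨hw, (g 0 0 - g 1 1) / g 1 0, -(g 0 1) / g 1 0, ?_, ?_⟩
  · push_cast
    field_simp
    linear_combination hroot
  · have h2 : (0 : ℚ) < g 1 0 * g 0 1 := by exact_mod_cast hpos
    have : ((g 0 0 - g 1 1 : ℚ) / g 1 0) ^ 2 - 4 * (-(g 0 1) / g 1 0) =
        ((g 0 0 - g 1 1 : ℚ) ^ 2 + 4 * (g 1 0 * g 0 1)) / (g 1 0) ^ 2 := by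
      field_simp
      ring
    rw [this]
    positivity

/-! ### Orientations -/

/-- The sign of `(x - a y) (x - b y) (a - b)` at `(x : y)`. -/
def orient (a b : ℝ) (r : OnePoint ℚ) : ℤ :=
  r.elim (SignType.sign (a - b) : ℤ) fun q ↦ (SignType.sign ((q - a) * (q - b) * (a - b)) : ℤ)

theorem sign_mul_sq (x : ℝ) {y : ℝ} (hy : y ≠ 0) : SignType.sign (x * y ^ 2) = SignType.sign x := by
  rw [sign_mul, sign_pos (by positivity : 0 < y ^ 2), mul_one]

theorem orient_infty (a b : ℝ) : orient a b OnePoint.infty = SignType.sign (a - b) := rfl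

theorem orient_coe (a b : ℝ) (q : ℚ) :
    orient a b (q : OnePoint ℚ) = SignType.sign ((q - a) * (q - b) * (a - b)) := rfl

/-- By `mob_sub_mob`, each difference of images is the old difference divided by automorphy factors,
and in the product of the three differences those factors occur to even powers. -/
theorem orient_mob (γ : Matrix.SpecialLinearGroup (Fin 2) ℚ) {a b : ℝ} (ha : ∀ q : ℚ, a ≠ q)
    (hb : ∀ q : ℚ, b ≠ q) (r : OnePoint ℚ) :
    orient (mob γ a) (mob γ b) (actP1 γ r) = orient a b r := by
  have ha0 := aut_ne_zero γ ha
  have hb0 := aut_ne_zero γ hb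
  have hab := mob_sub_mob γ ha0 hb0
  have hd := det_cast (L := ℝ) γ
  induction r using OnePoint.rec with
  | infty =>
    rw [actP1_infty]
    split_ifs with hc
    · have hda : aut γ a = γ 1 1 := by simp [aut, hc]
      have hdb : aut γ b = γ 1 1 := by simp [aut, hc]
      rw [hda] at ha0
      rw [orient_infty, orient_infty, hab, hda, hdb]
      congr 1
      have : (a - b) / ((γ 1 1 : ℝ) * γ 1 1) = (a - b) * ((γ 1 1 : ℝ)⁻¹) ^ 2 := by
        field_simp
      rw [this, sign_mul_sq _ (inv_ne_zero ha0)]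
    · have hc' : (γ 1 0 : ℝ) ≠ 0 := by exact_mod_cast hc
      rw [orient_infty, orient_coe, hab]
      congr 1
      have e : ∀ x : ℝ, aut γ x ≠ 0 → ((γ 0 0 / γ 1 0 : ℚ) : ℝ) - mob γ x =
          1 / (γ 1 0 * aut γ x) := by
        intro x hx
        unfold mob
        rw [← aut]
        push_cast
        rw [div_sub_div _ _ hc' hx]
        congr 1
        simp only [aut]
        linear_combination hd
      rw [e a ha0, e b hb0]
      have : 1 / ((γ 1 0 : ℝ) * aut γ a) * (1 / (γ 1 0 * aut γ b)) *
          ((a - b) / (aut γ a * aut γ b)) =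
          (a - b) * (((γ 1 0 : ℝ) * aut γ a * aut γ b)⁻¹) ^ 2 := by
        field_simp
      rw [this, sign_mul_sq _ (inv_ne_zero (by positivity))]
  | coe q =>
    have hq : aut γ (q : ℝ) = ((γ 1 0 * q + γ 1 1 : ℚ) : ℝ) := by simp [aut]
    rw [actP1_coe]
    split_ifs with hc
    · rw [orient_infty, orient_coe, hab]
      congr 1
      have hc1 : (γ 1 0 : ℝ) * q + γ 1 1 = 0 := by exact_mod_cast congrArg (Rat.cast : ℚ → ℝ) hc
      have e : ∀ x : ℝ, aut γ x = -(γ 1 0 * (q - x)) := by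
        intro x; simp only [aut]; linear_combination hc1
      have hc' : (γ 1 0 : ℝ) ≠ 0 := by
        intro h
        rw [e, h] at ha0
        simp at ha0
      have hqa : (q : ℝ) - a ≠ 0 := sub_ne_zero.2 (ha q).symm
      have hqb : (q : ℝ) - b ≠ 0 := sub_ne_zero.2 (hb q).symm
      rw [e, e]
      have : (a - b) / (-(γ 1 0 * (q - a)) * -(γ 1 0 * (q - b))) =
          (q - a) * (q - b) * (a - b) * (((γ 1 0 : ℝ) * (q - a) * (q - b))⁻¹) ^ 2 := by
        field_simp
      rw [this, sign_mul_sq _ (inv_ne_zero (by positivity))]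
    · have hq0 : aut γ (q : ℝ) ≠ 0 := by rw [hq]; exact_mod_cast hc
      have hm : (((γ 0 0 * q + γ 0 1) / (γ 1 0 * q + γ 1 1) : ℚ) : ℝ) = mob γ (q : ℝ) := by
        simp [mob]
      rw [orient_coe, orient_coe, hm, mob_sub_mob γ hq0 ha0, mob_sub_mob γ hq0 hb0, hab]
      congr 1
      have : (q - a) / (aut γ (q : ℝ) * aut γ a) * ((q - b) / (aut γ (q : ℝ) * aut γ b)) *
          ((a - b) / (aut γ a * aut γ b)) =
          (q - a) * (q - b) * (a - b) * ((aut γ (q : ℝ) * aut γ a * aut γ b)⁻¹) ^ 2 := by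
        field_simp
      rw [this, sign_mul_sq _ (inv_ne_zero (by positivity))]

theorem orient_swap (a b : ℝ) (r : OnePoint ℚ) : orient b a r = -orient a b r := by
  induction r using OnePoint.rec with
  | infty => rw [orient_infty, orient_infty, ← neg_sub, Left.sign_neg]; simp
  | coe q =>
    rw [orient_coe, orient_coe, ← neg_sub a b, mul_neg, Left.sign_neg, mul_comm ((q : ℝ) - b)]
    simp

theorem orient_pt {a b : ℝ} (x y : ℤ) (h : IsCoprime x y) :
    orient a b (pt x y) = SignType.sign ((x - a * y) * (x - b * y) * (a - b)) := by
  unfold pt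
  split_ifs with hy
  · subst hy
    have hx : (x : ℝ) ≠ 0 := by
      intro h0
      have : x = 0 := by exact_mod_cast h0
      subst this
      exact not_isCoprime_zero_zero h
    rw [orient_infty]
    congr 1
    rw [← sign_mul_sq (a - b) hx]
    congr 1
    push_cast
    ring
  · have hy' : (y : ℝ) ≠ 0 := by exact_mod_cast hy
    rw [orient_coe]
    congr 1
    rw [← sign_mul_sq _ hy']
    congr 1
    push_cast
    field_simp

/-- The orientation changes between 0 and ∞ exactly when `a` and `b` have opposite signs, and then
it jumps by 2. This writes the crossing number as a coboundary, whence additivity in {r, s} for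
arbitrary ends. -/
theorem two_mul_crossing {a b : ℝ} (ha : a ≠ 0) (hb : b ≠ 0) :
    2 * crossing a b = orient a b ((0 : ℚ) : OnePoint ℚ) - orient a b OnePoint.infty := by
  rw [orient_coe, orient_infty]
  have e : (((0 : ℚ) : ℝ) - a) * (((0 : ℚ) : ℝ) - b) * (a - b) = a * b * (a - b) := by
    push_cast; ring
  rw [e]
  unfold crossing
  rcases lt_or_gt_of_ne ha with ha | ha <;> rcases lt_or_gt_of_ne hb with hb | hb
  · rw [if_neg (by rintro ⟨_, h⟩; linarith), if_neg (by rintro ⟨_, h⟩; linarith), sign_mul,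
      sign_pos (mul_pos_of_neg_of_neg ha hb)]
    simp
  · rw [if_pos ⟨ha, hb⟩, sign_neg (by linarith : a - b < 0),
      sign_pos (mul_pos_of_neg_of_neg (mul_neg_of_neg_of_pos ha hb) (by linarith))]
    rfl
  · rw [if_neg (by rintro ⟨h, _⟩; linarith), if_pos ⟨hb, ha⟩, sign_pos (by linarith : 0 < a - b),
      sign_neg (mul_neg_of_neg_of_pos (mul_neg_of_pos_of_neg ha hb) (by linarith))]
    rfl
  · rw [if_neg (by rintro ⟨h, _⟩; linarith), if_neg (by rintro ⟨h, _⟩; linarith), sign_mul,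
      sign_pos (mul_pos ha hb)]
    simp

/-! ### Primitive forms -/

theorem quad_galConj {L : Type*} [Field L] [Algebra ℚ L] {x : L}
    (h : (minpoly ℚ x).natDegree = 2) {Q : QForm} (hA : Q.A ≠ 0) (hQ : Q.eval x = 0) :
    (Q.A : L) * (x + galConj x) = -Q.B ∧ (Q.A : L) * (x * galConj x) = Q.C := by
  have : CharZero L := charZero_of_injective_algebraMap (algebraMap ℚ L).injective
  have hA' : (Q.A : L) ≠ 0 := by exact_mod_cast hA
  unfold QForm.eval at hQ
  have := (natDegree_galConj_of_sum_of_prod (y := -(Q.B : L) / Q.A - x)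
    (ne_algebraMap_of_natDegree h) (s := -Q.B / Q.A) (n := Q.C / Q.A) (by simp)
    (by simp; field_simp; linear_combination -hQ)).2
  rw [this]
  constructor
  · field_simp; ring
  · field_simp; linear_combination -hQ

theorem QForm.Primitive.exists_bezout {Q : QForm} (h : Q.Primitive) :
    ∃ u v w : ℤ, u * Q.A + v * Q.B + w * Q.C = 1 := by
  have h1 := Int.gcd_eq_gcd_ab (Int.gcd Q.A Q.B) Q.C
  have h2 := Int.gcd_eq_gcd_ab Q.A Q.B
  unfold QForm.Primitive at h
  rw [h, h2] at h1
  refine ⟨Int.gcdA Q.A Q.B * Int.gcdA (Int.gcd Q.A Q.B) Q.C,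
    Int.gcdB Q.A Q.B * Int.gcdA (Int.gcd Q.A Q.B) Q.C, Int.gcdB (Int.gcd Q.A Q.B) Q.C, ?_⟩
  rw [h2]
  push_cast at h1
  linear_combination -h1

theorem mul_norm_p_pow_mul (m : ℕ) (x : ℤ) :
    (((p : ℤ) ^ m * x : ℤ) : ℝ) * ‖(((p : ℤ) ^ m * x : ℤ) : ℚ_[p])‖ = (x : ℝ) * ‖(x : ℚ_[p])‖ := by
  have := p_pos (p := p)
  push_cast
  rw [norm_mul, norm_pow, Padic.norm_p]
  have h2 : (p : ℝ) ^ m * ((p : ℝ)⁻¹) ^ m = 1 := by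
    rw [← mul_pow, mul_inv_cancel₀ this.ne', one_pow]
  linear_combination ((x : ℝ) * ‖(x : ℚ_[p])‖) * h2

/-- The product of the archimedean and the `p`-adic absolute values of the discriminant is
constant on the orbits of the Ihara group. -/
theorem disc_mul_norm_eq {w : ℂ_[p]} (hw : w ∈ Hp p)
    {γ : Matrix.SpecialLinearGroup (Fin 2) ℚ} (hγ : γ ∈ ihara p) {Q Q' : QForm}
    (hQ : Q.Primitive) (hQ' : Q'.Primitive) (hA : Q.A ≠ 0) (h : Q.eval w = 0)
    (h' : Q'.eval (mob γ w) = 0) :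
    (Q'.disc : ℝ) * ‖(Q'.disc : ℚ_[p])‖ = (Q.disc : ℝ) * ‖(Q.disc : ℚ_[p])‖ := by
  obtain ⟨m, M, hM⟩ := exists_int_matrix hγ
  set a := M 0 0 with ha
  set b := M 0 1 with hb
  set c := M 1 0 with hc
  set d := M 1 1 with hd
  have hpQ : (p : ℚ) ≠ 0 := by exact_mod_cast (Fact.out : p.Prime).ne_zero
  have hpC : (p : ℂ_[p]) ≠ 0 := by exact_mod_cast (Fact.out : p.Prime).ne_zero
  have hN : a * d - b * c = (p : ℤ) ^ (2 * m) := by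
    have h1 : (a * d - b * c : ℚ) = (p : ℚ) ^ (2 * m) := by
      rw [ha, hb, hc, hd, ← hM, ← hM, ← hM, ← hM]
      have := det_cast (L := ℚ) γ
      simp only [Rat.cast_id] at this
      linear_combination (p : ℚ) ^ (2 * m) * this
    exact_mod_cast h1
  have hMC : ∀ i j, (γ i j : ℂ_[p]) = M i j / (p : ℂ_[p]) ^ m := by
    intro i j
    rw [eq_div_iff (pow_ne_zero _ hpC), mul_comm]
    exact_mod_cast congrArg (Rat.cast : ℚ → ℂ_[p]) (hM i j)
  -- The pullback of `Q'` under the integral matrix p^m γ. It vanishes at `w`, so it is an integral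
  -- multiple g·Q of the primitive form `Q`.
  set A₂ : ℤ := Q'.A * a ^ 2 + Q'.B * a * c + Q'.C * c ^ 2 with hA₂
  set B₂ : ℤ := 2 * Q'.A * a * b + Q'.B * (a * d + b * c) + 2 * Q'.C * c * d with hB₂
  set C₂ : ℤ := Q'.A * b ^ 2 + Q'.B * b * d + Q'.C * d ^ 2 with hC₂
  have hG : (A₂ : ℂ_[p]) * w ^ 2 + B₂ * w + C₂ = 0 := by
    have hj := aut_ne_zero_of_mem_Hp γ hw
    have hm : mob γ w = ((a : ℂ_[p]) * w + b) / (c * w + d) := by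
      unfold mob
      rw [hMC, hMC, hMC, hMC]
      rw [div_mul_eq_mul_div, div_mul_eq_mul_div, ← add_div, ← add_div,
        div_div_div_cancel_right₀ (pow_ne_zero _ hpC)]
    have hj' : (c : ℂ_[p]) * w + d ≠ 0 := by
      intro h0
      apply hj
      unfold aut
      rw [hMC, hMC, div_mul_eq_mul_div, ← add_div, h0, zero_div]
    have hX : mob γ w * ((c : ℂ_[p]) * w + d) = a * w + b := by
      rw [hm, div_mul_cancel₀ _ hj']
    unfold QForm.eval at h'
    simp only [hA₂, hB₂, hC₂]
    push_cast
    linear_combination ((c : ℂ_[p]) * w + d) ^ 2 * h' -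
      (Q'.A * (mob γ w * ((c : ℂ_[p]) * w + d) + (a * w + b)) + Q'.B * (c * w + d)) * hX
  have hprop := quad_proportional hw h hG
  obtain ⟨u, v, t, huvt⟩ := hQ.exists_bezout
  obtain ⟨u', v', t', huvt'⟩ := hQ'.exists_bezout
  set g := u * A₂ + v * B₂ + t * C₂ with hg
  have hgA : A₂ = g * Q.A := by
    simp only [hg]
    linear_combination -A₂ * huvt + v * hprop.1 + t * hprop.2
  have hgB : B₂ = g * Q.B := mul_left_cancel₀ hA (by
    linear_combination -hprop.1 + Q.B * hgA)
  have hgC : C₂ = g * Q.C := mul_left_cancel₀ hA (by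
    linear_combination -hprop.2 + Q.C * hgA)
  have hdisc : (p : ℤ) ^ (4 * m) * Q'.disc = g ^ 2 * Q.disc := by
    have h1 : (a * d - b * c) ^ 2 * Q'.disc = B₂ ^ 2 - 4 * A₂ * C₂ := by
      simp only [hA₂, hB₂, hC₂, QForm.disc]; ring
    have h2 : (p : ℤ) ^ (4 * m) = (a * d - b * c) ^ 2 := by rw [hN]; ring
    rw [h2, h1, hgA, hgB, hgC, QForm.disc]
    ring
  -- Applying the adjugate matrix to g·Q returns Q' times the squared determinant, and `Q'` is
  -- primitive. Hence `g` is ± a power of `p`, and the two discriminants differ by a power of `p`,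
  -- which the product of absolute values ignores.
  have hdvd : g ∣ (p : ℤ) ^ (4 * m) := by
    have h2 : (p : ℤ) ^ (4 * m) = (a * d - b * c) ^ 2 := by rw [hN]; ring
    rw [h2]
    have hAN : Q'.A * (a * d - b * c) ^ 2 = A₂ * d ^ 2 - B₂ * d * c + C₂ * c ^ 2 := by
      simp only [hA₂, hB₂, hC₂]; ring
    have hCN : Q'.C * (a * d - b * c) ^ 2 = A₂ * b ^ 2 - B₂ * a * b + C₂ * a ^ 2 := by
      simp only [hA₂, hB₂, hC₂]; ring
    have hBN : Q'.B * (a * d - b * c) ^ 2 =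
        -2 * A₂ * b * d + B₂ * (a * d + b * c) - 2 * C₂ * a * c := by
      simp only [hA₂, hB₂, hC₂]; ring
    rw [hgA, hgB, hgC] at hAN hCN hBN
    refine ⟨u' * (Q.A * d ^ 2 - Q.B * d * c + Q.C * c ^ 2) +
      v' * (-2 * Q.A * b * d + Q.B * (a * d + b * c) - 2 * Q.C * a * c) +
      t' * (Q.A * b ^ 2 - Q.B * a * b + Q.C * a ^ 2), ?_⟩
    linear_combination -(a * d - b * c) ^ 2 * huvt' + u' * hAN + v' * hBN + t' * hCN
  obtain ⟨i, -, hi⟩ : ∃ i ≤ 4 * m, g.natAbs = p ^ i := by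
    rw [← Nat.dvd_prime_pow (Fact.out : p.Prime)]
    have := Int.natAbs_dvd_natAbs.2 hdvd
    simpa [Int.natAbs_pow] using this
  have hg2 : g ^ 2 = (p : ℤ) ^ (2 * i) := by
    rw [← Int.natAbs_sq, hi]; push_cast; ring
  rw [← mul_norm_p_pow_mul (4 * m) Q'.disc, hdisc, hg2, mul_norm_p_pow_mul]

/-! ### Decay of the terms, and finiteness of forms of bounded discriminant. -/

/-- The function `1 / (z - x) - 1 / (z - y)`, with value zero at the poles. -/
def hker (x y z : ℂ_[p]) : ℂ_[p] := (x - y) / ((z - x) * (z - y))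

theorem norm_four_pos : 0 < ‖(4 : ℂ_[p])‖ := norm_pos_iff.2 (by norm_num)

/-- The square of the kernel is disc / Q(z)². Completing the square, 4A·Q(z) = (2Az + B)² - disc,
and `z` is far from ℚ_p, so for small |disc| the square dominates and bounds |Q(z)| from below. -/
theorem norm_hker_sq_le {n : ℕ} {z : ℂ_[p]} (hz : z ∈ affinoid p n) {x y : ℂ_[p]} {Q : QForm}
    (hQ : Q.Primitive) (hA : Q.A ≠ 0) (h1 : (Q.A : ℂ_[p]) * (x + y) = -Q.B)
    (h2 : (Q.A : ℂ_[p]) * (x * y) = Q.C)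
    (hD : ‖(Q.disc : ℂ_[p])‖ < ‖(4 : ℂ_[p])‖ * ((p : ℝ)⁻¹ ^ n) ^ 2) :
    (z - x) * (z - y) ≠ 0 ∧
      ‖hker x y z‖ ^ 2 ≤ ‖(Q.disc : ℂ_[p])‖ * (((p : ℝ)⁻¹ ^ n) ^ 2)⁻¹ ^ 2 := by
  have hA' : (Q.A : ℂ_[p]) ≠ 0 := by exact_mod_cast hA
  have hpn := inv_p_pow_pos (p := p) n
  have hpn1 := inv_p_pow_le_one (p := p) n
  have h4 := norm_four_pos (p := p)
  have h41 : ‖(4 : ℂ_[p])‖ ≤ 1 := by exact_mod_cast norm_intCast_le_one (p := p) 4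
  have hD1 : ‖(Q.disc : ℂ_[p])‖ < 1 := hD.trans_le (mul_le_one₀ h41 (by positivity)
    (pow_le_one₀ hpn.le hpn1))
  have hdisc : (Q.disc : ℂ_[p]) = (Q.B : ℂ_[p]) ^ 2 - 4 * Q.A * Q.C := by
    simp [QForm.disc]
  have hdxy : (Q.disc : ℂ_[p]) = ((Q.A : ℂ_[p]) * (x - y)) ^ 2 := by
    rw [hdisc, ← h2]
    linear_combination ((Q.B : ℂ_[p]) - Q.A * (x + y)) * h1
  set q : ℂ_[p] := Q.A * ((z - x) * (z - y)) with hq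
  have hq' : q = Q.A * z ^ 2 + Q.B * z + Q.C := by
    rw [hq, ← h2]
    linear_combination -z * h1
  -- If `p` divided `A`, `C` and the discriminant, it would divide `B` too, contradicting
  -- primitivity.
  have hmax : ‖(Q.A : ℂ_[p])‖ = 1 ∨ ‖(Q.C : ℂ_[p])‖ = 1 := by
    by_contra hcon
    push Not at hcon
    have hlt : ∀ n : ℤ, ‖(n : ℂ_[p])‖ ≠ 1 → (p : ℤ) ∣ n := by
      intro n hn
      rw [norm_intCast_eq] at hn
      exact (Padic.norm_intCast_lt_one_iff).1 (lt_of_le_of_ne (Padic.norm_int_le_one n) hn)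
    have hpA := hlt _ hcon.1
    have hpC := hlt _ hcon.2
    have hpD := hlt _ hD1.ne
    have hpB : (p : ℤ) ∣ Q.B := by
      have : (p : ℤ) ∣ Q.B ^ 2 := by
        have e : Q.B ^ 2 = Q.disc + Q.A * (4 * Q.C) := by simp only [QForm.disc]; ring
        rw [e]
        exact dvd_add hpD (hpA.mul_right _)
      exact (Nat.prime_iff_prime_int.1 (Fact.out : p.Prime)).dvd_of_dvd_pow this
    obtain ⟨u, v, t, h⟩ := hQ.exists_bezout
    have : (p : ℤ) ∣ 1 := by
      rw [← h]
      exact dvd_add (dvd_add (hpA.mul_left _) (hpB.mul_left _)) (hpC.mul_left _)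
    have := Int.le_of_dvd one_pos this
    have := (Fact.out : p.Prime).one_lt
    omega
  have hle1 : 1 ≤ max 1 ‖z‖ := le_max_left _ _
  have hlez : ‖z‖ ≤ max 1 ‖z‖ := le_max_right _ _
  have h2n : ‖(2 : ℂ_[p])‖ ^ 2 = ‖(4 : ℂ_[p])‖ := by
    rw [← norm_pow]; norm_num
  -- Used with U = A, V = 2Az + B, E = 1 or with U = C, V = Bz + 2C, E = z², according to which
  -- outer coefficient is a unit.
  have key : ∀ U V E : ℂ_[p], 4 * U * q = V ^ 2 - Q.disc * E → ‖U‖ = 1 →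
      ‖E‖ ≤ max 1 ‖z‖ ^ 2 → (p : ℝ)⁻¹ ^ n * max 1 ‖z‖ * ‖(2 : ℂ_[p])‖ ≤ ‖V‖ → ((p : ℝ)⁻¹ ^ n) ^ 2 ≤ ‖q‖ := by
    intro U V E hUV hU hE hV
    have hV2 : ‖(4 : ℂ_[p])‖ * ((p : ℝ)⁻¹ ^ n) ^ 2 * max 1 ‖z‖ ^ 2 ≤ ‖V ^ 2‖ := by
      rw [norm_pow]
      calc _ = ((p : ℝ)⁻¹ ^ n * max 1 ‖z‖ * ‖(2 : ℂ_[p])‖) ^ 2 := by rw [← h2n]; ring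
        _ ≤ _ := by gcongr
    have hlt : ‖(Q.disc : ℂ_[p]) * E‖ < ‖V ^ 2‖ := by
      refine lt_of_lt_of_le ?_ hV2
      rw [norm_mul]
      calc _ ≤ ‖(Q.disc : ℂ_[p])‖ * max 1 ‖z‖ ^ 2 := by gcongr
        _ < _ := by gcongr
    have hnorm : ‖4 * U * q‖ = ‖V ^ 2‖ := by
      rw [hUV, sub_eq_add_neg, IsUltrametricDist.norm_add_eq_max_of_norm_ne_norm (by
        rw [norm_neg]; exact hlt.ne'), norm_neg, max_eq_left hlt.le]
    rw [norm_mul, norm_mul, hU, mul_one] at hnorm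
    refine le_of_mul_le_mul_left ?_ h4
    rw [hnorm]
    refine le_trans ?_ hV2
    exact le_mul_of_one_le_right (by positivity) (one_le_pow₀ hle1)
  have hqn : ((p : ℝ)⁻¹ ^ n) ^ 2 ≤ ‖q‖ := by
    by_cases hA1 : ‖(Q.A : ℂ_[p])‖ = 1
    · refine key Q.A (2 * Q.A * z + Q.B) 1 ?_ hA1 (by rw [norm_one]; exact one_le_pow₀ hle1) ?_
      · rw [hdisc, hq']; ring
      · have := le_norm_of_mem_affinoid hz (-(Q.B : ℚ_[p])) (2 * (Q.A : ℚ_[p]))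
        simp only [map_mul, map_neg, map_ofNat, map_intCast, sub_neg_eq_add] at this
        refine le_trans ?_ this
        gcongr
        refine le_trans (le_of_eq ?_) (le_max_right _ _)
        rw [norm_mul, ← norm_intCast_eq, hA1, mul_one]
        exact_mod_cast norm_natCast_eq (p := p) 2
    · have hC1 := hmax.resolve_left hA1
      refine key Q.C (Q.B * z + 2 * Q.C) (z ^ 2) ?_ hC1 (by rw [norm_pow]; gcongr) ?_
      · rw [hdisc, hq']; ring
      · have := le_norm_of_mem_affinoid hz (-(2 * (Q.C : ℚ_[p]))) (Q.B : ℚ_[p])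
        simp only [map_mul, map_neg, map_ofNat, map_intCast, sub_neg_eq_add] at this
        refine le_trans ?_ this
        gcongr
        refine le_trans (le_of_eq ?_) (le_max_left _ _)
        rw [norm_neg, norm_mul, ← norm_intCast_eq, hC1, mul_one]
        exact_mod_cast norm_natCast_eq (p := p) 2
  have hqpos : 0 < ‖q‖ := lt_of_lt_of_le (by positivity) hqn
  have hq0 : q ≠ 0 := norm_pos_iff.1 hqpos
  have hzz : (z - x) * (z - y) ≠ 0 := fun h ↦ hq0 (by rw [hq, h, mul_zero])
  refine ⟨hzz, ?_⟩
  have hh : hker x y z ^ 2 = Q.disc / q ^ 2 := by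
    rw [hdxy, hker, hq]
    field_simp
  rw [← norm_pow, hh, norm_div, norm_pow, div_eq_mul_inv, ← inv_pow]
  gcongr

/-- There are only finitely many forms of bounded discriminant that take values of opposite signs
at two given points. -/
theorem finite_forms (x y x' y' : ℤ) (hN : x * y' - y * x' ≠ 0) (K : ℤ) :
    {Q : QForm | (Q.A * x ^ 2 + Q.B * x * y + Q.C * y ^ 2) *
      (Q.A * x' ^ 2 + Q.B * x' * y' + Q.C * y' ^ 2) < 0 ∧ Q.disc ≤ K}.Finite := by
  set N := x * y' - y * x' with hNdef
  set T := |N ^ 2 * K| with hT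
  -- The coefficients of `Q` in the basis formed by the two vectors. The discriminant becomes
  -- N²·disc = β² - 4αδ with αδ < 0, so bounding it bounds all three.
  let F : QForm → ℤ × ℤ × ℤ := fun Q ↦
    (Q.A * x ^ 2 + Q.B * x * y + Q.C * y ^ 2,
      2 * Q.A * x * x' + Q.B * (x * y' + x' * y) + 2 * Q.C * y * y',
      Q.A * x' ^ 2 + Q.B * x' * y' + Q.C * y' ^ 2)
  have hinj : Function.Injective F := by
    rintro ⟨A, B, C⟩ ⟨A', B', C'⟩ h
    simp only [F, Prod.mk.injEq] at h
    obtain ⟨h1, h2, h3⟩ := h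
    have hN2 : N ^ 2 ≠ 0 := pow_ne_zero _ hN
    have eA : A = A' := mul_left_cancel₀ hN2 (by
      rw [hNdef]; linear_combination y' ^ 2 * h1 - y * y' * h2 + y ^ 2 * h3)
    have eC : C = C' := mul_left_cancel₀ hN2 (by
      rw [hNdef]; linear_combination x' ^ 2 * h1 - x * x' * h2 + x ^ 2 * h3)
    have eB : B = B' := mul_left_cancel₀ hN2 (by
      rw [hNdef]
      linear_combination -2 * x' * y' * h1 + (x * y' + x' * y) * h2 - 2 * x * y * h3)
    rw [eA, eB, eC]
  refine Set.Finite.of_finite_image (f := F) ?_ hinj.injOn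
  refine ((Set.finite_Icc (-T) T).prod ((Set.finite_Icc (-T) T).prod
    (Set.finite_Icc (-T) T))).subset ?_
  rintro _ ⟨Q, ⟨h1, h2⟩, rfl⟩
  set α := Q.A * x ^ 2 + Q.B * x * y + Q.C * y ^ 2
  set β := 2 * Q.A * x * x' + Q.B * (x * y' + x' * y) + 2 * Q.C * y * y'
  set δ := Q.A * x' ^ 2 + Q.B * x' * y' + Q.C * y' ^ 2
  have hdisc : β ^ 2 - 4 * (α * δ) = N ^ 2 * Q.disc := by
    simp only [α, β, δ, hNdef, QForm.disc]; ring
  have hle : β ^ 2 - 4 * (α * δ) ≤ T := by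
    rw [hdisc]
    refine le_trans ?_ (le_abs_self _)
    exact mul_le_mul_of_nonneg_left h2 (sq_nonneg _)
  have hαδ : |α| * |δ| ≤ T := by
    rw [← abs_mul, abs_of_neg h1]
    nlinarith [sq_nonneg β]
  have hα0 : 1 ≤ |α| := Int.one_le_abs (by rintro h; rw [h] at h1; simp at h1)
  have hδ0 : 1 ≤ |δ| := Int.one_le_abs (by rintro h; rw [h] at h1; simp at h1)
  have hβ : |β| ≤ T := by
    rcases eq_or_ne β 0 with h | h
    · rw [h, abs_zero]; exact abs_nonneg _
    · have h3 : 1 ≤ |β| := Int.one_le_abs h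
      have h4 := sq_abs β
      nlinarith
  simp only [Set.mem_prod, Set.mem_Icc, F, ← abs_le]
  exact ⟨by nlinarith, hβ, by nlinarith⟩

/-! ### The orbit of an RM point -/

/-- The inclusion of `ℚ(τ)` in `ℂ_p`. -/
def emb (τ : ℂ_[p]) : fieldOf τ →ₐ[ℚ] ℂ_[p] := (algebraMap (fieldOf τ) ℂ_[p]).toRatAlgHom

theorem emb_apply (τ : ℂ_[p]) (ω : fieldOf τ) : emb τ ω = (ω : ℂ_[p]) := rfl

/-- The orbit of `τ` under the Ihara group, in `ℚ(τ)`. -/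
def orb (τ : ℂ_[p]) : Set (fieldOf τ) := {ω | ∃ γ ∈ ihara p, (ω : ℂ_[p]) = moebius γ τ}

theorem gen_mem_orb (τ : ℂ_[p]) : IntermediateField.AdjoinSimple.gen ℚ τ ∈ orb τ :=
  ⟨1, one_mem _, by rw [moebius_eq_mob, mob_one]; rfl⟩

theorem coe_mob (τ : ℂ_[p]) (γ : Matrix.SpecialLinearGroup (Fin 2) ℚ) (ω : fieldOf τ) :
    ((mob γ ω : fieldOf τ) : ℂ_[p]) = mob γ (ω : ℂ_[p]) :=
  map_mob (algebraMap (fieldOf τ) ℂ_[p]) γ ω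

section orb

variable {τ : ℂ_[p]} (hτ : IsRM τ) {ω : fieldOf τ} (hω : ω ∈ orb τ)

include hτ hω

theorem mem_Hp_of_mem_orb : (ω : ℂ_[p]) ∈ Hp p := by
  obtain ⟨γ, -, h⟩ := hω
  rw [h]
  exact mob_mem_Hp γ hτ.1

theorem natDegree_of_mem_orb : (minpoly ℚ ω).natDegree = 2 := by
  obtain ⟨γ, -, h⟩ := hω
  have h1 := (galConj_mob γ hτ.natDegree).1
  rw [← moebius_eq_mob, ← h, ← emb_apply, minpoly.algHom_eq _ (emb τ).injective] at h1
  exact h1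

theorem coe_galConj : galConj (ω : ℂ_[p]) = (galConj ω : fieldOf τ) :=
  (map_galConj (emb τ) (natDegree_of_mem_orb hτ hω)).2

theorem galConj_mem_Hp_of_mem_orb : ((galConj ω : fieldOf τ) : ℂ_[p]) ∈ Hp p := by
  rw [← coe_galConj hτ hω]
  exact galConj_mem_Hp (mem_Hp_of_mem_orb hτ hω)

theorem ne_ratCast_of_mem_orb (ι : fieldOf τ →ₐ[ℚ] ℝ) (q : ℚ) : ι ω ≠ q := by
  intro h
  refine ne_algebraMap_of_natDegree (natDegree_of_mem_orb hτ hω) q (ι.injective ?_)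
  change ι _ = ι _
  rw [h, AlgHom.commutes]; simp

theorem galConj_ne_ratCast_of_mem_orb (ι : fieldOf τ →ₐ[ℚ] ℝ) (q : ℚ) :
    ι (galConj ω) ≠ q := by
  intro h
  refine ne_algebraMap_of_natDegree (galConj_props (natDegree_of_mem_orb hτ hω)).1 q
    (ι.injective ?_)
  change ι _ = ι _
  rw [h, AlgHom.commutes]; simp

omit hτ in
theorem mob_mem_orb (hτ : τ ∈ Hp p) {γ : Matrix.SpecialLinearGroup (Fin 2) ℚ} (hγ : γ ∈ ihara p) :
    mob γ ω ∈ orb τ := by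
  obtain ⟨δ, hδ, h⟩ := hω
  refine ⟨γ * δ, mul_mem hγ hδ, ?_⟩
  rw [coe_mob, h, moebius_eq_mob, moebius_eq_mob, mob_mul _ _ (aut_ne_zero_of_mem_Hp δ hτ)]

theorem isFormOf_formOf (ι : fieldOf τ →ₐ[ℚ] ℝ) : IsFormOf ι ω (formOf ι ω) :=
  Classical.epsilon_spec (exists_isFormOf ι ω (natDegree_of_mem_orb hτ hω))

theorem formOf_A_ne_zero (ι : fieldOf τ →ₐ[ℚ] ℝ) : (formOf ι ω).A ≠ 0 := by
  intro hA
  have h0 := (isFormOf_formOf hτ hω ι).2.2.2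
  simp only [QForm.firstRoot, hA, Int.cast_zero, mul_zero, div_zero] at h0
  exact ne_ratCast_of_mem_orb hτ hω ι 0 (by rw [h0]; simp)

theorem formOf_eval (ι : fieldOf τ →ₐ[ℚ] ℝ) : (formOf ι ω).eval (ω : ℂ_[p]) = 0 := by
  have := congrArg (emb τ) (isFormOf_formOf hτ hω ι).2.2.1
  simpa [QForm.eval, emb_apply] using this

theorem formOf_sum_prod (ι : fieldOf τ →ₐ[ℚ] ℝ) :
    ((formOf ι ω).A : ℂ_[p]) * ((ω : ℂ_[p]) + (galConj ω : fieldOf τ)) = -(formOf ι ω).B ∧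
      ((formOf ι ω).A : ℂ_[p]) * ((ω : ℂ_[p]) * (galConj ω : fieldOf τ)) = (formOf ι ω).C := by
  rw [← coe_galConj hτ hω]
  refine quad_galConj ?_ (formOf_A_ne_zero hτ hω ι) (formOf_eval hτ hω ι)
  exact (map_galConj (emb τ) (natDegree_of_mem_orb hτ hω)).1

theorem formOf_real (ι : fieldOf τ →ₐ[ℚ] ℝ) :
    ((formOf ι ω).A : ℝ) * (ι ω + ι (galConj ω)) = -(formOf ι ω).B ∧
      ((formOf ι ω).A : ℝ) * (ι ω * ι (galConj ω)) = (formOf ι ω).C := by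
  have h := map_galConj ι (natDegree_of_mem_orb hτ hω)
  rw [← h.2]
  refine quad_galConj h.1 (formOf_A_ne_zero hτ hω ι) ?_
  have := congrArg ι (isFormOf_formOf hτ hω ι).2.2.1
  simpa [QForm.eval] using this

end orb

/-! ### The terms of the series -/

/-- The intersection number of the geodesic from `ω` to `ω'` with the one from `r` to `s`. -/
def chi {K : IntermediateField ℚ ℂ_[p]} (ι : K →ₐ[ℚ] ℝ) (r s : OnePoint ℚ) (ω : K) : ℂ_[p] :=
  ((orient (ι ω) (ι (galConj ω)) r - orient (ι ω) (ι (galConj ω)) s : ℤ) : ℂ_[p]) / 2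

/-- The term of index `ω` in the series at `z` of the cocycle, evaluated at `{r, s}`. -/
def term {K : IntermediateField ℚ ℂ_[p]} (k : ℕ) (ι : K →ₐ[ℚ] ℝ) (r s : OnePoint ℚ) (z : ℂ_[p])
    (ω : K) : ℂ_[p] :=
  chi ι r s ω * hker ω (galConj ω : K) z ^ k

/-- The cocycle attached to the orbit of `τ`. -/
def orbCocycle (k : ℕ) (τ : ℂ_[p]) (ι : fieldOf τ →ₐ[ℚ] ℝ) (r s : OnePoint ℚ) (z : ℂ_[p]) :
    ℂ_[p] :=
  ∑' ω : orb τ, term k ι r s z ω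

theorem norm_chi_le {K : IntermediateField ℚ ℂ_[p]} (ι : K →ₐ[ℚ] ℝ) (r s : OnePoint ℚ) (ω : K) :
    ‖chi ι r s ω‖ ≤ ‖(2 : ℂ_[p])‖⁻¹ := by
  rw [chi, norm_div, div_eq_mul_inv]
  exact mul_le_of_le_one_left (by positivity) (norm_intCast_le_one _)

theorem chi_self {K : IntermediateField ℚ ℂ_[p]} (ι : K →ₐ[ℚ] ℝ) (r : OnePoint ℚ) (ω : K) :
    chi ι r r ω = 0 := by simp [chi]

theorem chi_antisymm {K : IntermediateField ℚ ℂ_[p]} (ι : K →ₐ[ℚ] ℝ) (r s : OnePoint ℚ) (ω : K) :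
    chi ι r s ω = -chi ι s r ω := by
  unfold chi; push_cast; ring

theorem chi_add {K : IntermediateField ℚ ℂ_[p]} (ι : K →ₐ[ℚ] ℝ) (r s t : OnePoint ℚ) (ω : K) :
    chi ι r s ω + chi ι s t ω = chi ι r t ω := by
  unfold chi; push_cast; ring

theorem hker_mob (γ : Matrix.SpecialLinearGroup (Fin 2) ℚ) {x y z : ℂ_[p]} (hx : x ∈ Hp p)
    (hy : y ∈ Hp p) (hz : z ∈ Hp p) :
    hker (mob γ x) (mob γ y) (mob γ z) = aut γ z ^ 2 * hker x y z := by
  have hx' := aut_ne_zero_of_mem_Hp γ hx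
  have hy' := aut_ne_zero_of_mem_Hp γ hy
  have hz' := aut_ne_zero_of_mem_Hp γ hz
  unfold hker
  rw [mob_sub_mob γ hx' hy', mob_sub_mob γ hz' hx', mob_sub_mob γ hz' hy', div_mul_div_comm,
    div_div_div_eq]
  rw [show (x - y) * (aut γ z * aut γ x * (aut γ z * aut γ y)) =
    (aut γ x * aut γ y) * (aut γ z ^ 2 * (x - y)) by ring,
    mul_div_mul_left _ _ (mul_ne_zero hx' hy'), mul_div_assoc]

theorem hker_swap (x y z : ℂ_[p]) : hker y x z = -hker x y z := by
  unfold hker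
  rw [← neg_sub x y, neg_div, mul_comm]

section terms

variable {τ : ℂ_[p]} (hτ : IsRM τ) (ι : fieldOf τ →ₐ[ℚ] ℝ)

include hτ

theorem chi_mob {ω : fieldOf τ} (hω : ω ∈ orb τ) (γ : Matrix.SpecialLinearGroup (Fin 2) ℚ)
    (r s : OnePoint ℚ) : chi ι (actP1 γ r) (actP1 γ s) (mob γ ω) = chi ι r s ω := by
  unfold chi
  have h1 : ι (mob γ ω) = mob γ (ι ω) := map_mob (ι : fieldOf τ →+* ℝ) γ ω
  have h2 : ι (galConj (mob γ ω)) = mob γ (ι (galConj ω)) := by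
    rw [(galConj_mob γ (natDegree_of_mem_orb hτ hω)).2]
    exact map_mob (ι : fieldOf τ →+* ℝ) γ _
  rw [h1, h2, orient_mob γ (ne_ratCast_of_mem_orb hτ hω ι) (galConj_ne_ratCast_of_mem_orb hτ hω ι),
    orient_mob γ (ne_ratCast_of_mem_orb hτ hω ι) (galConj_ne_ratCast_of_mem_orb hτ hω ι)]

theorem term_mob {ω : fieldOf τ} (hω : ω ∈ orb τ) (γ : Matrix.SpecialLinearGroup (Fin 2) ℚ)
    (k : ℕ) (r s : OnePoint ℚ) {z : ℂ_[p]} (hz : z ∈ Hp p) :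
    term k ι (actP1 γ r) (actP1 γ s) (mob γ z) (mob γ ω) =
      aut γ z ^ (2 * k) * term k ι r s z ω := by
  unfold term
  rw [chi_mob hτ ι hω, (galConj_mob γ (natDegree_of_mem_orb hτ hω)).2, coe_mob, coe_mob,
    hker_mob γ (mem_Hp_of_mem_orb hτ hω) (galConj_mem_Hp_of_mem_orb hτ hω) hz, mul_pow, ← pow_mul]
  ring

/-- Q(x, y) = A(x - ωy)(x - ω'y), so different orientations at the two points mean opposite signs of
`Q`. This turns a nonzero intersection number into the hypothesis of `finite_forms`. -/
theorem sign_mul_formOf {ω : fieldOf τ} (hω : ω ∈ orb τ) {x y x' y' : ℤ} (h : IsCoprime x y)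
    (h' : IsCoprime x' y') (hchi : chi ι (pt x y) (pt x' y') ω ≠ 0) :
    ((formOf ι ω).A * x ^ 2 + (formOf ι ω).B * x * y + (formOf ι ω).C * y ^ 2) *
      ((formOf ι ω).A * x' ^ 2 + (formOf ι ω).B * x' * y' + (formOf ι ω).C * y' ^ 2) < 0 := by
  obtain ⟨h1, h2⟩ := formOf_real hτ hω ι
  have hA : ((formOf ι ω).A : ℝ) ≠ 0 := by exact_mod_cast formOf_A_ne_zero hτ hω ι
  set A := ((formOf ι ω).A : ℝ)
  set a := ι ω
  set b := ι (galConj ω)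
  have hne : orient a b (pt x y) ≠ orient a b (pt x' y') := by
    rintro he
    apply hchi
    simp [chi, a, b, he]
  rw [orient_pt x y h, orient_pt x' y' h'] at hne
  have hirr := ne_ratCast_of_mem_orb hτ hω ι
  have hirr' := galConj_ne_ratCast_of_mem_orb hτ hω ι
  have hlin : ∀ c : ℝ, (∀ q : ℚ, c ≠ q) → ∀ u v : ℤ, IsCoprime u v → (u : ℝ) - c * v ≠ 0 := by
    intro c hc u v huv h0
    by_cases hv : v = 0
    · subst hv
      simp only [Int.cast_zero, mul_zero, sub_zero, Int.cast_eq_zero] at h0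
      subst h0
      exact not_isCoprime_zero_zero huv
    · refine hc (u / v) ?_
      have : (v : ℝ) ≠ 0 := by exact_mod_cast hv
      push_cast
      field_simp
      linarith
  have hab : a ≠ b := fun e ↦
    (galConj_ne (natDegree_of_mem_orb hτ hω)) (ι.injective e.symm)
  have key : ∀ s t : ℝ, s ≠ 0 → t ≠ 0 →
      ((SignType.sign s : ℤ)) ≠ (SignType.sign t : ℤ) → s * t < 0 := by
    intro s t hs ht hst
    rcases lt_or_gt_of_ne hs with hs | hs <;> rcases lt_or_gt_of_ne ht with ht | ht
    · simp [sign_neg hs, sign_neg ht] at hst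
    · exact mul_neg_of_neg_of_pos hs ht
    · exact mul_neg_of_pos_of_neg hs ht
    · simp [sign_pos hs, sign_pos ht] at hst
  have := key _ _ (mul_ne_zero (mul_ne_zero (hlin a hirr x y h) (hlin b hirr' x y h))
    (sub_ne_zero.2 hab)) (mul_ne_zero (mul_ne_zero (hlin a hirr x' y' h') (hlin b hirr' x' y' h'))
    (sub_ne_zero.2 hab)) hne
  have h3 : ((((formOf ι ω).A * x ^ 2 + (formOf ι ω).B * x * y + (formOf ι ω).C * y ^ 2) *
      ((formOf ι ω).A * x' ^ 2 + (formOf ι ω).B * x' * y' + (formOf ι ω).C * y' ^ 2) : ℤ) : ℝ) *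
      (a - b) ^ 2 = A ^ 2 *
      (((x - a * y) * (x - b * y) * (a - b)) * ((x' - a * y') * (x' - b * y') * (a - b))) := by
    push_cast
    rw [← h2, show ((formOf ι ω).B : ℝ) = -(A * (a + b)) by rw [h1, neg_neg]]
    ring
  have h4 : A ^ 2 *
      (((x - a * y) * (x - b * y) * (a - b)) * ((x' - a * y') * (x' - b * y') * (a - b))) < 0 :=
    mul_neg_of_pos_of_neg (by positivity) this
  rw [← h3] at h4
  exact_mod_cast neg_of_mul_neg_left h4 (sq_nonneg _)

/-- Since disc·|disc|_p is constant on the orbit, a lower bound for |disc|_p is an upper bound for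
disc, and `finite_forms` applies; a point is recovered from its form as the first root. -/
theorem finite_chi_ne_zero (r s : OnePoint ℚ) {δ : ℝ} (hδ : 0 < δ) :
    {ω : orb τ | chi ι r s (ω : fieldOf τ) ≠ 0 ∧
      δ ≤ ‖((formOf ι (ω : fieldOf τ)).disc : ℂ_[p])‖}.Finite := by
  by_cases hrs : r = s
  · subst hrs
    simp [chi_self]
  obtain ⟨x, y, h, rfl⟩ := exists_pt r
  obtain ⟨x', y', h', rfl⟩ := exists_pt s
  have hN : x * y' - y * x' ≠ 0 := fun h0 ↦ hrs (pt_eq_pt h h' h0)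
  set D₀ := (formOf ι (IntermediateField.AdjoinSimple.gen ℚ τ)).disc
  obtain ⟨K, hK⟩ := exists_int_gt ((D₀ : ℝ) * ‖(D₀ : ℚ_[p])‖ / δ)
  refine Set.Finite.of_finite_image (f := fun ω : orb τ ↦ formOf ι (ω : fieldOf τ))
    ((finite_forms x y x' y' hN K).subset ?_) ?_
  · rintro _ ⟨⟨ω, hω⟩, ⟨h1, h2⟩, rfl⟩
    refine ⟨sign_mul_formOf hτ ι hω h h' h1, ?_⟩
    have hF := isFormOf_formOf hτ hω ι
    obtain ⟨γ, hγ, hωγ⟩ := id hω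
    have hgen := gen_mem_orb τ
    have e := disc_mul_norm_eq hτ.1 hγ (isFormOf_formOf hτ hgen ι).1 hF.1
      (formOf_A_ne_zero hτ hgen ι) (formOf_eval hτ hgen ι)
      (by rw [← moebius_eq_mob, ← hωγ]; exact formOf_eval hτ hω ι)
    have hpos : (0 : ℝ) < (formOf ι ω).disc := by exact_mod_cast hF.2.1
    simp only [norm_intCast_eq] at h2
    have : ((formOf ι ω).disc : ℝ) ≤ (D₀ : ℝ) * ‖(D₀ : ℚ_[p])‖ / δ := by
      rw [le_div_iff₀ hδ, ← e]
      gcongr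
    exact_mod_cast (this.trans hK.le)
  · rintro ⟨ω, hω⟩ - ⟨ω₂, hω₂⟩ - he
    simp only at he
    apply Subtype.ext
    apply ι.injective
    change ι ω = ι ω₂
    rw [(isFormOf_formOf hτ hω ι).2.2.2, (isFormOf_formOf hτ hω₂ ι).2.2.2, he]

theorem exists_term_small {k : ℕ} (hk : k ≠ 0) (n : ℕ) {ε : ℝ} (hε : 0 < ε) :
    ∃ δ > 0, ∀ ω ∈ orb τ, ‖((formOf ι ω).disc : ℂ_[p])‖ < δ → ∀ z ∈ affinoid p n,
      (z - ω) * (z - (galConj ω : fieldOf τ)) ≠ 0 ∧ ∀ r s, ‖term k ι r s z ω‖ ≤ ε := by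
  have h4 := norm_four_pos (p := p)
  have h2 : 0 < ‖(2 : ℂ_[p])‖ := norm_pos_iff.2 (by norm_num)
  have hpn := inv_p_pow_pos (p := p) n
  set M := (((p : ℝ)⁻¹ ^ n) ^ 2)⁻¹ ^ 2 with hM
  have hMpos : 0 < M := by positivity
  -- The 1 ensures that the `k`-th power of the kernel is no larger than the kernel; the factor |2|
  -- absorbs the denominator of `chi`.
  set η := min 1 (ε * ‖(2 : ℂ_[p])‖) with hη
  have hηpos : 0 < η := by positivity
  refine ⟨min (‖(4 : ℂ_[p])‖ * ((p : ℝ)⁻¹ ^ n) ^ 2) (η ^ 2 / M), by positivity,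
    fun ω hω hD z hz ↦ ?_⟩
  obtain ⟨e1, e2⟩ := formOf_sum_prod hτ hω ι
  obtain ⟨h1, h3⟩ := norm_hker_sq_le hz (isFormOf_formOf hτ hω ι).1 (formOf_A_ne_zero hτ hω ι)
    e1 e2 (hD.trans_le (min_le_left _ _))
  refine ⟨h1, fun r s ↦ ?_⟩
  have h5 : ‖hker (ω : ℂ_[p]) (galConj ω : fieldOf τ) z‖ ^ 2 ≤ η ^ 2 := by
    refine h3.trans ?_
    rw [← le_div_iff₀ hMpos]
    exact hD.le.trans (min_le_right _ _)
  have h6 := le_of_sq_le_sq h5 hηpos.le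
  have h7 : ‖hker (ω : ℂ_[p]) (galConj ω : fieldOf τ) z‖ ^ k ≤ ε * ‖(2 : ℂ_[p])‖ :=
    (pow_le_of_le_one (norm_nonneg _) (h6.trans (min_le_left _ _)) hk).trans
      (h6.trans (min_le_right _ _))
  rw [term, norm_mul, norm_pow]
  calc _ ≤ ‖(2 : ℂ_[p])‖⁻¹ * (ε * ‖(2 : ℂ_[p])‖) :=
        mul_le_mul (norm_chi_le _ _ _ _) h7 (by positivity) (by positivity)
    _ = ε := by field_simp

theorem finite_term_not_small {k : ℕ} (hk : k ≠ 0) (r s : OnePoint ℚ) (n : ℕ) {ε : ℝ}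
    (hε : 0 < ε) :
    {ω : orb τ | ¬∀ z ∈ affinoid p n, ‖term k ι r s z (ω : fieldOf τ)‖ ≤ ε}.Finite := by
  obtain ⟨δ, hδ, h⟩ := exists_term_small hτ ι hk n hε
  refine (finite_chi_ne_zero hτ ι r s hδ).subset ?_
  rintro ⟨ω, hω⟩ hn
  refine ⟨fun h0 ↦ hn fun z _ ↦ ?_, ?_⟩
  · simp only at h0
    rw [term, h0, zero_mul, norm_zero]; exact hε.le
  · by_contra hlt
    push Not at hlt
    exact hn fun z hz ↦ (h ω hω hlt z hz).2 r s

theorem summable_term {k : ℕ} (hk : k ≠ 0) (r s : OnePoint ℚ) {z : ℂ_[p]} (hz : z ∈ Hp p) :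
    Summable fun ω : orb τ ↦ term k ι r s z ω := by
  obtain ⟨n, hn⟩ := exists_mem_affinoid hz
  refine IsAnalyticOnAffinoid.summable_of_small
    (u := fun (ω : orb τ) (z : ℂ_[p]) ↦ term k ι r s z ω) fun ε hε ↦ ?_
  refine (finite_term_not_small hτ ι hk r s n hε).subset fun ω hω h ↦ hω (h z hn)

end terms

/-! ### Closure properties of rigid meromorphic functions -/

/-- `f` represents a meromorphic function on the `n`-th affinoid. -/
def IsMeromorphicOnAffinoid (p : ℕ) [Fact p.Prime] (n : ℕ) (f : ℂ_[p] → ℂ_[p]) : Prop :=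
  ∃ q : ℂ_[p][X], q ≠ 0 ∧ ∃ g : ℂ_[p] → ℂ_[p], IsAnalyticOnAffinoid p n g ∧
    {z ∈ affinoid p n | q.eval z * f z ≠ g z}.Finite

namespace IsMeromorphicOnAffinoid

variable {n : ℕ} {f g : ℂ_[p] → ℂ_[p]}

theorem of_analytic (h : IsAnalyticOnAffinoid p n f) : IsMeromorphicOnAffinoid p n f :=
  ⟨1, one_ne_zero, f, h, by simp⟩

theorem rational (P : ℂ_[p][X]) {Q : ℂ_[p][X]} (hQ : Q ≠ 0) :
    IsMeromorphicOnAffinoid p n fun z ↦ P.eval z / Q.eval z := by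
  refine ⟨Q, hQ, fun z ↦ P.eval z, .poly P, (eval_finite hQ).subset ?_⟩
  rintro z ⟨-, h⟩
  by_contra h0
  exact h (mul_div_cancel₀ _ h0)

theorem add (hf : IsMeromorphicOnAffinoid p n f) (hg : IsMeromorphicOnAffinoid p n g) :
    IsMeromorphicOnAffinoid p n fun z ↦ f z + g z := by
  obtain ⟨q₁, h₁, f₁, hf₁, hfin₁⟩ := hf
  obtain ⟨q₂, h₂, f₂, hf₂, hfin₂⟩ := hg
  refine ⟨q₁ * q₂, mul_ne_zero h₁ h₂, fun z ↦ q₂.eval z * f₁ z + q₁.eval z * f₂ z,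
    ((IsAnalyticOnAffinoid.poly q₂).mul hf₁).add ((IsAnalyticOnAffinoid.poly q₁).mul hf₂),
    (hfin₁.union hfin₂).subset ?_⟩
  rintro z ⟨hz, h⟩
  by_contra hcon
  simp only [Set.mem_union, Set.mem_ofPred_eq, not_or, not_and, not_not] at hcon
  refine h ?_
  simp only [eval_mul, ← hcon.1 hz, ← hcon.2 hz]
  ring

theorem const_mul (c : ℂ_[p]) (hf : IsMeromorphicOnAffinoid p n f) :
    IsMeromorphicOnAffinoid p n fun z ↦ c * f z := by
  obtain ⟨q, hq, g, hg, hfin⟩ := hf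
  refine ⟨q, hq, fun z ↦ c * g z, (IsAnalyticOnAffinoid.const c).mul hg, hfin.subset ?_⟩
  rintro z ⟨hz, h⟩
  refine ⟨hz, fun h' ↦ h ?_⟩
  simp only [← h']; ring

theorem sum {ι : Type*} (s : Finset ι) {u : ι → ℂ_[p] → ℂ_[p]}
    (h : ∀ i ∈ s, IsMeromorphicOnAffinoid p n (u i)) :
    IsMeromorphicOnAffinoid p n fun z ↦ ∑ i ∈ s, u i z := by
  classical
  induction s using Finset.induction_on with
  | empty => simpa using of_analytic (IsAnalyticOnAffinoid.const 0)
  | insert a s ha ih =>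
    simp only [Finset.sum_insert ha]
    exact (h a (by simp)).add (ih fun i hi ↦ h i (by simp [hi]))

end IsMeromorphicOnAffinoid

theorem isRigidMeromorphic_iff {f : ℂ_[p] → ℂ_[p]} :
    IsRigidMeromorphic p f ↔ ∀ n, IsMeromorphicOnAffinoid p n f := Iff.rfl

/-! ### The cocycle of an orbit -/

/-- The denominator of `hker`. -/
def hkerDen (x y : ℂ_[p]) : ℂ_[p][X] := (X - C x) * (X - C y)

theorem hkerDen_ne_zero (x y : ℂ_[p]) : hkerDen x y ≠ 0 :=
  mul_ne_zero (X_sub_C_ne_zero x) (X_sub_C_ne_zero y)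

theorem eval_hkerDen (x y z : ℂ_[p]) : (hkerDen x y).eval z = (z - x) * (z - y) := by
  simp [hkerDen]

theorem term_eq {K : IntermediateField ℚ ℂ_[p]} (k : ℕ) (ι : K →ₐ[ℚ] ℝ) (r s : OnePoint ℚ)
    (ω : K) : (fun z ↦ term k ι r s z ω) = fun z ↦
      (C (chi ι r s ω * ((ω : ℂ_[p]) - (galConj ω : K)) ^ k)).eval z /
        (hkerDen (ω : ℂ_[p]) (galConj ω : K) ^ k).eval z := by
  funext z
  rw [eval_C, eval_pow, eval_hkerDen, term, hker, div_pow, mul_div_assoc]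

theorem isMeromorphicOnAffinoid_term {K : IntermediateField ℚ ℂ_[p]} (k : ℕ) (ι : K →ₐ[ℚ] ℝ)
    (r s : OnePoint ℚ) (ω : K) (n : ℕ) :
    IsMeromorphicOnAffinoid p n fun z ↦ term k ι r s z ω := by
  rw [term_eq]
  exact .rational _ (pow_ne_zero _ (hkerDen_ne_zero _ _))

theorem isAnalyticOnAffinoid_term {K : IntermediateField ℚ ℂ_[p]} (k : ℕ) (ι : K →ₐ[ℚ] ℝ)
    (r s : OnePoint ℚ) (ω : K) {n : ℕ} (h : chi ι r s ω = 0 ∨ ∀ z ∈ affinoid p n,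
      (z - ω) * (z - (galConj ω : K)) ≠ 0) :
    IsAnalyticOnAffinoid p n fun z ↦ term k ι r s z ω := by
  rcases h with h | h
  · simp only [term, h, zero_mul]
    exact .const 0
  · rw [term_eq]
    refine .rational _ _ fun z hz ↦ ?_
    rw [eval_pow, eval_hkerDen]
    exact pow_ne_zero _ (h z hz)

theorem analyticAt_hker {x y w : ℂ_[p]} (hx : w ≠ x) (hy : w ≠ y) :
    AnalyticAt ℂ_[p] (hker x y) w := by
  unfold hker
  refine analyticAt_const.div ((analyticAt_id.sub analyticAt_const).mul
    (analyticAt_id.sub analyticAt_const)) ?_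
  exact mul_ne_zero (sub_ne_zero.2 hx) (sub_ne_zero.2 hy)

theorem reg_term {K : IntermediateField ℚ ℂ_[p]} (k : ℕ) (ι : K →ₐ[ℚ] ℝ)
    (r s : OnePoint ℚ) (ω : K) {w : ℂ_[p]} (h : chi ι r s ω = 0 ∨
      (w ≠ ω ∧ w ≠ (galConj ω : K))) : Reg (fun z ↦ term k ι r s z ω) w := by
  rcases h with h | h
  · simp only [term, h, zero_mul]
    exact .const 0
  · exact .of_analyticAt (analyticAt_const.mul ((analyticAt_hker h.1 h.2).pow k))

section

variable {τ : ℂ_[p]} (hτ : IsRM τ) (ι : fieldOf τ →ₐ[ℚ] ℝ)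

include hτ

/-- On an affinoid, all but finitely many of the terms have an analytic sum. -/
theorem exists_orbCocycle_eq {k : ℕ} (hk : k ≠ 0) (r s : OnePoint ℚ) (n : ℕ) :
    ∃ (B : Finset (fieldOf τ)) (g : ℂ_[p] → ℂ_[p]), IsAnalyticOnAffinoid p n g ∧
      (∀ ω ∈ B, ω ∈ orb τ) ∧ (∀ ω ∈ orb τ, ω ∉ B → chi ι r s ω = 0 ∨ ∀ z ∈ affinoid p n,
        (z - ω) * (z - (galConj ω : fieldOf τ)) ≠ 0) ∧
      ∀ z ∈ affinoid p n, orbCocycle k τ ι r s z = ∑ ω ∈ B, term k ι r s z ω + g z := by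
  classical
  obtain ⟨δ, hδ, h⟩ := exists_term_small hτ ι hk n one_pos
  set B := (finite_chi_ne_zero hτ ι r s hδ).toFinset with hB
  have hmem : ∀ ω : orb τ, ω ∉ B → chi ι r s (ω : fieldOf τ) = 0 ∨ ∀ z ∈ affinoid p n,
      (z - (ω : fieldOf τ)) * (z - (galConj (ω : fieldOf τ) : fieldOf τ)) ≠ 0 := by
    intro ω hω
    rw [hB, Set.Finite.mem_toFinset] at hω
    by_cases h0 : chi ι r s (ω : fieldOf τ) = 0
    · exact Or.inl h0
    · right
      intro z hz
      refine (h ω ω.2 ?_ z hz).1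
      by_contra hlt
      exact hω ⟨h0, not_lt.1 hlt⟩
  let u : orb τ → ℂ_[p] → ℂ_[p] := fun ω z ↦ if ω ∈ B then 0 else term k ι r s z ω
  refine ⟨B.map (Function.Embedding.subtype _), fun z ↦ ∑' ω, u ω z, ?_, ?_, ?_, ?_⟩
  · refine .tsum (fun ω ↦ ?_) fun ε hε ↦ ?_
    · by_cases hω : ω ∈ B
      · simp only [u, if_pos hω]
        exact .const 0
      · simp only [u, if_neg hω]
        exact isAnalyticOnAffinoid_term k ι r s _ (hmem ω hω)
    · refine (finite_term_not_small hτ ι hk r s n hε).subset ?_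
      intro ω hω h'
      refine hω fun z hz ↦ ?_
      simp only [u]
      split_ifs
      · rw [norm_zero]; exact hε.le
      · exact h' z hz
  · simp only [Finset.mem_map]
    rintro _ ⟨ω, -, rfl⟩
    exact ω.2
  · intro ω hω hωB
    refine hmem ⟨ω, hω⟩ fun hB' ↦ hωB ?_
    rw [Finset.mem_map]
    exact ⟨_, hB', rfl⟩
  · intro z hz
    have hs := summable_term hτ ι hk r s (affinoid_subset_Hp n hz)
    have hu : Summable fun ω ↦ u ω z := by
      refine hs.congr_cofinite ((B.finite_toSet).subset fun ω hω ↦ ?_)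
      by_contra hωB
      exact hω (if_neg hωB).symm
    have h0 : ∑ ω ∈ B, u ω z = 0 := Finset.sum_eq_zero fun ω hω ↦ if_pos hω
    simp only
    rw [orbCocycle, Finset.sum_map, ← hs.sum_add_tsum_compl (s := B),
      ← hu.sum_add_tsum_compl (s := B), h0, zero_add]
    congr 1
    refine tsum_congr ?_
    rintro ⟨ω, hω⟩
    exact (if_neg hω).symm

theorem isRigidMeromorphic_orbCocycle {k : ℕ} (hk : k ≠ 0) (r s : OnePoint ℚ) :
    IsRigidMeromorphic p (orbCocycle k τ ι r s) := by
  rw [isRigidMeromorphic_iff]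
  intro n
  obtain ⟨B, g, hg, -, -, h⟩ := exists_orbCocycle_eq hτ ι hk r s n
  obtain ⟨q, hq, g', hg', hfin⟩ := (IsMeromorphicOnAffinoid.sum (n := n) B fun ω _ ↦
    isMeromorphicOnAffinoid_term k ι r s ω n).add (.of_analytic hg)
  refine ⟨q, hq, g', hg', hfin.subset ?_⟩
  rintro z ⟨hz, h'⟩
  refine ⟨hz, ?_⟩
  simpa only [← h z hz] using h'

/-- The principal part of the cocycle at a point. -/
theorem reg_orbCocycle_sub {k : ℕ} (hk : k ≠ 0) (r s : OnePoint ℚ) {w : ℂ_[p]} (hw : w ∈ Hp p)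
    (S : Finset (fieldOf τ)) (hS : ∀ ω ∈ orb τ, w = ω ∨ w = (galConj ω : fieldOf τ) → ω ∈ S)
    (hS' : ∀ ω ∈ S, ω ∈ orb τ) :
    Reg (fun z ↦ orbCocycle k τ ι r s z - ∑ ω ∈ S, term k ι r s z ω) w := by
  classical
  obtain ⟨n, hn⟩ := exists_mem_affinoid hw
  obtain ⟨B, g, hg, hB', hB, h⟩ := exists_orbCocycle_eq hτ ι hk r s n
  have h1 : Reg (fun z ↦ ∑ ω ∈ B \ S, term k ι r s z ω) w := by
    refine .sum _ fun ω hω ↦ reg_term k ι r s ω (Or.inr ?_)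
    rw [Finset.mem_sdiff] at hω
    have := mt (hS ω (hB' ω hω.1)) hω.2
    exact not_or.1 this
  have h2 : Reg (fun z ↦ ∑ ω ∈ S \ B, term k ι r s z ω) w := by
    refine .sum _ fun ω hω ↦ reg_term k ι r s ω ?_
    rw [Finset.mem_sdiff] at hω
    refine (hB ω (hS' ω hω.1) hω.2).imp id fun h ↦ ?_
    have := h w hn
    simpa [sub_eq_zero] using this
  refine (((Reg.of_analyticAt (hg.analyticAt hn)).add h1).sub h2).congr ?_
  filter_upwards [mem_nhdsWithin_of_mem_nhds (affinoid_mem_nhds hn)] with z hz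
  have h3 := Finset.sum_sdiff_sub_sum_sdiff (s₁ := S) (s₂ := B) (f := fun ω ↦ term k ι r s z ω)
  simp only [Pi.add_apply, Pi.sub_apply, h z hz]
  linear_combination h3

omit hτ in
theorem orbCocycle_antisymm (k : ℕ) (r s : OnePoint ℚ) (z : ℂ_[p]) :
    orbCocycle k τ ι r s z = -orbCocycle k τ ι s r z := by
  rw [orbCocycle, orbCocycle, ← tsum_neg]
  refine tsum_congr fun ω ↦ ?_
  rw [term, term, chi_antisymm, neg_mul]

theorem orbCocycle_add {k : ℕ} (hk : k ≠ 0) (r s t : OnePoint ℚ) {z : ℂ_[p]} (hz : z ∈ Hp p) :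
    orbCocycle k τ ι r s z + orbCocycle k τ ι s t z = orbCocycle k τ ι r t z := by
  rw [orbCocycle, orbCocycle, orbCocycle,
    ← (summable_term hτ ι hk r s hz).tsum_add (summable_term hτ ι hk s t hz)]
  refine tsum_congr fun ω ↦ ?_
  rw [term, term, term, ← add_mul, chi_add]

omit hτ in
/-- The action of an element of the Ihara group on the orbit. -/
def orbEquiv (hτ : τ ∈ Hp p) {γ : Matrix.SpecialLinearGroup (Fin 2) ℚ} (hγ : γ ∈ ihara p) :
    orb τ ≃ orb τ where
  toFun ω := ⟨mob γ (ω : fieldOf τ), mob_mem_orb ω.2 hτ hγ⟩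
  invFun ω := ⟨mob γ⁻¹ (ω : fieldOf τ), mob_mem_orb ω.2 hτ (inv_mem hγ)⟩
  left_inv := by
    rintro ⟨ω, hω⟩
    refine Subtype.ext (mob_inv_mob γ (aut_ne_zero γ ?_))
    intro q hq
    obtain ⟨δ, -, h⟩ := id hω
    refine Hp.ne_ratCast (mob_mem_Hp δ hτ) q ?_
    rw [← moebius_eq_mob, ← h, show ω = _ from hq]
    simp
  right_inv := by
    rintro ⟨ω, hω⟩
    have := mob_inv_mob γ⁻¹ (x := ω) (aut_ne_zero γ⁻¹ ?_)
    · rw [inv_inv] at this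
      exact Subtype.ext this
    · intro q hq
      obtain ⟨δ, -, h⟩ := hω
      refine Hp.ne_ratCast (mob_mem_Hp δ hτ) q ?_
      rw [← moebius_eq_mob, ← h, hq]
      simp

/-- Both ingredients of a term are equivariant, `chi` with weight 0 and `hker` with weight 2, so the
action only permutes the terms. -/
theorem orbCocycle_mob {γ : Matrix.SpecialLinearGroup (Fin 2) ℚ} (hγ : γ ∈ ihara p) (k : ℕ)
    (r s : OnePoint ℚ) {z : ℂ_[p]} (hz : z ∈ Hp p) :
    orbCocycle k τ ι (actP1 γ r) (actP1 γ s) (mob γ z) =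
      aut γ z ^ (2 * k) * orbCocycle k τ ι r s z := by
  rw [orbCocycle, orbCocycle, ← tsum_mul_left, ← (orbEquiv hτ.1 hγ).tsum_eq]
  exact tsum_congr fun ω ↦ term_mob hτ ι ω.2 γ k r s hz

theorem isMeromorphicCocycle_orbCocycle {k : ℕ} (hk : k ≠ 0) :
    IsMeromorphicCocycle p (2 * k) (orbCocycle k τ ι) where
  meromorphic := isRigidMeromorphic_orbCocycle hτ ι hk
  antisymm r s n := by
    convert Set.finite_empty
    ext z
    simp [orbCocycle_antisymm ι k r s z]
  add r s t n := by
    convert Set.finite_empty (α := ℂ_[p])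
    ext z
    simp only [Set.mem_ofPred_eq, Set.mem_empty_iff_false, iff_false, not_and, not_not]
    intro hz
    exact orbCocycle_add hτ ι hk r s t (affinoid_subset_Hp n hz)
  invariant γ hγ r s n := by
    convert Set.finite_empty (α := ℂ_[p])
    ext z
    simp only [Set.mem_ofPred_eq, Set.mem_empty_iff_false, iff_false, not_and, not_not]
    intro hz
    have hz' := affinoid_subset_Hp n hz
    rw [slash_apply, orbCocycle_mob hτ ι hγ k r s hz',
      inv_mul_cancel_left₀ (pow_ne_zero _ (aut_ne_zero_of_mem_Hp γ hz'))]

/-! ### Comparison with the functions `φ_τ` -/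

theorem chi_zero_infty {ω : fieldOf τ} (hω : ω ∈ orb τ) :
    chi ι ((0 : ℚ) : OnePoint ℚ) OnePoint.infty ω = crossing (ι ω) (ι (galConj ω)) := by
  have h1 := ne_ratCast_of_mem_orb hτ hω ι 0
  have h2 := galConj_ne_ratCast_of_mem_orb hτ hω ι 0
  rw [Rat.cast_zero] at h1 h2
  rw [chi, ← two_mul_crossing h1 h2]
  push_cast
  rw [mul_div_cancel_left₀ _ (by norm_num)]

theorem chi_eq_zero_of_not_linked {ω : fieldOf τ} (hω : ω ∈ orb τ) (h : ω ∉ linked τ ι) :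
    chi ι ((0 : ℚ) : OnePoint ℚ) OnePoint.infty ω = 0 := by
  rw [chi_zero_infty hτ ι hω]
  have h0 : ¬ι ω * ι (galConj ω) < 0 := fun h0 ↦ h ⟨hω, h0⟩
  rw [crossing, if_neg, if_neg, Int.cast_zero]
  · rintro ⟨h1, h2⟩; exact h0 (mul_neg_of_pos_of_neg h2 h1)
  · rintro ⟨h1, h2⟩; exact h0 (mul_neg_of_neg_of_pos h1 h2)

/-- √D = A(ω - ω') and Q(z) = A(z - ω)(z - ω'), so the leading coefficient cancels. -/
theorem phiTerm_eq (k : ℕ) (z : ℂ_[p]) (ω : linked τ ι) :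
    phiTerm k τ ι z ω = term k ι ((0 : ℚ) : OnePoint ℚ) OnePoint.infty z ω := by
  obtain ⟨ω, hω⟩ := ω
  have ho : ω ∈ orb τ := hω.1
  obtain ⟨h1, h2⟩ := formOf_sum_prod hτ ho ι
  have hA : ((formOf ι ω).A : ℂ_[p]) ≠ 0 := by exact_mod_cast formOf_A_ne_zero hτ ho ι
  rw [phiTerm, term, chi_zero_infty hτ ι ho, mul_div_assoc, ← div_pow]
  congr 2
  have e1 : ((sqrtDisc ι ω : fieldOf τ) : ℂ_[p]) =
      (formOf ι ω).A * ((ω : ℂ_[p]) - (galConj ω : fieldOf τ)) := by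
    have : ((sqrtDisc ι ω : fieldOf τ) : ℂ_[p]) = 2 * (formOf ι ω).A * ω + (formOf ι ω).B := by
      change emb τ (sqrtDisc ι ω) = _
      rw [sqrtDisc, map_add, map_mul, map_mul, map_intCast, map_intCast, map_ofNat]
      rfl
    rw [this]
    linear_combination h1
  have e2 : (formOf ι ω).eval z =
      (formOf ι ω).A * ((z - (ω : ℂ_[p])) * (z - (galConj ω : fieldOf τ))) := by
    rw [QForm.eval]
    linear_combination z * h1 - h2
  simp only
  rw [e1, e2, hker, mul_div_mul_left _ _ hA]

/-- Points of the orbit outside `linked` have `chi` equal to 0, so summing over the whole orbit adds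
only zeros. -/
theorem summable_phiTerm {k : ℕ} (hk : k ≠ 0) {z : ℂ_[p]} (hz : z ∈ Hp p) :
    Summable (phiTerm k τ ι z) ∧ phi k τ ι z =
      orbCocycle k τ ι ((0 : ℚ) : OnePoint ℚ) OnePoint.infty z := by
  set F : fieldOf τ → ℂ_[p] := fun ω ↦ term k ι ((0 : ℚ) : OnePoint ℚ) OnePoint.infty z ω
  have hF : phiTerm k τ ι z = fun ω : linked τ ι ↦ F ω := funext fun ω ↦ phiTerm_eq hτ ι k z ω
  have hind : (linked τ ι).indicator F = (orb τ).indicator F := by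
    classical
    funext ω
    rw [Set.indicator_apply, Set.indicator_apply]
    by_cases h1 : ω ∈ linked τ ι
    · have h2 : ω ∈ orb τ := h1.1
      rw [if_pos h1, if_pos h2]
    · rw [if_neg h1]
      split_ifs with h2
      · simp only [F, term, chi_eq_zero_of_not_linked hτ ι h2 h1, zero_mul]
      · rfl
  have hs := summable_term hτ ι hk ((0 : ℚ) : OnePoint ℚ) OnePoint.infty hz
  constructor
  · rw [hF]
    refine (summable_subtype_iff_indicator (f := F) (s := linked τ ι)).2 ?_
    rw [hind]
    exact (summable_subtype_iff_indicator (f := F) (s := orb τ)).1 hs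
  · have e1 : phi k τ ι z = ∑' ω : linked τ ι, F ω := tsum_congr fun ω ↦ phiTerm_eq hτ ι k z ω
    have e2 : ∑' ω : linked τ ι, F ω = ∑' ω, (linked τ ι).indicator F ω := tsum_subtype _ _
    have e3 : ∑' ω : orb τ, F ω = ∑' ω, (orb τ).indicator F ω := tsum_subtype _ _
    rw [e1, e2, hind, ← e3]
    rfl

end

/-! ### Regular points of a cocycle -/

namespace IsMeromorphicCocycle

variable {W : ℕ} {J : OnePoint ℚ → OnePoint ℚ → ℂ_[p] → ℂ_[p]}

theorem regSystem (hJ : IsMeromorphicCocycle p W J) : RegSystem (fun r s ↦ Reg (J r s)) where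
  refl w hw r := by
    refine (Reg.const 0).congr ?_
    filter_upwards [(hJ.antisymm r r).eventuallyEq hw] with z hz
    rw [Pi.neg_apply] at hz
    have h2 : (2 : ℂ_[p]) * J r r z = 0 := by linear_combination hz
    exact ((mul_eq_zero.1 h2).resolve_left (by norm_num)).symm
  symm w hw r s h := h.neg.congr ((hJ.antisymm s r).eventuallyEq hw).symm
  trans w hw r s t h h' := (h.add h').congr ((hJ.add r s t).eventuallyEq hw)
  equiv γ hγ w hw r s := by
    have h := (hJ.invariant γ hγ r s).eventuallyEq hw
    exact ⟨fun h' ↦ Reg.of_slash hw (h'.congr h.symm), fun h' ↦ (Reg.slash W γ hw h').congr h⟩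
  finite n := by
    rw [pt_zero_one, pt_one_zero]
    exact (hJ.meromorphic _ _).finite_not_reg n

/-- At a fixed point of a hyperbolic element, the value at `{0, ∞}` is invariant under this
element up to a regular function. -/
theorem reg_slash_sub (hJ : IsMeromorphicCocycle p W J) {w : ℂ_[p]} (hw : w ∈ Hp p)
    {g : Matrix.SpecialLinearGroup (Fin 2) ℤ} (hg : mob (toQ g) w = w)
    (hpos : 0 < g 1 0 * g 0 1) :
    Reg (slash W (J (pt 0 1) (pt 1 0)) (toQ g) - J (pt 0 1) (pt 1 0)) w := by
  have hR := hJ.regSystem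
  have hform : ∀ x y : ℤ, fixForm g (g 0 0 * x + g 0 1 * y) (g 1 0 * x + g 1 1 * y) =
      fixForm g x y := fun x y ↦ by
    simpa using fixForm_conj g g x y
  have hcop : ∀ x y : ℤ, IsCoprime x y →
      IsCoprime (g 0 0 * x + g 0 1 * y) (g 1 0 * x + g 1 1 * y) := by
    rintro x y ⟨u, v, h⟩
    have hd := int_det g
    refine ⟨u * g 1 1 - v * g 1 0, v * g 0 0 - u * g 0 1, ?_⟩
    linear_combination h + (u * x + v * y) * hd
  have hb : g 0 1 ≠ 0 := by rintro h; simp [h] at hpos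
  have hc : g 1 0 ≠ 0 := by rintro h; simp [h] at hpos
  have c01 : IsCoprime (0 : ℤ) 1 := isCoprime_one_right
  have c10 : IsCoprime (1 : ℤ) 0 := isCoprime_one_left
  -- The fixed form is `g`-invariant, so it has equal signs at 0 and g0, and likewise at ∞ and g∞.
  -- Thus J{0,g0} and J{g∞,∞} are regular at `w`.
  have h1 := hR.reg_of_same_sign hw hg c01 (hcop _ _ c01) (by
    rw [hform]
    have : fixForm g 0 1 = -g 0 1 := by simp [fixForm]
    rw [this]
    exact mul_self_pos.2 (neg_ne_zero.2 hb))
  have h2 := hR.reg_of_same_sign hw hg (hcop _ _ c10) c10 (by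
    rw [hform]
    have : fixForm g 1 0 = g 1 0 := by simp [fixForm]
    rw [this]
    exact mul_self_pos.2 hc)
  rw [← actP1_pt g _ _ c01] at h1
  rw [← actP1_pt g _ _ c10] at h2
  set r := pt 0 1
  set s := pt 1 0
  set r' := actP1 (toQ g) r
  set s' := actP1 (toQ g) s
  have h3 : Reg (J r s - J r' s') w := by
    refine (h1.add h2).congr ?_
    filter_upwards [(hJ.add r r' s).eventuallyEq hw, (hJ.add r' s' s).eventuallyEq hw] with z e1 e2
    simp only [Pi.add_apply, Pi.sub_apply] at *
    linear_combination e1 + e2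
  have h4 : Reg (slash W (J r s - J r' s') (toQ g)) w := by
    refine Reg.slash W (toQ g) hw ?_
    rwa [hg]
  refine h4.congr ?_
  filter_upwards [(hJ.invariant _ (toQ_mem_ihara g) r s).eventuallyEq hw] with z hz
  rw [slash_apply] at hz
  rw [slash_apply, Pi.sub_apply, Pi.sub_apply, slash_apply, ← hz]
  ring

end IsMeromorphicCocycle

/-! ### The multiplier of a hyperbolic fixed point -/

/-- The automorphy factor ε satisfies ε² = tr·ε - 1. As tr ≥ 3, its powers are aε - b with integers
a > b ≥ 0, so a power equal to 1 would make ε, and with it `w`, rational. -/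
theorem aut_pow_ne_one {w : ℂ_[p]} (hw : w ∈ Hp p) {g : Matrix.SpecialLinearGroup (Fin 2) ℤ}
    (hg : mob (toQ g) w = w) (htr : 3 ≤ g 0 0 + g 1 1) (hc : g 1 0 ≠ 0) (n : ℕ) :
    aut (toQ g) w ^ (n + 1) ≠ 1 := by
  have hroot := fixForm_root hw hg
  have haut : aut (toQ g) w = g 1 0 * w + g 1 1 := by simp [aut, toQ_apply]
  set ε := aut (toQ g) w
  have hdet : (g 0 0 : ℂ_[p]) * g 1 1 - g 0 1 * g 1 0 = 1 := by exact_mod_cast int_det g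
  have hε : ε ^ 2 = (g 0 0 + g 1 1) * ε - 1 := by
    rw [haut]
    linear_combination (g 1 0 : ℂ_[p]) * hroot - hdet
  have key : ∀ n : ℕ, ∃ a b : ℤ, 0 ≤ b ∧ b < a ∧ ε ^ (n + 1) = a * ε - b := by
    intro n
    induction n with
    | zero => exact ⟨1, 0, le_rfl, one_pos, by simp⟩
    | succ n ih =>
      obtain ⟨a, b, hb, hab, h⟩ := ih
      refine ⟨a * (g 0 0 + g 1 1) - b, a, by omega, by nlinarith, ?_⟩
      rw [pow_succ, h]
      push_cast
      linear_combination (a : ℂ_[p]) * hε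
  intro h1
  obtain ⟨a, b, hb, hab, h⟩ := key n
  rw [h1, haut] at h
  have ha : (a : ℂ_[p]) ≠ 0 := by exact_mod_cast (show a ≠ 0 by omega)
  have hc' : (g 1 0 : ℂ_[p]) ≠ 0 := by exact_mod_cast hc
  refine Hp.ne_ratCast hw (((1 + b) / a - g 1 1) / g 1 0) ?_
  push_cast
  field_simp
  linear_combination -h

theorem exists_expansion {f : ℂ_[p] → ℂ_[p]} {w : ℂ_[p]} (hf : MeromorphicAt f w) (k : ℤ) :
    (∃ S, AnalyticAt ℂ_[p] S w ∧ ∀ᶠ z in 𝓝[≠] w, f z = (z - w) ^ k * S z) ∨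
      ∃ i < k, ∃ G, AnalyticAt ℂ_[p] G w ∧ G w ≠ 0 ∧ ∀ᶠ z in 𝓝[≠] w, f z = (z - w) ^ i * G z := by
  rcases h : meromorphicOrderAt f w with _ | i
  · left
    refine ⟨fun _ ↦ 0, analyticAt_const, ?_⟩
    filter_upwards [meromorphicOrderAt_eq_top_iff.1 h] with z hz
    rw [hz, mul_zero]
  · obtain ⟨G, hG, hG0, hfG⟩ := (meromorphicOrderAt_eq_int_iff hf).1 h
    rcases lt_or_ge i k with hik | hik
    · exact Or.inr ⟨i, hik, G, hG, hG0, hfG⟩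
    · left
      refine ⟨fun z ↦ (z - w) ^ (i - k).toNat * G z, by fun_prop, ?_⟩
      filter_upwards [hfG, self_mem_nhdsWithin] with z hz hzw
      have hne : z - w ≠ 0 := sub_ne_zero.2 hzw
      rw [hz, smul_eq_mul, ← mul_assoc, ← zpow_natCast, ← zpow_add₀ hne,
        Int.toNat_of_nonneg (by omega), add_sub_cancel]

/-- A function that is invariant to order `k` under a Möbius transformation fixing `w`, with
multiplier not a root of unity, is constant to order `k`. -/
theorem exists_const_of_invariant {w : ℂ_[p]} (hw : w ∈ Hp p)
    {γ : Matrix.SpecialLinearGroup (Fin 2) ℚ} (hγ : mob γ w = w)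
    (hroot : ∀ n : ℕ, aut γ w ^ (n + 1) ≠ 1) (k : ℤ) {F : ℂ_[p] → ℂ_[p]}
    (hF : MeromorphicAt F w) {R : ℂ_[p] → ℂ_[p]} (hR : AnalyticAt ℂ_[p] R w)
    (h : ∀ᶠ z in 𝓝[≠] w, F (mob γ z) - F z = (z - w) ^ k * R z) :
    ∃ b S, AnalyticAt ℂ_[p] S w ∧ ∀ᶠ z in 𝓝[≠] w, F z - b = (z - w) ^ k * S z := by
  have ha0 := aut_ne_zero_of_mem_Hp γ hw
  have htend : Tendsto (mob γ) (𝓝[≠] w) (𝓝[≠] w) := by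
    have := tendsto_mob γ hw
    rwa [hγ] at this
  -- With leading term of exponent i < k, comparing leading coefficients of F∘γ and F gives (cw +
  -- d)^(-2i) = 1, so i = 0.
  have step : ∀ F : ℂ_[p] → ℂ_[p],
      (∀ᶠ z in 𝓝[≠] w, F (mob γ z) - F z = (z - w) ^ k * R z) → ∀ i < k,
      ∀ G, AnalyticAt ℂ_[p] G w → G w ≠ 0 → (∀ᶠ z in 𝓝[≠] w, F z = (z - w) ^ i * G z) →
      i = 0 := by
    intro F h i hik G hG hG0 hFG
    by_contra hi
    set H : ℂ_[p] → ℂ_[p] := fun z ↦ (aut γ z * aut γ w) ^ (-i) * G (mob γ z) - G z with hH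
    have hHcont : Tendsto H (𝓝[≠] w) (𝓝 (H w)) := by
      have h1 : ContinuousAt (aut γ) w := (analyticAt_aut γ w).continuousAt
      have h2 : ContinuousAt (mob γ) w := (analyticAt_mob γ hw).continuousAt
      have h3 : ContinuousAt (fun z ↦ G (mob γ z)) w :=
        ContinuousAt.comp (by rw [hγ]; exact hG.continuousAt) h2
      have h4 : ContinuousAt (fun z ↦ (aut γ z * aut γ w) ^ (-i)) w :=
        (h1.mul continuousAt_const).zpow₀ _ (Or.inl (mul_ne_zero ha0 ha0))
      exact ((h4.mul h3).sub hG.continuousAt).tendsto.mono_left nhdsWithin_le_nhds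
    have hHeq : ∀ᶠ z in 𝓝[≠] w, H z = (z - w) ^ (k - i).toNat * R z := by
      filter_upwards [h, hFG, htend.eventually hFG, self_mem_nhdsWithin,
        mem_nhdsWithin_of_mem_nhds (isOpen_Hp.mem_nhds hw)] with z h1 h2 h3 hzw hz
      have hne : z - w ≠ 0 := sub_ne_zero.2 hzw
      have haz := aut_ne_zero_of_mem_Hp γ hz
      have hm : mob γ z - w = (z - w) / (aut γ z * aut γ w) := by
        conv_lhs => rw [← hγ]
        rw [mob_sub_mob γ haz ha0]
      rw [h2, h3, hm, div_zpow] at h1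
      have hpi : (z - w) ^ i ≠ 0 := zpow_ne_zero _ hne
      refine mul_left_cancel₀ hpi ?_
      have e : (z - w) ^ i * ((z - w) ^ (k - i).toNat * R z) = (z - w) ^ k * R z := by
        rw [← mul_assoc, ← zpow_natCast, ← zpow_add₀ hne, Int.toNat_of_nonneg (by omega),
          add_sub_cancel]
      rw [e, ← h1, hH]
      simp only [zpow_neg]
      ring
    have hRcont : Tendsto (fun z ↦ (z - w) ^ (k - i).toNat * R z) (𝓝[≠] w) (𝓝 0) := by
      have : ContinuousAt (fun z ↦ (z - w) ^ (k - i).toNat * R z) w :=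
        ((continuousAt_id.sub continuousAt_const).pow _).mul hR.continuousAt
      have h0 := this.tendsto.mono_left (nhdsWithin_le_nhds (s := {w}ᶜ))
      rwa [sub_self, zero_pow (by omega), zero_mul] at h0
    have hH0 : H w = 0 := tendsto_nhds_unique (hHcont.congr' hHeq) hRcont
    simp only [hH, hγ] at hH0
    have h1 : (aut γ w * aut γ w) ^ (-i) = 1 := by
      refine mul_right_cancel₀ hG0 ?_
      linear_combination hH0
    have h2 : (aut γ w * aut γ w) ^ i.natAbs = 1 := by
      rw [zpow_neg, inv_eq_one] at h1
      rcases Int.natAbs_eq i with he | he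
      · rw [← zpow_natCast, ← he, h1]
      · rw [← zpow_natCast, show (i.natAbs : ℤ) = -i by omega, zpow_neg, h1, inv_one]
    rw [← pow_two, ← pow_mul] at h2
    refine hroot (2 * i.natAbs - 1) ?_
    rwa [Nat.sub_add_cancel (by omega)]
  rcases exists_expansion hF k with ⟨S, hS, hFS⟩ | ⟨i, hik, G, hG, hG0, hFG⟩
  · exact ⟨0, S, hS, by simpa using hFS⟩
  obtain rfl := step F h i hik G hG hG0 hFG
  refine ⟨G w, ?_⟩
  -- Removing the constant term keeps the invariance, so a remaining leading exponent below `k`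
  -- would again be 0; but the difference now tends to 0.
  have hF' : MeromorphicAt (fun z ↦ F z - G w) w := hF.sub (MeromorphicAt.const _ _)
  rcases exists_expansion hF' k with h' | ⟨j, hjk, G', hG', hG0', hFG'⟩
  · exact h'
  exfalso
  obtain rfl := step (fun z ↦ F z - G w) (by simpa using h) j hjk G' hG' hG0' hFG'
  have h1 : Tendsto (fun z ↦ F z - G w) (𝓝[≠] w) (𝓝 (G' w)) := by
    refine (hG'.continuousAt.tendsto.mono_left nhdsWithin_le_nhds).congr' ?_
    filter_upwards [hFG'] with z hz
    rw [hz, zpow_zero, one_mul]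
  have h2 : Tendsto (fun z ↦ F z - G w) (𝓝[≠] w) (𝓝 (G w - G w)) := by
    refine ((hG.continuousAt.tendsto.mono_left nhdsWithin_le_nhds).sub_const _).congr' ?_
    filter_upwards [hFG] with z hz
    rw [hz, zpow_zero, one_mul]
  rw [sub_self] at h2
  exact hG0' (tendsto_nhds_unique h1 h2)

/-- The principal part at a fixed point of a hyperbolic element of a function that is invariant
under this element up to a regular function. -/
theorem exists_reg_sub_hker {w w' : ℂ_[p]} (hw : w ∈ Hp p) (hw' : w' ∈ Hp p) (hne : w ≠ w')
    {γ : Matrix.SpecialLinearGroup (Fin 2) ℚ} (hγ : mob γ w = w) (hγ' : mob γ w' = w')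
    (hroot : ∀ n : ℕ, aut γ w ^ (n + 1) ≠ 1) (k : ℕ) {f : ℂ_[p] → ℂ_[p]}
    (hf : MeromorphicAt f w) (hinv : Reg (slash (2 * k) f γ - f) w) :
    ∃ b, Reg (fun z ↦ f z - b * hker w w' z ^ k) w := by
  obtain ⟨R, hR, hfR⟩ := hinv
  have hd : w - w' ≠ 0 := sub_ne_zero.2 hne
  set q : ℂ_[p] → ℂ_[p] := fun z ↦ ((z - w') / (w - w')) ^ k with hq
  have hqa : AnalyticAt ℂ_[p] q w :=
    ((analyticAt_id.sub analyticAt_const).div_const).pow k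
  have hker_eq : ∀ z, z ≠ w → z ≠ w' → (hker w w' z ^ k)⁻¹ = (z - w) ^ k * q z := by
    intro z h1 h2
    rw [hker, hq, ← inv_pow, inv_div, ← mul_pow, mul_div_assoc]
  have hker_ne : ∀ z, z ≠ w → z ≠ w' → hker w w' z ^ k ≠ 0 := by
    intro z h1 h2
    exact pow_ne_zero _ (div_ne_zero hd (mul_ne_zero (sub_ne_zero.2 h1) (sub_ne_zero.2 h2)))
  have hev : ∀ᶠ z in 𝓝[≠] w, z ≠ w' :=
    mem_nhdsWithin_of_mem_nhds (isOpen_ne.mem_nhds hne)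
  -- Off `w` and `w'` this is f / h^k for the kernel h. Since h^k has weight 2k, F∘γ - F is h^(-k)
  -- times the regular function f|γ - f, so it vanishes to order `k`.
  set F : ℂ_[p] → ℂ_[p] := fun z ↦ f z * ((z - w) ^ k * q z) with hFdef
  have hF : MeromorphicAt F w := hf.mul
    (((analyticAt_id.sub analyticAt_const).pow k).mul hqa).meromorphicAt
  have htend := tendsto_mob γ hw
  rw [hγ] at htend
  obtain ⟨b, S, hS, hFS⟩ := exists_const_of_invariant hw hγ hroot k hF (hR.mul hqa) (by
    filter_upwards [hfR, hev, self_mem_nhdsWithin, htend.eventually hev,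
      htend.eventually self_mem_nhdsWithin,
      mem_nhdsWithin_of_mem_nhds (isOpen_Hp.mem_nhds hw)] with z h1 h2 h3 h4 h5 hz
    have h6 : hker w w' (mob γ z) = aut γ z ^ 2 * hker w w' z := by
      conv_lhs => rw [← hγ, ← hγ']
      exact hker_mob γ hw hw' hz
    have ha := aut_ne_zero_of_mem_Hp γ hz
    simp only [hFdef]
    rw [← hker_eq _ h3 h2, ← hker_eq _ h5 h4, h6, mul_pow, ← pow_mul]
    rw [Pi.sub_apply, slash_apply] at h1
    rw [zpow_natCast, Pi.mul_apply, ← h1, mul_inv]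
    have := hker_eq z h3 h2
    linear_combination ((aut γ z ^ (2 * k))⁻¹ * f (mob γ z) - f z) * this)
  refine ⟨b, fun z ↦ ((w - w') / (z - w')) ^ k * S z, ?_, ?_⟩
  · exact ((analyticAt_const.div (analyticAt_id.sub analyticAt_const) hd).pow k).mul hS
  · filter_upwards [hFS, hev, self_mem_nhdsWithin] with z h1 h2 h3
    have h4 := hker_eq z h3 h2
    have h5 := hker_ne z h3 h2
    have h6 : f z - b * hker w w' z ^ k = hker w w' z ^ k * (F z - b) := by
      simp only [hFdef]
      rw [← h4]
      field_simp
    rw [h6, h1, zpow_natCast, ← mul_assoc]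
    congr 1
    have h7 : z - w ≠ 0 := sub_ne_zero.2 h3
    have h8 : z - w' ≠ 0 := sub_ne_zero.2 h2
    rw [hker, ← mul_pow]
    congr 1
    field_simp

/-! ### Residues -/

namespace HasResidueAt

variable {f g : ℂ_[p] → ℂ_[p]} {w r s : ℂ_[p]}

theorem congr (h : HasResidueAt f w r) (hfg : f =ᶠ[𝓝[≠] w] g) : HasResidueAt g w r := by
  obtain ⟨P, u, hu, h1, h2⟩ := h
  refine ⟨P, u, hu, ?_, h2⟩
  filter_upwards [h1, hfg] with z e1 e2
  rw [← e2, e1]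

theorem const_mul (c : ℂ_[p]) (h : HasResidueAt f w r) :
    HasResidueAt (fun z ↦ c * f z) w (c * r) := by
  obtain ⟨P, u, hu, h1, h2⟩ := h
  refine ⟨C c * P, fun z ↦ c * u z, analyticAt_const.mul hu, ?_, by rw [coeff_C_mul, h2]⟩
  filter_upwards [h1] with z e
  rw [e, eval_mul, eval_C]
  ring

theorem add_reg (h : HasResidueAt f w r) (hg : Reg g w) : HasResidueAt (f + g) w r := by
  obtain ⟨P, u, hu, h1, h2⟩ := h
  obtain ⟨v, hv, h3⟩ := hg
  refine ⟨P, u + v, hu.add hv, ?_, h2⟩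
  filter_upwards [h1, h3] with z e1 e2
  rw [Pi.add_apply, Pi.add_apply, e1, e2, add_assoc]

/-- The difference of the two polynomials, taken at 1/(z - w), stays bounded near `w`, so it is
constant and has no linear coefficient. -/
theorem unique (h : HasResidueAt f w r) (h' : HasResidueAt f w s) : r = s := by
  obtain ⟨P, u, hu, h1, h2⟩ := h
  obtain ⟨Q, v, hv, h3, h4⟩ := h'
  rw [← h2, ← h4, ← sub_eq_zero, ← coeff_sub]
  by_contra hne
  have hdeg : 0 < (P - Q).degree := by
    by_contra hle
    refine hne ?_
    rw [eq_C_of_degree_le_zero (not_lt.1 hle), coeff_C_of_ne_zero one_ne_zero]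
  have hinv : Tendsto (fun z : ℂ_[p] ↦ ‖(z - w)⁻¹‖) (𝓝[≠] w) atTop := by
    refine tendsto_norm_inv_nhdsNE_zero_atTop.comp ?_
    refine tendsto_nhdsWithin_iff.2 ⟨?_, ?_⟩
    · have : ContinuousAt (fun z : ℂ_[p] ↦ z - w) w := by fun_prop
      have h0 := this.tendsto.mono_left (nhdsWithin_le_nhds (s := {w}ᶜ))
      rwa [sub_self] at h0
    · filter_upwards [self_mem_nhdsWithin] with z hz
      exact sub_ne_zero.2 hz
  have h5 := (P - Q).tendsto_norm_atTop hdeg hinv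
  have h6 : Tendsto (fun z ↦ ‖v z - u z‖) (𝓝[≠] w) (𝓝 ‖v w - u w‖) :=
    ((hv.continuousAt.sub hu.continuousAt).norm).tendsto.mono_left nhdsWithin_le_nhds
  refine not_tendsto_nhds_of_tendsto_atTop h5 _ (h6.congr' ?_)
  filter_upwards [h1, h3] with z e1 e2
  rw [eval_sub]
  congr 1
  linear_combination e1 - e2

end HasResidueAt

/-- A polynomial approximation of `(1 - X) ^ (-k)`. -/
theorem exists_inv_one_sub_pow (k : ℕ) (hk : 0 < k) : ∃ T S : ℂ_[p][X],
    T * (1 - X) ^ k = 1 + X ^ k * S ∧ T.coeff (k - 1) ≠ 0 ∧ T.natDegree < k := by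
  set F : PowerSeries ℂ_[p] := ↑(PowerSeries.invOneSubPow ℂ_[p] k) with hF
  set T := PowerSeries.trunc k F with hT
  have h1 : F * (1 - PowerSeries.X) ^ k = 1 := by
    rw [← PowerSeries.invOneSubPow_inv_eq_one_sub_pow]
    exact (PowerSeries.invOneSubPow ℂ_[p] k).mul_inv
  have h2 : X ^ k ∣ T * (1 - X) ^ k - 1 := by
    rw [X_pow_dvd_iff]
    intro d hd
    have h3 := congrArg (fun P : ℂ_[p][X] ↦ P.coeff d)
      (PowerSeries.trunc_trunc_mul (n := k) F ((1 - PowerSeries.X) ^ k))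
    simp only [h1, PowerSeries.coeff_trunc, if_pos hd] at h3
    have h4 : ((T * (1 - X) ^ k : ℂ_[p][X]) : PowerSeries ℂ_[p]) =
        (T : PowerSeries ℂ_[p]) * (1 - PowerSeries.X) ^ k := by simp
    rw [← h4, Polynomial.coeff_coe] at h3
    rw [coeff_sub, h3, PowerSeries.coeff_one, coeff_one, sub_self]
  obtain ⟨S, hS⟩ := h2
  refine ⟨T, S, by rw [← hS]; ring, ?_, ?_⟩
  swap
  · obtain ⟨m, rfl⟩ := Nat.exists_eq_succ_of_ne_zero hk.ne'
    exact PowerSeries.natDegree_trunc_lt _ _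
  -- The top coefficient of the truncation is the binomial coefficient of 2k - 2 over k - 1.
  rw [hT, PowerSeries.coeff_trunc, if_pos (by omega), hF,
    PowerSeries.invOneSubPow_val_eq_mk_sub_one_add_choose_of_pos _ _ hk, PowerSeries.coeff_mk]
  exact_mod_cast (Nat.choose_pos (by omega)).ne'

/-- The residues of the powers of `hker`. -/
theorem exists_hasResidueAt_hker_pow (k : ℕ) (hk : 0 < k) : ∃ c : ℂ_[p], c ≠ 0 ∧
    ∀ w w' : ℂ_[p], w ≠ w' →
      HasResidueAt (fun z ↦ hker w w' z ^ k) w (c * (-1 / (w - w')) ^ (k - 1)) := by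
  obtain ⟨T, S, hTS, hT, hdeg⟩ := exists_inv_one_sub_pow (p := p) k hk
  refine ⟨T.coeff (k - 1), hT, fun w w' hne ↦ ?_⟩
  have hd : w - w' ≠ 0 := sub_ne_zero.2 hne
  -- With x = z - w the kernel is x⁻¹(1 - ηx)⁻¹. The principal part of its `k`-th power is x^(-k)
  -- T(ηx), in which x⁻¹ has coefficient T_(k-1) η^(k-1).
  set η := -1 / (w - w') with hη
  have hden : ∀ z, 1 - η * (z - w) = (z - w') / (w - w') := by
    intro z
    rw [hη]
    field_simp
    ring
  refine ⟨∑ j ∈ Finset.range k, C (T.coeff j * η ^ j) * X ^ (k - j),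
    fun z ↦ -(η ^ k * S.eval (η * (z - w)) * (((z - w') / (w - w')) ^ k)⁻¹), ?_, ?_, ?_⟩
  · have h1 : AnalyticAt ℂ_[p] (fun z ↦ S.eval (η * (z - w))) w :=
      (AnalyticOnNhd.eval_polynomial (𝕜 := ℂ_[p]) S (η * (w - w)) (Set.mem_univ _)).fun_comp
        (f := fun z ↦ η * (z - w)) (by fun_prop)
    refine ((analyticAt_const.mul h1).mul (AnalyticAt.inv ?_ ?_)).neg
    · exact ((analyticAt_id.sub analyticAt_const).div_const).pow k
    · exact pow_ne_zero _ (div_ne_zero hd hd)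
  · filter_upwards [self_mem_nhdsWithin,
      mem_nhdsWithin_of_mem_nhds (isOpen_ne.mem_nhds hne)] with z h1 h2
    have hx : z - w ≠ 0 := sub_ne_zero.2 h1
    have hx' : z - w' ≠ 0 := sub_ne_zero.2 h2
    have e1 : (∑ j ∈ Finset.range k, C (T.coeff j * η ^ j) * X ^ (k - j)).eval (z - w)⁻¹ =
        ((z - w) ^ k)⁻¹ * T.eval (η * (z - w)) := by
      rw [eval_eq_sum_range' hdeg, eval_finsetSum, Finset.mul_sum]
      refine Finset.sum_congr rfl fun j hj ↦ ?_
      have hj' : (z - w) ^ k = (z - w) ^ (k - j) * (z - w) ^ j := by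
        rw [← pow_add, Nat.sub_add_cancel (Finset.mem_range.1 hj).le]
      rw [eval_mul, eval_C, eval_pow, eval_X, hj', inv_pow, mul_pow]
      field_simp
    have e2 := congrArg (eval (η * (z - w))) hTS
    simp only [eval_mul, eval_add, eval_pow, eval_sub, eval_one, eval_X, hden] at e2
    have hq : ((z - w') / (w - w')) ^ k ≠ 0 := pow_ne_zero _ (div_ne_zero hx' hd)
    have e3 : hker w w' z ^ k = ((z - w) ^ k)⁻¹ * (((z - w') / (w - w')) ^ k)⁻¹ := by
      rw [← mul_inv, ← mul_pow, ← inv_pow, hker]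
      congr 1
      field_simp
    have e4 : T.eval (η * (z - w)) = (1 + (η * (z - w)) ^ k * S.eval (η * (z - w))) *
        (((z - w') / (w - w')) ^ k)⁻¹ := by
      rw [← e2, mul_inv_cancel_right₀ hq]
    rw [e1, e3, e4, mul_pow]
    have hxk : (z - w) ^ k ≠ 0 := pow_ne_zero _ hx
    generalize (((z - w') / (w - w')) ^ k)⁻¹ = u
    field_simp
    ring
  · rw [finsetSum_coeff, Finset.sum_eq_single (k - 1)]
    · rw [coeff_C_mul_X_pow, if_pos (by omega)]
    · intro j hj hjk
      rw [coeff_C_mul_X_pow, if_neg]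
      have := Finset.mem_range.1 hj
      omega
    · intro h
      exact absurd (Finset.mem_range.2 (by omega)) h

/-! ### Principal parts at RM points -/

/-- At each RM point `ω` and at its conjugate, the principal part of `f` is one and the same
multiple of the principal part of the `k`-th power of `hker ω ω'`. -/
def Balanced (k : ℕ) (f : ℂ_[p] → ℂ_[p]) : Prop :=
  ∀ ω : ℂ_[p], IsRM ω → ∃ b : ℂ_[p], Reg (fun z ↦ f z - b * hker ω (galConj ω) z ^ k) ω ∧
    Reg (fun z ↦ f z - b * hker ω (galConj ω) z ^ k) (galConj ω)

theorem Balanced.sub_const_mul {k : ℕ} {f g : ℂ_[p] → ℂ_[p]} (hf : Balanced k f)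
    (hg : Balanced k g) (c : ℂ_[p]) : Balanced k fun z ↦ f z - c * g z := by
  intro ω hω
  obtain ⟨a, h1, h2⟩ := hf ω hω
  obtain ⟨b, h3, h4⟩ := hg ω hω
  refine ⟨a - c * b, (h1.sub (h3.const_mul c)).congr (.of_forall fun z ↦ ?_),
    (h2.sub (h4.const_mul c)).congr (.of_forall fun z ↦ ?_)⟩ <;>
  · simp only [Pi.sub_apply]
    ring

theorem IsRM.galConj_galConj {ω : ℂ_[p]} (h : IsRM ω) :
    RigidCocycle.galConj (RigidCocycle.galConj ω) = ω := (galConj_props h.natDegree).2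

theorem IsRM.galConj_ne {ω : ℂ_[p]} (h : IsRM ω) : RigidCocycle.galConj ω ≠ ω :=
  RigidCocycle.galConj_ne h.natDegree

theorem not_reg_iff_isPole {f : ℂ_[p] → ℂ_[p]} {w : ℂ_[p]} (hf : MeromorphicAt f w) :
    ¬Reg f w ↔ IsPole f w := by
  refine ⟨fun h ↦ ?_, fun h h' ↦ h'.not_isPole h⟩
  by_contra h0
  exact h (reg_of_meromorphicOrderAt_nonneg hf (not_lt.1 h0))

theorem mob_galConj_of_mob {w : ℂ_[p]} (hw : IsRM w)
    {γ : Matrix.SpecialLinearGroup (Fin 2) ℚ} (h : mob γ w = w) :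
    mob γ (galConj w) = galConj w := by
  rw [← (galConj_mob γ hw.natDegree).2, h]

namespace IsMeromorphicCocycle

variable {k : ℕ} {J : OnePoint ℚ → OnePoint ℚ → ℂ_[p] → ℂ_[p]}

theorem exists_reg_sub_hker (hJ : IsMeromorphicCocycle p (2 * k) J) {w : ℂ_[p]} (hw : w ∈ Hp p)
    (h : ¬Reg (J (pt 0 1) (pt 1 0)) w) :
    ∃ b, Reg (fun z ↦ J (pt 0 1) (pt 1 0) z - b * hker w (galConj w) z ^ k) w := by
  obtain ⟨g, hg, htr, hpos⟩ := hJ.regSystem.exists_fix hw h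
  have hRM := isRM_of_fix hw hg hpos
  have hc : g 1 0 ≠ 0 := by rintro h; simp [h] at hpos
  exact RigidCocycle.exists_reg_sub_hker hw (galConj_mem_Hp hw) hRM.galConj_ne.symm hg
    (mob_galConj_of_mob hRM hg) (aut_pow_ne_one hw hg htr hc) k
    ((hJ.meromorphic _ _).meromorphicAt hw) (hJ.reg_slash_sub hw hg hpos)

/-- At ω and ω' the principal parts are those of b h^k and -b' h^k. For odd `k`, h^k is odd under
exchanging ω and ω' while η^(k-1) is even, so its residues there are ρ and -ρ with ρ ≠ 0; opposite
residues of `f` then give b = -b'. -/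
theorem balanced_of_residues (hJ : IsMeromorphicCocycle p (2 * k) J) (hk : Odd k)
    (hpole : ∀ τ : ℂ_[p], IsRM τ → IsPole (J (pt 0 1) (pt 1 0)) τ →
      IsPole (J (pt 0 1) (pt 1 0)) (galConj τ) ∧
      ∃ r : ℂ_[p], HasResidueAt (J (pt 0 1) (pt 1 0)) τ r ∧
        HasResidueAt (J (pt 0 1) (pt 1 0)) (galConj τ) (-r)) :
    Balanced k (J (pt 0 1) (pt 1 0)) := by
  set f := J (pt 0 1) (pt 1 0) with hf
  have hmer : ∀ w ∈ Hp p, MeromorphicAt f w := fun w hw ↦ (hJ.meromorphic _ _).meromorphicAt hw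
  obtain ⟨c, hc, hres⟩ := exists_hasResidueAt_hker_pow (p := p) k hk.pos
  have hkeven : Even (k - 1) := by
    obtain ⟨m, rfl⟩ := hk
    exact ⟨m, by omega⟩
  intro ω hω
  have hω' := hω.galConj
  have hd : ω - galConj ω ≠ 0 := sub_ne_zero.2 hω.galConj_ne.symm
  have hadd : ∀ (w b : ℂ_[p]) (r : ℂ_[p]), Reg (fun z ↦ f z - b * hker ω (galConj ω) z ^ k) w →
      HasResidueAt (fun z ↦ hker ω (galConj ω) z ^ k) w r → HasResidueAt f w (b * r) := by
    intro w b r h1 h2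
    refine ((h2.const_mul b).add_reg h1).congr (.of_forall fun z ↦ ?_)
    simp only [Pi.add_apply]
    ring
  by_cases h : IsPole f ω ∨ IsPole f (galConj ω)
  · have hboth : IsPole f ω ∧ IsPole f (galConj ω) := by
      rcases h with h | h
      · exact ⟨h, (hpole ω hω h).1⟩
      · have := (hpole _ hω' h).1
        rw [hω.galConj_galConj] at this
        exact ⟨this, h⟩
    obtain ⟨-, r, hr, hr'⟩ := hpole ω hω hboth.1
    obtain ⟨b, hb⟩ := hJ.exists_reg_sub_hker hω.1
      ((not_reg_iff_isPole (hmer _ hω.1)).2 hboth.1)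
    obtain ⟨b', hb'⟩ := hJ.exists_reg_sub_hker hω'.1
      ((not_reg_iff_isPole (hmer _ hω'.1)).2 hboth.2)
    rw [hω.galConj_galConj] at hb'
    have hswap : ∀ z, hker (galConj ω) ω z ^ k = -hker ω (galConj ω) z ^ k := by
      intro z
      rw [hker_swap, hk.neg_pow]
    have hb2 : Reg (fun z ↦ f z - (-b') * hker ω (galConj ω) z ^ k) (galConj ω) := by
      refine hb'.congr (.of_forall fun z ↦ ?_)
      simp only [hswap]
      ring
    have e1 := (hadd _ _ _ hb (hres ω (galConj ω) hω.galConj_ne.symm)).unique hr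
    have h2 := (hres (galConj ω) ω hω.galConj_ne).const_mul (-1)
    have h3 : HasResidueAt (fun z ↦ hker ω (galConj ω) z ^ k) (galConj ω)
        (-(c * (-1 / (ω - galConj ω)) ^ (k - 1))) := by
      have : -1 / (galConj ω - ω) = -(-1 / (ω - galConj ω)) := by
        rw [← neg_sub ω, div_neg]
      rw [this, hkeven.neg_pow, neg_one_mul] at h2
      refine h2.congr (.of_forall fun z ↦ ?_)
      simp only [hswap]
      ring
    have e2 := (hadd _ _ _ hb2 h3).unique hr'
    have hρ : c * (-1 / (ω - galConj ω)) ^ (k - 1) ≠ 0 :=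
      mul_ne_zero hc (pow_ne_zero _ (div_ne_zero (by simp) hd))
    have hbb : b = -b' := by
      refine mul_right_cancel₀ hρ ?_
      linear_combination e1 + e2
    exact ⟨b, hb, by rw [hbb]; exact hb2⟩
  · push Not at h
    have h1 := not_not.1 (mt (not_reg_iff_isPole (hmer _ hω.1)).1 h.1)
    have h2 := not_not.1 (mt (not_reg_iff_isPole (hmer _ hω'.1)).1 h.2)
    exact ⟨0, by simpa using h1, by simpa using h2⟩

/-- The difference of a cocycle and a multiple of another one. -/
theorem sub_const_mul {W : ℕ} {J J' : OnePoint ℚ → OnePoint ℚ → ℂ_[p] → ℂ_[p]}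
    (hJ : IsMeromorphicCocycle p W J) (hJ' : IsMeromorphicCocycle p W J') (c : ℂ_[p]) :
    IsMeromorphicCocycle p W fun r s z ↦ J r s z - c * J' r s z where
  meromorphic r s n := by
    obtain ⟨q, hq, g, hg, hfin⟩ := (show IsMeromorphicOnAffinoid p n (J r s) from
      hJ.meromorphic r s n).add
      ((show IsMeromorphicOnAffinoid p n (J' r s) from hJ'.meromorphic r s n).const_mul (-c))
    refine ⟨q, hq, g, hg, ?_⟩
    simpa only [neg_mul, ← sub_eq_add_neg] using hfin
  antisymm r s n := by
    refine ((hJ.antisymm r s n).union (hJ'.antisymm r s n)).subset ?_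
    rintro z ⟨hz, h⟩
    by_contra hcon
    simp only [Set.mem_union, Set.mem_ofPred_eq, not_or, not_and, not_not, Pi.neg_apply] at hcon h
    refine h ?_
    rw [hcon.1 hz, hcon.2 hz]
    ring
  add r s t n := by
    refine ((hJ.add r s t n).union (hJ'.add r s t n)).subset ?_
    rintro z ⟨hz, h⟩
    by_contra hcon
    simp only [Set.mem_union, Set.mem_ofPred_eq, not_or, not_and, not_not, Pi.add_apply] at hcon h
    refine h ?_
    rw [← hcon.1 hz, ← hcon.2 hz]
    ring
  invariant γ hγ r s n := by
    refine ((hJ.invariant γ hγ r s n).union (hJ'.invariant γ hγ r s n)).subset ?_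
    rintro z ⟨hz, h⟩
    by_contra hcon
    simp only [Set.mem_union, Set.mem_ofPred_eq, not_or, not_and, not_not, slash_apply] at hcon h
    refine h ?_
    rw [← hcon.1 hz, ← hcon.2 hz]
    ring

end IsMeromorphicCocycle

/-- If the value at `{0, ∞}` is regular at a hyperbolic fixed point, then so are all values. -/
theorem RegSystem.reg_of_fix {R : OnePoint ℚ → OnePoint ℚ → ℂ_[p] → Prop} (hR : RegSystem R)
    {w : ℂ_[p]} (hw : w ∈ Hp p) {g : Matrix.SpecialLinearGroup (Fin 2) ℤ}
    (hg : mob (toQ g) w = w) (hpos : 0 < g 1 0 * g 0 1) (h : R (pt 0 1) (pt 1 0) w)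
    (r s : OnePoint ℚ) : R r s w := by
  have hroot := fixForm_root hw hg
  have hb : g 0 1 ≠ 0 := by rintro h; simp [h] at hpos
  have hc : g 1 0 ≠ 0 := by rintro h; simp [h] at hpos
  have hc' : (g 1 0 : ℂ_[p]) ≠ 0 := by exact_mod_cast hc
  -- The fixed form has the irrational root `w`, hence no rational one. Every cusp thus lies on the
  -- side of 0 or on that of ∞, and regularity along each side and across {0, ∞} connects all cusps.
  have hne : ∀ x y : ℤ, IsCoprime x y → fixForm g x y ≠ 0 := by
    intro x y hxy h0
    have h1 : (g 1 0 : ℂ_[p]) * x ^ 2 + (g 1 1 - g 0 0) * x * y - g 0 1 * y ^ 2 = 0 := by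
      exact_mod_cast congrArg (Int.cast : ℤ → ℂ_[p]) h0
    have hy : y ≠ 0 := by
      rintro rfl
      have hx : x ≠ 0 := by
        rintro rfl
        exact not_isCoprime_zero_zero hxy
      simp [fixForm, hc, hx] at h0
    have hy' : (y : ℂ_[p]) ≠ 0 := by exact_mod_cast hy
    have h2 : ((y : ℂ_[p]) * w - x) * (g 1 0 * (y * w + x) + (g 1 1 - g 0 0) * y) = 0 := by
      linear_combination (y : ℂ_[p]) ^ 2 * hroot - h1
    rcases mul_eq_zero.1 h2 with h3 | h3
    · refine Hp.ne_ratCast hw (x / y) ?_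
      push_cast
      field_simp
      linear_combination h3
    · refine Hp.ne_ratCast hw (-((g 1 0 * x + (g 1 1 - g 0 0) * y) / (g 1 0 * y))) ?_
      push_cast
      field_simp
      linear_combination h3
  have c01 : IsCoprime (0 : ℤ) 1 := isCoprime_one_right
  have c10 : IsCoprime (1 : ℤ) 0 := isCoprime_one_left
  have e01 : fixForm g 0 1 = -g 0 1 := by simp [fixForm]
  have e10 : fixForm g 1 0 = g 1 0 := by simp [fixForm]
  have h0 : ∀ r, R r (pt 0 1) w := by
    intro r
    obtain ⟨x, y, hxy, rfl⟩ := exists_pt r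
    rcases lt_or_gt_of_ne (mul_ne_zero (hne x y hxy) (hne 0 1 c01)) with hlt | hgt
    · refine hR.trans w hw _ _ _ (hR.reg_of_same_sign hw hg hxy c10 ?_) (hR.symm w hw _ _ h)
      rw [e01] at hlt
      rw [e10]
      have : 0 < (fixForm g x y * g 1 0) * g 0 1 ^ 2 := by nlinarith
      exact pos_of_mul_pos_left this (sq_nonneg _)
    · exact hR.reg_of_same_sign hw hg hxy c01 hgt
  exact hR.trans w hw _ _ _ (h0 r) (hR.symm w hw _ _ (h0 s))

section

variable {τ : ℂ_[p]} (hτ : IsRM τ) (ι : fieldOf τ →ₐ[ℚ] ℝ)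

include hτ

/-! ### Principal parts of the orbit cocycles. -/

/-- The principal parts of the cocycle of an orbit at an RM point and its conjugate. -/
theorem exists_principal_orbCocycle {k : ℕ} (hk : k ≠ 0) {ω : ℂ_[p]} (hω : IsRM ω) :
    ∃ S : Finset (fieldOf τ), (∀ η, η ∈ S ↔ η ∈ orb τ ∧ ((η : ℂ_[p]) = ω ∨ (η : ℂ_[p]) = galConj ω)) ∧
      ∀ r s, ∀ w, w = ω ∨ w = galConj ω →
        Reg (fun z ↦ orbCocycle k τ ι r s z - ∑ η ∈ S, term k ι r s z η) w := by
  have hfin : {η : fieldOf τ | η ∈ orb τ ∧ ((η : ℂ_[p]) = ω ∨ (η : ℂ_[p]) = galConj ω)}.Finite := by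
    refine Set.Finite.of_finite_image (f := fun η : fieldOf τ ↦ (η : ℂ_[p]))
      ((Set.toFinite {ω, galConj ω}).subset ?_) (Subtype.val_injective.injOn)
    rintro _ ⟨η, hη, rfl⟩
    exact hη.2
  refine ⟨hfin.toFinset, fun η ↦ hfin.mem_toFinset, fun r s w hw ↦ ?_⟩
  have hw' : w ∈ Hp p := by
    rcases hw with rfl | rfl
    exacts [hω.1, hω.galConj.1]
  refine reg_orbCocycle_sub hτ ι hk r s hw' _ (fun η hη h ↦ ?_) fun η hη ↦ by
    simp only [Set.Finite.mem_toFinset] at hη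
    exact hη.1
  rw [Set.Finite.mem_toFinset]
  refine ⟨hη, ?_⟩
  have hinv : galConj (galConj (η : ℂ_[p])) = η :=
    (galConj_props (map_galConj (emb τ) (natDegree_of_mem_orb hτ hη)).1).2
  rw [← coe_galConj hτ hη] at h
  rcases h with h | h
  · rw [← h]; exact hw
  · rw [← hinv, ← h]
    rcases hw with rfl | rfl
    · exact Or.inr rfl
    · exact Or.inl hω.galConj_galConj

/-- Only the terms of index ω or ω' are singular at these points, and each is a multiple of the same
h^k up to the sign (-1)^k. Hence balance persists when orbit cocycles are subtracted. -/
theorem balanced_orbCocycle {k : ℕ} (hk : k ≠ 0) (r s : OnePoint ℚ) :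
    Balanced k (orbCocycle k τ ι r s) := by
  intro ω hω
  obtain ⟨S, hS, h⟩ := exists_principal_orbCocycle hτ ι hk hω
  have hterm : ∀ η ∈ S, ∃ b, ∀ z, term k ι r s z η = b * hker ω (galConj ω) z ^ k := by
    intro η hη
    obtain ⟨ho, hη⟩ := (hS η).1 hη
    rcases hη with hη | hη
    · refine ⟨chi ι r s η, fun z ↦ ?_⟩
      rw [term, ← coe_galConj hτ ho, hη]
    · refine ⟨chi ι r s η * (-1) ^ k, fun z ↦ ?_⟩
      rw [term, ← coe_galConj hτ ho, hη, hω.galConj_galConj, hker_swap, neg_pow]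
      ring
  choose! b hb using hterm
  have hsum : ∀ z, ∑ η ∈ S, term k ι r s z η = (∑ η ∈ S, b η) * hker ω (galConj ω) z ^ k := by
    intro z
    rw [Finset.sum_mul]
    exact Finset.sum_congr rfl fun η hη ↦ hb η hη z
  have h' := h r s
  simp only [hsum] at h'
  exact ⟨_, h' ω (Or.inl rfl), h' _ (Or.inr rfl)⟩

/-- The principal part of the cocycle of the orbit of `τ` at `τ` and at its conjugate. -/
theorem exists_principal_self {k : ℕ} (hk : Odd k) : ∃ e : ℂ_[p], e ≠ 0 ∧
    ∀ r s, ∀ w, w = τ ∨ w = galConj τ → Reg (fun z ↦ orbCocycle k τ ι r s z -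
      e * chi ι r s (IntermediateField.AdjoinSimple.gen ℚ τ) * hker τ (galConj τ) z ^ k) w := by
  obtain ⟨S, hS, h⟩ := exists_principal_orbCocycle hτ ι hk.pos.ne' hτ
  set t := IntermediateField.AdjoinSimple.gen ℚ τ with ht
  have hto := gen_mem_orb τ
  have htS : t ∈ S := (hS t).2 ⟨hto, Or.inl rfl⟩
  have hconj : galConj τ = ((galConj t : fieldOf τ) : ℂ_[p]) := by
    have := coe_galConj hτ hto
    rwa [IntermediateField.AdjoinSimple.coe_gen] at this
  have hterm : ∀ r s, ∀ η ∈ S, ∀ z, term k ι r s z η =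
      chi ι r s t * hker τ (galConj τ) z ^ k := by
    intro r s η hη z
    obtain ⟨ho, hη⟩ := (hS η).1 hη
    rcases hη with hη | hη
    · obtain rfl : η = t := Subtype.ext hη
      rw [term, ← coe_galConj hτ ho, hη]
    · have hη' : η = galConj t := Subtype.ext (hη.trans hconj)
      have hchi : chi ι r s η = -chi ι r s t := by
        rw [hη', chi, chi, (galConj_props (natDegree_of_mem_orb hτ hto)).2,
          orient_swap, orient_swap (ι t) _ s]
        push_cast
        ring
      rw [term, ← coe_galConj hτ ho, hη, hτ.galConj_galConj, hker_swap, hk.neg_pow, hchi]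
      ring
  -- If τ' lies in the orbit of τ, its term contributes too. For odd `k` both `chi` and h^k change
  -- sign, so it equals the term of τ and the two add up instead of cancelling.
  refine ⟨S.card, ?_, fun r s w hw ↦ ?_⟩
  · exact_mod_cast (Finset.card_pos.2 ⟨t, htS⟩).ne'
  · refine (h r s w hw).congr (.of_forall fun z ↦ ?_)
    simp only
    rw [Finset.sum_congr rfl fun η hη ↦ hterm r s η hη z, Finset.sum_const, nsmul_eq_mul]
    ring

/-- The fixed form of `g` gives ωω' the value -g₀₁/g₁₀, which is negative under the sign condition.
-/
theorem chi_ne_zero_of_fix {g : Matrix.SpecialLinearGroup (Fin 2) ℤ}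
    (hg : mob (toQ g) τ = τ) (hpos : 0 < g 1 0 * g 0 1) :
    chi ι (pt 0 1) (pt 1 0) (IntermediateField.AdjoinSimple.gen ℚ τ) ≠ 0 := by
  set t := IntermediateField.AdjoinSimple.gen ℚ τ with ht
  have hto := gen_mem_orb τ
  have hc : g 1 0 ≠ 0 := by rintro h; simp [h] at hpos
  set Q : QForm := ⟨g 1 0, g 1 1 - g 0 0, -g 0 1⟩ with hQ
  have hroot : Q.eval τ = 0 := by
    rw [QForm.eval, ← fixForm_root hτ.1 hg]
    simp only [hQ]
    push_cast
    ring
  have hK : Q.eval t = 0 := by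
    apply (emb τ).injective
    change emb τ _ = emb τ _
    rw [map_zero, ← hroot]
    simp only [QForm.eval, map_add, map_mul, map_pow, map_intCast]
    rfl
  have hR : Q.eval (ι t) = 0 := by
    rw [← map_zero ι, ← hK]
    simp [QForm.eval]
  have h := map_galConj ι (natDegree_of_mem_orb hτ hto)
  have hprod := (quad_galConj h.1 hc hR).2
  rw [h.2] at hprod
  simp only [hQ] at hprod
  have hneg : ι t * ι (galConj t) < 0 := by
    have hpos' : (0 : ℝ) < g 1 0 * g 0 1 := by exact_mod_cast hpos
    have hc2 : (0 : ℝ) < (g 1 0 : ℝ) ^ 2 := by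
      have : (g 1 0 : ℝ) ≠ 0 := by exact_mod_cast hc
      positivity
    have : (g 1 0 : ℝ) ^ 2 * (ι t * ι (galConj t)) < 0 := by
      have e : (g 1 0 : ℝ) ^ 2 * (ι t * ι (galConj t)) = -(g 1 0 * g 0 1) := by
        push_cast at hprod
        linear_combination (g 1 0 : ℝ) * hprod
      rw [e]
      linarith
    exact neg_of_mul_neg_right this hc2.le
  rw [pt_zero_one, pt_one_zero, chi_zero_infty hτ ι hto, crossing]
  rcases mul_neg_iff.1 hneg with ⟨h1, h2⟩ | ⟨h1, h2⟩
  · rw [if_neg (fun h ↦ absurd h.1 (not_lt.2 h1.le)), if_pos ⟨h2, h1⟩]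
    norm_num
  · rw [if_pos ⟨h1, h2⟩]
    norm_num

end

/-! ### Analytic representatives of cocycles without poles -/

theorem eq_of_eventuallyEq_nhdsNE {f g : ℂ_[p] → ℂ_[p]} {z : ℂ_[p]} (hf : ContinuousAt f z)
    (hg : ContinuousAt g z) (h : f =ᶠ[𝓝[≠] z] g) : f z = g z :=
  tendsto_nhds_unique (hf.tendsto.mono_left nhdsWithin_le_nhds)
    ((hg.tendsto.mono_left nhdsWithin_le_nhds).congr' h.symm)

/-- The extension of `f` by continuity. -/
def contExt (f : ℂ_[p] → ℂ_[p]) (z : ℂ_[p]) : ℂ_[p] := limUnder (𝓝[≠] z) f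

theorem contExt_eq {f g : ℂ_[p] → ℂ_[p]} {z : ℂ_[p]} (hg : ContinuousAt g z)
    (h : f =ᶠ[𝓝[≠] z] g) : contExt f z = g z :=
  ((hg.tendsto.mono_left nhdsWithin_le_nhds).congr' h.symm).limUnder_eq

/-- On each affinoid there is an analytic function agreeing with `f` off a finite set; extension by
continuity is independent of these choices, so one function serves all affinoids. -/
theorem contExt_props {f : ℂ_[p] → ℂ_[p]} (hf : IsRigidMeromorphic p f)
    (hreg : ∀ w ∈ Hp p, Reg f w) :
    IsRigidAnalytic p (contExt f) ∧ MerEq p f (contExt f) := by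
  have key : ∀ n, ∃ g, IsAnalyticOnAffinoid p n g ∧ {z | z ∈ affinoid p n ∧ f z ≠ g z}.Finite ∧
      ∀ z ∈ affinoid p n, contExt f z = g z := by
    intro n
    obtain ⟨q, hq, g, hg, hfin⟩ := hf n
    obtain ⟨g', hg', hfin'⟩ := exists_analytic_of_reg
      (fun w hw ↦ hreg w (affinoid_subset_Hp n hw)) q hq g hg hfin
    exact ⟨g', hg', hfin', fun z hz ↦ contExt_eq (hg'.analyticAt hz).continuousAt
      (eventually_of_finite hz (P := fun z ↦ f z = g' z) hfin')⟩
  constructor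
  · intro n
    obtain ⟨g, hg, -, h⟩ := key n
    exact hg.congr fun z hz ↦ (h z hz).symm
  · intro n
    obtain ⟨g, -, hfin, h⟩ := key n
    refine hfin.subset ?_
    rintro z ⟨hz, hne⟩
    exact ⟨hz, by rwa [← h z hz]⟩

theorem IsRigidAnalytic.continuousAt {f : ℂ_[p] → ℂ_[p]} (hf : IsRigidAnalytic p f)
    {z : ℂ_[p]} (hz : z ∈ Hp p) : ContinuousAt f z := by
  obtain ⟨n, hn⟩ := exists_mem_affinoid hz
  exact ((hf n).analyticAt hn).continuousAt

/-- The cocycle identities hold in punctured neighbourhoods and pass to the centres by continuity.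
-/
theorem IsMeromorphicCocycle.isAnalyticCocycle_contExt {W : ℕ}
    {J : OnePoint ℚ → OnePoint ℚ → ℂ_[p] → ℂ_[p]} (hJ : IsMeromorphicCocycle p W J)
    (hreg : ∀ w ∈ Hp p, ∀ r s, Reg (J r s) w) :
    IsAnalyticCocycle p W fun r s ↦ contExt (J r s) := by
  have hA : ∀ r s, IsRigidAnalytic p (contExt (J r s)) := fun r s ↦
    (contExt_props (hJ.meromorphic r s) fun w hw ↦ hreg w hw r s).1
  have hE : ∀ r s, ∀ z ∈ Hp p, J r s =ᶠ[𝓝[≠] z] contExt (J r s) := fun r s z hz ↦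
    (contExt_props (hJ.meromorphic r s) fun w hw ↦ hreg w hw r s).2.eventuallyEq hz
  refine ⟨hA, fun r s z hz ↦ ?_, fun r s t z hz ↦ ?_, fun γ hγ r s z hz ↦ ?_⟩
  · refine eq_of_eventuallyEq_nhdsNE ((hA r s).continuousAt hz)
      ((hA s r).continuousAt hz).neg ?_
    exact (hE r s z hz).symm.trans (((hJ.antisymm r s).eventuallyEq hz).trans (hE s r z hz).neg)
  · refine eq_of_eventuallyEq_nhdsNE (((hA r s).continuousAt hz).add ((hA s t).continuousAt hz))
      ((hA r t).continuousAt hz) ?_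
    exact ((hE r s z hz).add (hE s t z hz)).symm.trans
      (((hJ.add r s t).eventuallyEq hz).trans (hE r t z hz))
  · refine eq_of_eventuallyEq_nhdsNE ?_ ((hA r s).continuousAt hz) ?_
    · have h1 : ContinuousAt (fun z ↦ contExt (J (actP1 γ r) (actP1 γ s)) (mob γ z)) z :=
        ContinuousAt.comp (g := contExt (J (actP1 γ r) (actP1 γ s))) (f := mob γ) ((hA _ _).continuousAt (mob_mem_Hp γ hz))
          (analyticAt_mob γ hz).continuousAt
      exact (((analyticAt_aut γ z).continuousAt.pow W).inv₀
        (pow_ne_zero _ (aut_ne_zero_of_mem_Hp γ hz))).mul h1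
    · refine EventuallyEq.trans ?_ (((hJ.invariant γ hγ r s).eventuallyEq hz).trans (hE r s z hz))
      filter_upwards [(tendsto_mob γ hz).eventually
        (hE (actP1 γ r) (actP1 γ s) _ (mob_mem_Hp γ hz))] with y hy
      rw [slash_apply, slash_apply, hy]

/-! ### The decomposition -/

/-- A balanced pole of a cocycle is removed by subtracting a multiple of the cocycle of an orbit,
without creating new poles. -/
theorem IsMeromorphicCocycle.exists_remove_pole {k : ℕ} (hk : Odd k)
    {J : OnePoint ℚ → OnePoint ℚ → ℂ_[p] → ℂ_[p]} (hJ : IsMeromorphicCocycle p (2 * k) J)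
    (hb : Balanced k (J (pt 0 1) (pt 1 0))) {τ : ℂ_[p]} (hτ : τ ∈ Hp p)
    (hpole : ¬Reg (J (pt 0 1) (pt 1 0)) τ) :
    IsRM τ ∧ ∀ ι : fieldOf τ →ₐ[ℚ] ℝ, ∃ c : ℂ_[p],
      Reg (fun z ↦ J (pt 0 1) (pt 1 0) z - c * orbCocycle k τ ι (pt 0 1) (pt 1 0) z) τ ∧
      ∀ w ∈ Hp p, Reg (J (pt 0 1) (pt 1 0)) w →
        Reg (fun z ↦ J (pt 0 1) (pt 1 0) z - c * orbCocycle k τ ι (pt 0 1) (pt 1 0) z) w := by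
  obtain ⟨g, hg, htr, hpos⟩ := hJ.regSystem.exists_fix hτ hpole
  have hRM := isRM_of_fix hτ hg hpos
  refine ⟨hRM, fun ι ↦ ?_⟩
  obtain ⟨e, he, hprin⟩ := exists_principal_self hRM ι hk
  have hchi := chi_ne_zero_of_fix hRM ι hg hpos
  set χ := chi ι (pt 0 1) (pt 1 0) (IntermediateField.AdjoinSimple.gen ℚ τ)
  obtain ⟨b, hb1, hb2⟩ := hb τ hRM
  -- Matches the principal parts at τ; by balance the same constant works at τ'.
  set c := b / (e * χ) with hc
  have hcb : c * (e * χ) = b := div_mul_cancel₀ _ (mul_ne_zero he hchi)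
  have hJ' := hJ.sub_const_mul (isMeromorphicCocycle_orbCocycle hRM ι hk.pos.ne') c
  have hR := hJ'.regSystem
  have hloc : ∀ w, w = τ ∨ w = galConj τ →
      Reg (fun z ↦ J (pt 0 1) (pt 1 0) z - c * orbCocycle k τ ι (pt 0 1) (pt 1 0) z) w := by
    intro w hw
    have h1 : Reg (fun z ↦ J (pt 0 1) (pt 1 0) z - b * hker τ (galConj τ) z ^ k) w := by
      rcases hw with rfl | rfl
      exacts [hb1, hb2]
    refine (h1.sub ((hprin (pt 0 1) (pt 1 0) w hw).const_mul c)).congr (.of_forall fun z ↦ ?_)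
    simp only [Pi.sub_apply]
    linear_combination hker τ (galConj τ) z ^ k * hcb
  have hall : ∀ w, w = τ ∨ w = galConj τ → ∀ r s,
      Reg (fun z ↦ J r s z - c * orbCocycle k τ ι r s z) w := by
    intro w hw r s
    have h1 := hloc w hw
    rcases hw with rfl | rfl
    · exact hR.reg_of_fix hτ hg hpos h1 r s
    · exact hR.reg_of_fix hRM.galConj.1 (mob_galConj_of_mob hRM hg) hpos h1 r s
  refine ⟨c, hloc _ (Or.inl rfl), fun w hw hreg ↦ ?_⟩
  -- On the two orbits, regularity of all values at τ and τ' is transported by equivariance. Off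
  -- them the orbit cocycle is itself regular.
  by_cases hex : ∃ γ ∈ ihara p, w = mob γ τ ∨ w = mob γ (galConj τ)
  · obtain ⟨γ, hγ, h⟩ := hex
    obtain ⟨u, hu, rfl⟩ : ∃ u, (u = τ ∨ u = galConj τ) ∧ w = mob γ u := by
      rcases h with h | h
      · exact ⟨τ, Or.inl rfl, h⟩
      · exact ⟨_, Or.inr rfl, h⟩
    have huH : u ∈ Hp p := by
      rcases hu with rfl | rfl
      exacts [hτ, hRM.galConj.1]
    have h1 := hR.equiv γ hγ u huH (actP1 γ⁻¹ (pt 0 1)) (actP1 γ⁻¹ (pt 1 0))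
    rw [← actP1_mul, ← actP1_mul, mul_inv_cancel, actP1_one, actP1_one] at h1
    exact h1.1 (hall u hu _ _)
  · have h1 := reg_orbCocycle_sub hRM ι hk.pos.ne' (pt 0 1) (pt 1 0) hw ∅ (fun ω hω h ↦ ?_)
      (by simp)
    · simp only [Finset.sum_empty, sub_zero] at h1
      exact hreg.sub (h1.const_mul c)
    · exfalso
      apply hex
      obtain ⟨γ, hγ, hωγ⟩ := id hω
      refine ⟨γ, hγ, h.imp (fun h ↦ by rw [h, hωγ, moebius_eq_mob]) fun h ↦ ?_⟩
      rw [h, ← coe_galConj hRM hω, hωγ, moebius_eq_mob, (galConj_mob γ hRM.natDegree).2]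

/-- Balanced cocycles are linear combinations of the cocycles of orbits up to an analytic
cocycle. -/
theorem IsMeromorphicCocycle.exists_decomposition {k : ℕ} (hk : Odd k)
    (ι : ∀ τ : RMPoint p, fieldOf (τ : ℂ_[p]) →ₐ[ℚ] ℝ) (N : ℕ)
    {J : OnePoint ℚ → OnePoint ℚ → ℂ_[p] → ℂ_[p]} (hJ : IsMeromorphicCocycle p (2 * k) J)
    (hb : Balanced k (J (pt 0 1) (pt 1 0)))
    (hN : {w | w ∈ affinoid p 1 ∧ ¬Reg (J (pt 0 1) (pt 1 0)) w}.ncard ≤ N) :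
    ∃ (c : RMPoint p →₀ ℂ_[p]) (J' : OnePoint ℚ → OnePoint ℚ → ℂ_[p] → ℂ_[p]),
      IsAnalyticCocycle p (2 * k) J' ∧ MerEq p (J (pt 0 1) (pt 1 0)) fun z ↦
        (c.sum fun τ a ↦ a * orbCocycle k (τ : ℂ_[p]) (ι τ) (pt 0 1) (pt 1 0) z) +
          J' (pt 0 1) (pt 1 0) z := by
  classical
  have hfin : ∀ {J : OnePoint ℚ → OnePoint ℚ → ℂ_[p] → ℂ_[p]}, IsMeromorphicCocycle p (2 * k) J →
      {w | w ∈ affinoid p 1 ∧ ¬Reg (J (pt 0 1) (pt 1 0)) w}.Finite := fun hJ ↦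
    hJ.regSystem.finite 1
  induction N generalizing J with
  | zero =>
    have hempty := (Set.ncard_eq_zero (hfin hJ)).1 (Nat.le_zero.1 hN)
    have hreg : ∀ w ∈ Hp p, ∀ r s, Reg (J r s) w := fun w hw r s ↦
      hJ.regSystem.reg_of_reg_affinoid_one (fun w hw ↦ by
        by_contra h
        have : w ∈ {w | w ∈ affinoid p 1 ∧ ¬Reg (J (pt 0 1) (pt 1 0)) w} := ⟨hw, h⟩
        rw [hempty] at this
        exact this) hw r s
    refine ⟨0, _, hJ.isAnalyticCocycle_contExt hreg, ?_⟩
    simpa using (contExt_props (hJ.meromorphic (pt 0 1) (pt 1 0)) fun w hw ↦ hreg w hw _ _).2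
  | succ N ih =>
    by_cases hne : {w | w ∈ affinoid p 1 ∧ ¬Reg (J (pt 0 1) (pt 1 0)) w} = ∅
    · exact ih hJ hb (by rw [hne, Set.ncard_empty]; exact Nat.zero_le _)
    obtain ⟨τ, hτ, hpole⟩ := Set.nonempty_iff_ne_empty.2 hne
    obtain ⟨hRM, hrem⟩ := hJ.exists_remove_pole hk hb (affinoid_subset_Hp 1 hτ) hpole
    obtain ⟨a, h1, h2⟩ := hrem (ι ⟨τ, hRM⟩)
    have hJ₂ := hJ.sub_const_mul
      (isMeromorphicCocycle_orbCocycle hRM (ι ⟨τ, hRM⟩) hk.pos.ne') a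
    obtain ⟨c, J', hJ', heq⟩ := ih hJ₂
      (hb.sub_const_mul (balanced_orbCocycle hRM _ hk.pos.ne' _ _) a) (by
        -- The new poles in the affinoid are among the old ones, and τ is no longer one of them.
        refine Nat.le_of_lt_succ (lt_of_lt_of_le (Set.ncard_lt_ncard ?_ (hfin hJ)) hN)
        refine ⟨?_, ?_⟩
        · rintro w ⟨hw, hnr⟩
          exact ⟨hw, fun hr ↦ hnr (h2 w (affinoid_subset_Hp 1 hw) hr)⟩
        · intro hsub
          exact (hsub ⟨hτ, hpole⟩).2 h1)
    refine ⟨c + Finsupp.single ⟨τ, hRM⟩ a, J', hJ', fun n ↦ (heq n).subset ?_⟩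
    rintro z ⟨hz, hne⟩
    refine ⟨hz, fun h ↦ hne ?_⟩
    simp only at h ⊢
    rw [Finsupp.sum_add_index' (by simp) (by intros; ring), Finsupp.sum_single_index (by simp)]
    linear_combination h

end RigidCocycle

end

theorem mainTheorem8 (p : ℕ) [Fact p.Prime] (k : ℕ) (hk : Odd k)
    (ι : ∀ τ : RigidCocycle.RMPoint p, RigidCocycle.fieldOf (τ : ℂ_[p]) →ₐ[ℚ] ℝ)
    (φ : ℂ_[p] → ℂ_[p]) (hφ : RigidCocycle.IsMeromorphicPeriod p (2 * k) φ)
    (hpole : ∀ τ : ℂ_[p], RigidCocycle.IsRM τ → RigidCocycle.IsPole φ τ →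
      RigidCocycle.IsPole φ (RigidCocycle.galConj τ) ∧
      ∃ r : ℂ_[p], RigidCocycle.HasResidueAt φ τ r ∧
        RigidCocycle.HasResidueAt φ (RigidCocycle.galConj τ) (-r)) :
    (∀ τ : RigidCocycle.RMPoint p, ∀ z ∈ RigidCocycle.Hp p,
      Summable (RigidCocycle.phiTerm k (τ : ℂ_[p]) (ι τ) z)) ∧
    ∃ (c : RigidCocycle.RMPoint p →₀ ℂ_[p]) (ψ : ℂ_[p] → ℂ_[p]),
      RigidCocycle.IsAnalyticPeriod p (2 * k) ψ ∧
      RigidCocycle.MerEq p φ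
        (fun z => (c.sum fun τ a => a * RigidCocycle.phi k (τ : ℂ_[p]) (ι τ) z) + ψ z) := by
  open RigidCocycle in
  have hk0 : k ≠ 0 := hk.pos.ne'
  refine ⟨fun τ z hz ↦ (summable_phiTerm τ.2 (ι τ) hk0 hz).1, ?_⟩
  obtain ⟨J, hJ, hφJ⟩ := hφ
  -- Poles and residues depend only on punctured neighbourhoods, so the hypotheses on φ pass to
  -- J{0,∞}.
  rw [← pt_zero_one, ← pt_one_zero] at hφJ
  have hpoleJ : ∀ w ∈ Hp p, (IsPole φ w ↔ IsPole (J (pt 0 1) (pt 1 0)) w) := fun w hw ↦ by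
    rw [IsPole, IsPole, meromorphicOrderAt_congr (hφJ.eventuallyEq hw)]
  have hb : Balanced k (J (pt 0 1) (pt 1 0)) := by
    refine hJ.balanced_of_residues hk fun τ hτ hp ↦ ?_
    obtain ⟨h1, r, h2, h3⟩ := hpole τ hτ ((hpoleJ τ hτ.1).2 hp)
    exact ⟨(hpoleJ _ hτ.galConj.1).1 h1, r, h2.congr (hφJ.eventuallyEq hτ.1),
      h3.congr (hφJ.eventuallyEq hτ.galConj.1)⟩
  obtain ⟨c, J', hJ', heq⟩ := hJ.exists_decomposition hk ι _ hb le_rfl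
  refine ⟨c, J' (pt 0 1) (pt 1 0), ⟨J', hJ', ?_⟩, fun n ↦ ((hφJ n).union (heq n)).subset ?_⟩
  · rw [pt_zero_one, pt_one_zero]
    exact fun z _ ↦ rfl
  · rintro z ⟨hz, hne⟩
    by_contra hcon
    simp only [Set.mem_union, Set.mem_ofPred_eq, not_or, not_and, not_not] at hcon
    refine hne ?_
    rw [hcon.1 hz, hcon.2 hz, pt_zero_one, pt_one_zero]
    congr 1
    refine Finsupp.sum_congr fun τ _ ↦ ?_
    rw [(summable_phiTerm τ.2 (ι τ) hk0 (affinoid_subset_Hp n hz)).2]
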